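/- Let $\alpha,\lambda\in\mathbb R$, let $\gamma,\sigma\ge 1$ be integers, and put $g(s)=\alpha s^\gamma$, $f(s)=\lambda s^\sigma$. For $w\ge 0$, $\ell\ge 0$ let $\mathcal H_w^\ell=\{\psi\in L^2(\mathbb R):\|\psi\|_{\mathcal H_w^\ell}<\infty\}$, where $$\|\psi\|_{\mathcal H_w^\ell}^2=\int_{\mathbb R}\langle\xi\rangle^{2\ell}e^{2w\langle\xi\rangle}|\hat\psi(\xi)|^2\,d\xi,\qquad \langle\xi\rangle=\sqrt{1+\xi^2},\qquad \hat\psi(\xi)=\frac1{\sqrt{2\pi}}\int_{\mathbb R}e^{-ix\xi}\psi(x)\,dx .$$ For $w_0,M,T>0$ with $T<w_0/M$ put $w(t)=w_0-Mt$. Let $Y_{w,T}^\ell$ be the space of all $\psi$ such that $t\mapsto\mathcal F^{-1}\big(e^{w(t)\langle\xi\rangle}\hat\psi(t)\big)$ is continuous from $[0,T]$ to the Sobolev space $H^\ell(\mathbb R)$ and $\int_0^T\|\psi(t)\|^2_{\mathcal H_{w(t)}^{\ell+1/2}}dt<\infty$; let $X_{w,T}^\ell=Y_{w,T}^{\ell+1}\times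 Y_{w,T}^\ell$, and $$|||\psi|||_{\ell,T}^2=\max\Big(\sup_{0\le s\le T}\|\psi(s)\|^2_{\mathcal H_{w(s)}^\ell},\ 2M\int_0^T\|\psi(s)\|^2_{\mathcal H_{w(s)}^{\ell+1/2}}ds\Big).$$ For $\varepsilon\in[0,1]$ and initial data $(\varphi_0,b_0)$, with $\varphi_0$ real-valued and $b_0$ complex-valued, consider on $[0,T]\times\mathbb R$ the system $$(S_\varepsilon)\quad\begin{cases}\partial_t\varphi+\frac12(\partial_x\varphi)^2+\frac12 g(|b|^2)\partial_x\varphi+f(|b|^2)=0, & \varphi_{|t=0}=\varphi_0,\\[2pt] \partial_t b+\partial_x\varphi\,\partial_x b+\frac12 b\,\partial_x^2\varphi+\frac12\partial_x\big(g(|b|^2)b\big)=\frac{i\varepsilon}2\partial_x^2 b, & b_{|t=0}=b_0,\end{cases}$$ with $\varphi$ real-valued and $b$ complex-valued. Theorem 2. Let $w_0>0$, $\ell>1$, $(\phi_0,a_0)\in\mathcal H_{w_0}^{\ell+2}\times\mathcal H_{w_0}^{\ell+1}$, and let $(\phi_0^\varepsilon,a_0^\varepsilon)_{\varepsilon\in(0,1]}$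 be bounded in $\mathcal H_{w_0}^{\ell+1}\times\mathcal H_{w_0}^{\ell}$ (the phases $\phi_0,\phi_0^\varepsilon$ being real-valued), such that $$r_0^\varepsilon:=\|\phi_0^\varepsilon-\phi_0\|_{\mathcal H_{w_0}^{\ell+1}}+\|a_0^\varepsilon-a_0\|_{\mathcal H_{w_0}^{\ell}}\to 0\quad\text{as }\varepsilon\to 0.$$ Then there is $M_0>0$, independent of $\varepsilon$, such that for all $M\ge M_0$ and all $0<T<w_0/M$, with $w(t)=w_0-Mt$: the limiting system $(S_0)$ with data $(\phi_0,a_0)$ has a unique solution $(\phi,a)\in X_{w,T}^{\ell+1}$; for every $\varepsilon\in(0,1]$ the system $(S_\varepsilon)$ with data $(\phi_0^\varepsilon,a_0^\varepsilon)$ has a unique solution $(\phi^\varepsilon,a^\varepsilon)\in X_{w,T}^{\ell}$; and there is $C>0$, independent of $\varepsilon$, such that for all $\varepsilon\in(0,1]$ $$|||\phi^\varepsilon-\phi|||_{\ell+1,T}+|||a^\varepsilon-a|||_{\ell,T}\le C\,(r_0^\varepsilon+\varepsilon).$$ -/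

import Mathlib

open MeasureTheory Set Filter Topology
open scoped ENNReal FourierTransform

noncomputable section

namespace WKB

/-- The Japanese bracket `⟨ξ⟩ = √(1 + ξ²)`. -/
def bracket (ξ : ℝ) : ℝ := √(1 + ξ ^ 2)

open scoped Classical in
/-- The Fourier transform on `L²(ℝ)` in the unitary, angular-frequency normalization
`ψ̂(ξ) = (2π)^(-1/2) ∫ e^(-ixξ) ψ(x) dx`. It is obtained from the `L²` (Plancherel) Fourier transform
of Mathlib, whose kernel is `e^(-2πixη)`, by the substitution `η = ξ / 2π`. (The value is
`0` if `ψ` is not in `L²`; such functions have infinite `hNorm` below.) -/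
def fourierL2 (ψ : ℝ → ℂ) (ξ : ℝ) : ℂ :=
  if h : MemLp ψ 2 (volume : Measure ℝ) then
    (((√(2 * Real.pi))⁻¹ : ℝ) : ℂ) * (𝓕 (h.toLp ψ) : Lp ℂ 2 (volume : Measure ℝ)) (ξ / (2 * Real.pi))
  else 0

open scoped Classical in
/-- The norm of the analytic space `𝓗_w^ℓ`, with values in `[0, ∞]`:
`‖ψ‖² = ∫ ⟨ξ⟩^(2ℓ) e^(2w⟨ξ⟩) |ψ̂(ξ)|² dξ` for `ψ ∈ L²(ℝ)`, and `∞` for `ψ ∉ L²(ℝ)`. -/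
def hNorm (w ℓ : ℝ) (ψ : ℝ → ℂ) : ℝ≥0∞ :=
  if MemLp ψ 2 (volume : Measure ℝ) then
    (∫⁻ ξ : ℝ, ENNReal.ofReal
      (bracket ξ ^ (2 * ℓ) * Real.exp (2 * w * bracket ξ) * ‖fourierL2 ψ ξ‖ ^ 2)) ^ (1 / 2 : ℝ)
  else ∞

/-- `ψ ∈ 𝓗_w^ℓ`. -/
def MemH (w ℓ : ℝ) (ψ : ℝ → ℂ) : Prop := hNorm w ℓ ψ < ∞

/-- `ψ ∈ C([0,T], 𝓗_w^ℓ)` for a time-dependent weight `w = w(t)`: every `ψ(t)` belongs to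
`𝓗_{w(t)}^ℓ`, and `t ↦ 𝓕⁻¹(e^(w(t)⟨ξ⟩) ψ̂(t))` is continuous from `[0,T]` to the Sobolev space
`H^ℓ`, i.e. for the norm `(∫ ⟨ξ⟩^(2ℓ) |·|² dξ)^(1/2)` of the Fourier transform. -/
def MemCH (w : ℝ → ℝ) (T ℓ : ℝ) (ψ : ℝ → ℝ → ℂ) : Prop :=
  (∀ t ∈ Icc 0 T, MemH (w t) ℓ (ψ t)) ∧
  ∀ t ∈ Icc 0 T, Tendsto
    (fun s : ℝ => ∫⁻ ξ : ℝ, ENNReal.ofReal (bracket ξ ^ (2 * ℓ) *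
      ‖(Real.exp (w s * bracket ξ) : ℂ) * fourierL2 (ψ s) ξ
        - (Real.exp (w t * bracket ξ) : ℂ) * fourierL2 (ψ t) ξ‖ ^ 2))
    (𝓝[Icc 0 T] t) (𝓝 0)

/-- `Y_{w,T}^ℓ = C([0,T], 𝓗_w^ℓ) ∩ L²([0,T], 𝓗_w^(ℓ+1/2))`. -/
def MemY (w : ℝ → ℝ) (T ℓ : ℝ) (ψ : ℝ → ℝ → ℂ) : Prop :=
  MemCH w T ℓ ψ ∧ ∫⁻ t in Icc 0 T, hNorm (w t) (ℓ + 1 / 2) (ψ t) ^ 2 < ∞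

/-- `(φ, a) ∈ X_{w,T}^ℓ = Y_{w,T}^(ℓ+1) × Y_{w,T}^ℓ`, where the phase `φ` is real valued and the
amplitude `a` is complex valued. -/
def MemX (w : ℝ → ℝ) (T ℓ : ℝ) (φ : ℝ → ℝ → ℝ) (a : ℝ → ℝ → ℂ) : Prop :=
  MemY w T (ℓ + 1) (fun t x => (φ t x : ℂ)) ∧ MemY w T ℓ a

/-- The linearly decreasing weight `w(t) = w₀ - M t`. -/
def weight (w₀ M t : ℝ) : ℝ := w₀ - M * t

/-- The norm `|||ψ|||_{ℓ,T}` for the weight `w(t) = w₀ - M t`, with values in `[0, ∞]`: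
`|||ψ|||² = max (sup_{0 ≤ s ≤ T} ‖ψ(s)‖²_{𝓗_{w(s)}^ℓ}, 2M ∫₀^T ‖ψ(s)‖²_{𝓗_{w(s)}^(ℓ+1/2)} ds)`. -/
def tripleNorm (w₀ M ℓ T : ℝ) (ψ : ℝ → ℝ → ℂ) : ℝ≥0∞ :=
  (max (⨆ s ∈ Icc 0 T, hNorm (weight w₀ M s) ℓ (ψ s) ^ 2)
    (ENNReal.ofReal (2 * M) *
      ∫⁻ s in Icc 0 T, hNorm (weight w₀ M s) (ℓ + 1 / 2) (ψ s) ^ 2)) ^ (1 / 2 : ℝ)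

/-- The nonlinearities `f(s) = λ s^σ` and `g(s) = α s^γ`. -/
structure Nonlinearity where
  /-- the coefficient of `g` -/
  α : ℝ
  /-- the coefficient of `f` -/
  lam : ℝ
  /-- the exponent of `g` -/
  γ : ℕ
  /-- the exponent of `f` -/
  σ : ℕ
  γ_pos : 1 ≤ γ
  σ_pos : 1 ≤ σ

/-- `f(s) = λ s^σ`. -/
def Nonlinearity.f (N : Nonlinearity) (s : ℝ) : ℝ := N.lam * s ^ N.σ

/-- `g(s) = α s^γ`. -/
def Nonlinearity.g (N : Nonlinearity) (s : ℝ) : ℝ := N.α * s ^ N.γ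

/-- `(φ, a)` is a (classical) solution on `[0,T] × ℝ` of
```
∂ₜφ + ½ (∂ₓφ)² + ½ g(|a|²) ∂ₓφ + f(|a|²) = 0,                     φ(0) = φ₀,
∂ₜa + ∂ₓφ ∂ₓa + ½ a ∂ₓ²φ + ½ ∂ₓ(g(|a|²) a) = (iε/2) ∂ₓ²a,         a(0) = a₀.
```
The time derivatives are one-sided at `t = 0` and `t = T`. The initial data are elements of `L²`,
so they are attained almost everywhere. For `ε = 0` this is the limiting (eikonal/transport)
system. -/
structure IsSolution (N : Nonlinearity) (ε T : ℝ) (φ₀ : ℝ → ℝ) (a₀ : ℝ → ℂ)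
    (φ : ℝ → ℝ → ℝ) (a : ℝ → ℝ → ℂ) : Prop where
  contDiff_phase : ∀ t ∈ Icc 0 T, ContDiff ℝ 2 (φ t)
  contDiff_amplitude : ∀ t ∈ Icc 0 T, ContDiff ℝ 2 (a t)
  phase_eq : ∀ t ∈ Icc 0 T, ∀ x : ℝ, ∃ φ' : ℝ,
    HasDerivWithinAt (fun s => φ s x) φ' (Icc 0 T) t ∧
    φ' + 1 / 2 * deriv (φ t) x ^ 2 + 1 / 2 * N.g (‖a t x‖ ^ 2) * deriv (φ t) x
      + N.f (‖a t x‖ ^ 2) = 0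
  amplitude_eq : ∀ t ∈ Icc 0 T, ∀ x : ℝ, ∃ a' : ℂ,
    HasDerivWithinAt (fun s => a s x) a' (Icc 0 T) t ∧
    a' + ((deriv (φ t) x : ℝ) : ℂ) * deriv (a t) x
      + 1 / 2 * a t x * ((deriv (deriv (φ t)) x : ℝ) : ℂ)
      + 1 / 2 * deriv (fun y => (N.g (‖a t y‖ ^ 2) : ℂ) * a t y) x
      = Complex.I * (ε : ℂ) / 2 * deriv (deriv (a t)) x
  phase_init : φ 0 =ᵐ[volume] φ₀
  amplitude_init : a 0 =ᵐ[volume] a₀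

/-- `(φ, a)` is the unique solution in `X_{w,T}^ℓ` with parameter `ε`: it is a solution in this
space and every solution in this space coincides with it on `[0,T] × ℝ`. -/
def IsTheSolution (N : Nonlinearity) (ε : ℝ) (w : ℝ → ℝ) (T ℓ : ℝ) (φ₀ : ℝ → ℝ) (a₀ : ℝ → ℂ)
    (φ : ℝ → ℝ → ℝ) (a : ℝ → ℝ → ℂ) : Prop :=
  MemX w T ℓ φ a ∧ IsSolution N ε T φ₀ a₀ φ a ∧
  ∀ (ψ : ℝ → ℝ → ℝ) (b : ℝ → ℝ → ℂ), MemX w T ℓ ψ b → IsSolution N ε T φ₀ a₀ ψ b →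
    ∀ t ∈ Icc 0 T, ψ t = φ t ∧ b t = a t

/-- The size `r₀^ε = ‖φ₀^ε - φ₀‖_{𝓗_{w₀}^(ℓ+1)} + ‖a₀^ε - a₀‖_{𝓗_{w₀}^ℓ}` of the error on the
initial data. -/
def dataError (w₀ ℓ : ℝ) (φ₀ : ℝ → ℝ) (a₀ : ℝ → ℂ) (φ₀' : ℝ → ℝ) (a₀' : ℝ → ℂ) : ℝ≥0∞ :=
  hNorm w₀ (ℓ + 1) (fun x => ((φ₀' x - φ₀ x : ℝ) : ℂ)) + hNorm w₀ ℓ (fun x => a₀' x - a₀ x)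

end WKB

end

/-!
The whole argument takes place on the Fourier side. A pair `(φ, a)` is written as
`φ = synth p`, `a = synth q`, the inverse Fourier integrals of coefficients `p t ξ`, `q t ξ`.
Pointwise products become convolutions, and `(S_ε)` becomes, for almost every frequency `ξ`, the
ordinary differential equation in time
`p' = -F(p, q)`, `q' = -(iεξ²/2) q - G(p, q)`.
Since `|a|² = a * conj a`, the nonlinearities `f(|a|²)` and `g(|a|²)` are polynomials, so that
`F` and `G` are finite combinations of convolutions.

*Loss and gain of a derivative.* The bound `Dom ω S s f R` says that `|f t ξ|` is at most
`e^(-ω(t)⟨ξ⟩) K ξ` for all times `t ∈ S`, with a time independent majorant `K` whose norm in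
`L²(⟨ξ⟩^(2s) dξ)` is at most `R`. As `⟨ξ + η⟩ ≤ ⟨ξ⟩ + ⟨η⟩` the exponential weight passes through
convolutions, and `F` and `G` are Lipschitz on balls as maps losing one derivative
(`LipOp.phaseOp`, `LipOp.ampOp`). If the weight `ω` decreases with slope `μ`, the integral
`∫ e^(-μ(t-τ)⟨ξ⟩) dτ ≤ 1/(μ⟨ξ⟩)` gains one derivative back, with the small factor `1/μ`
(`Dom.gain`); the dispersive term only multiplies the Duhamel formula by unimodular factors and is
harmless uniformly in `ε`. For large `μ` the Picard map is thus a contraction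
(`exists_step_bound`), and its iterates converge to a solution (`exists_fourier_solution`).

*Back to the physical space.* The construction is run with the slope `M/2`. In the faster shrinking
weight `w₀ - Mt` there remains a factor `e^(-(M/2)t⟨ξ⟩)`, whose square has time integral at most
`1/(M⟨ξ⟩)`: this is the half derivative gained in `L²` in time, and it gives membership in the
spaces `Y` and bounds of `tripleNorm` (`memY_of_dom`, `tripleNorm_le`). The exponential decay of
the coefficients makes `synth p`, `synth q` smooth classical solutions (`isSolution_of_isStep`).

*Uniqueness.* For an arbitrary solution in the class, the equations hold pointwise in `x`, which is
a weak differential equation for the coefficients; being continuous in time with values in a weighted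
`L²` space, the right-hand side turns it into a strong one in a slightly smaller weight
(`hasDerivWithinAt_of_weak_deriv`). There the dispersive term is skew-adjoint and drops out of the
energy estimate (`DomAt.energy`). The difference of two solutions is then estimated by
iteration over a finite chain of constant weights, as in the abstract Cauchy–Kovalevskaya theorem
(`CoefSol.exists_unique_step`); it vanishes on a short interval, and a continuation argument yields
`IsSolution.unique`.

*Error estimate.* The limiting solution has one more derivative than the solutions of `(S_ε)`.
Rewritten as a solution of `(S_ε)` it acquires the source `-(iε/2) ∂ₓ²a`, of size `ε` after the loss
of one derivative with respect to the space of the amplitude (`IsStep.with_source`). The contraction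
estimate with this additional source bounds the difference by `r₀^ε + ε` (`exists_error_bound`).
-/

open scoped NNReal

noncomputable section

namespace WKB

/-! ### The Japanese bracket and weighted `L²` norms of majorants -/

lemma one_le_bracket (ξ : ℝ) : 1 ≤ bracket ξ :=
  Real.one_le_sqrt.2 (by nlinarith [sq_nonneg ξ])

lemma bracket_pos (ξ : ℝ) : 0 < bracket ξ := lt_of_lt_of_le one_pos (one_le_bracket ξ)

lemma bracket_sq (ξ : ℝ) : bracket ξ ^ 2 = 1 + ξ ^ 2 := Real.sq_sqrt (by positivity)

lemma bracket_neg (ξ : ℝ) : bracket (-ξ) = bracket ξ := by simp [bracket]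

lemma abs_le_bracket (ξ : ℝ) : |ξ| ≤ bracket ξ :=
  Real.abs_le_sqrt (by nlinarith)

lemma continuous_bracket : Continuous bracket := by unfold bracket; fun_prop

lemma measurable_bracket : Measurable bracket := continuous_bracket.measurable

lemma bracket_add_le (ξ η : ℝ) : bracket (ξ + η) ≤ bracket ξ + bracket η := by
  have h1 := bracket_pos ξ
  have h2 := bracket_pos η
  have h3 : ξ * η ≤ bracket ξ * bracket η := by
    calc ξ * η ≤ |ξ| * |η| := by rw [← abs_mul]; exact le_abs_self _
      _ ≤ _ := mul_le_mul (abs_le_bracket ξ) (abs_le_bracket η) (abs_nonneg _) h1.le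
  refine (Real.sqrt_le_left (by positivity)).2 ?_
  nlinarith [bracket_sq ξ, bracket_sq η]

lemma bracket_add_le_mul (ξ η : ℝ) : bracket (ξ + η) ≤ 2 * bracket ξ * bracket η := by
  have h1 := one_le_bracket ξ
  have h2 := one_le_bracket η
  have := bracket_add_le ξ η
  nlinarith

/-- The weight `⟨ξ⟩^s` with values in `[0, ∞]`. -/
def br (s ξ : ℝ) : ℝ≥0∞ := ENNReal.ofReal (bracket ξ ^ s)

@[fun_prop]
lemma measurable_br (s : ℝ) : Measurable (br s) := by
  unfold br
  exact (measurable_bracket.pow_const s).ennreal_ofReal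

lemma br_add (s t ξ : ℝ) : br (s + t) ξ = br s ξ * br t ξ := by
  unfold br
  rw [← ENNReal.ofReal_mul (Real.rpow_nonneg (bracket_pos ξ).le _), Real.rpow_add (bracket_pos ξ)]

lemma br_zero (ξ : ℝ) : br 0 ξ = 1 := by simp [br]

lemma br_mono {s t : ℝ} (h : s ≤ t) (ξ : ℝ) : br s ξ ≤ br t ξ :=
  ENNReal.ofReal_le_ofReal (Real.rpow_le_rpow_of_exponent_le (one_le_bracket ξ) h)

lemma br_ne_zero (s ξ : ℝ) : br s ξ ≠ 0 := by
  simp [br, Real.rpow_pos_of_pos (bracket_pos ξ) s]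

lemma br_neg (s ξ : ℝ) : br s (-ξ) = br s ξ := by simp [br, bracket_neg]

lemma br_one (ξ : ℝ) : br 1 ξ = ENNReal.ofReal (bracket ξ) := by simp [br]

lemma br_sq (s ξ : ℝ) : br s ξ ^ 2 = ENNReal.ofReal (bracket ξ ^ (2 * s)) := by
  rw [br, ← ENNReal.ofReal_pow (Real.rpow_nonneg (bracket_pos ξ).le _), ← Real.rpow_natCast,
    ← Real.rpow_mul (bracket_pos ξ).le]
  congr 2
  push_cast; ring

/-- The norm of `K` in the weighted space `L²(⟨ξ⟩^(2s) dξ)`. -/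
def wNorm (s : ℝ) (K : ℝ → ℝ≥0∞) : ℝ≥0∞ := eLpNorm (fun ξ => br s ξ * K ξ) 2 volume

lemma wNorm_sq (s : ℝ) (K : ℝ → ℝ≥0∞) : wNorm s K ^ 2 = ∫⁻ ξ, (br s ξ * K ξ) ^ 2 := by
  rw [wNorm, eLpNorm_eq_lintegral_rpow_enorm_toReal (by norm_num) (by norm_num)]
  simp only [ENNReal.toReal_ofNat, enorm_eq_self]
  rw [← ENNReal.rpow_natCast, ← ENNReal.rpow_mul]
  norm_num

lemma wNorm_le_iff {s : ℝ} {K : ℝ → ℝ≥0∞} {R : ℝ≥0∞} :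
    wNorm s K ≤ R ↔ ∫⁻ ξ, (br s ξ * K ξ) ^ 2 ≤ R ^ 2 := by
  rw [← wNorm_sq]
  exact (ENNReal.pow_le_pow_left_iff (by norm_num)).symm

lemma wNorm_mono_ae {s : ℝ} {K L : ℝ → ℝ≥0∞} (h : ∀ᵐ ξ, K ξ ≤ L ξ) : wNorm s K ≤ wNorm s L := by
  refine eLpNorm_mono_enorm_ae (h.mono fun ξ hξ => ?_)
  simp only [enorm_eq_self]
  gcongr

lemma wNorm_mono {s : ℝ} {K L : ℝ → ℝ≥0∞} (h : ∀ ξ, K ξ ≤ L ξ) : wNorm s K ≤ wNorm s L :=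
  wNorm_mono_ae (ae_of_all _ h)

lemma wNorm_mono_exp {s t : ℝ} (h : s ≤ t) (K : ℝ → ℝ≥0∞) : wNorm s K ≤ wNorm t K := by
  refine eLpNorm_mono_enorm fun ξ => ?_
  simp only [enorm_eq_self]
  gcongr
  exact br_mono h ξ

lemma wNorm_br_mul (s t : ℝ) (K : ℝ → ℝ≥0∞) :
    wNorm s (fun ξ => br t ξ * K ξ) = wNorm (s + t) K := by
  simp only [wNorm, br_add, mul_assoc]

lemma wNorm_add_le {s : ℝ} {K L : ℝ → ℝ≥0∞} (hK : Measurable K) (hL : Measurable L) :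
    wNorm s (fun ξ => K ξ + L ξ) ≤ wNorm s K + wNorm s L := by
  have h : (fun ξ => br s ξ * (K ξ + L ξ)) = (fun ξ => br s ξ * K ξ) + fun ξ => br s ξ * L ξ := by
    ext ξ; simp [mul_add]
  rw [wNorm, h]
  exact eLpNorm_add_le (Measurable.aestronglyMeasurable (by fun_prop))
    (Measurable.aestronglyMeasurable (by fun_prop)) (by norm_num)

lemma wNorm_const_mul {s : ℝ} {K : ℝ → ℝ≥0∞} (c : ℝ≥0∞) (hK : Measurable K) :
    wNorm s (fun ξ => c * K ξ) = c * wNorm s K := by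
  have h : wNorm s (fun ξ => c * K ξ) ^ 2 = (c * wNorm s K) ^ 2 := by
    rw [mul_pow, wNorm_sq, wNorm_sq, ← lintegral_const_mul _ (by fun_prop)]
    congr 1; ext ξ; ring
  exact (ENNReal.pow_right_strictMono (n := 2) (by norm_num)).injective h

lemma wNorm_comp_neg {s : ℝ} {K : ℝ → ℝ≥0∞} (hK : Measurable K) :
    wNorm s (fun ξ => K (-ξ)) = wNorm s K := by
  have h : (fun ξ => br s ξ * K (-ξ)) = (fun ξ => br s ξ * K ξ) ∘ fun ξ => -ξ := by
    ext ξ; simp [br_neg]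
  rw [wNorm, h, eLpNorm_comp_measurePreserving
    (Measurable.aestronglyMeasurable (by fun_prop)) (Measure.measurePreserving_neg volume)]
  rfl

lemma ae_lt_top_of_wNorm {s : ℝ} {K : ℝ → ℝ≥0∞} (hK : Measurable K) (h : wNorm s K ≠ ∞) :
    ∀ᵐ ξ, K ξ < ∞ := by
  have h2 : ∫⁻ ξ, (br s ξ * K ξ) ^ 2 ≠ ∞ := by
    rw [← wNorm_sq]; exact ENNReal.pow_ne_top h
  filter_upwards [ae_lt_top (by fun_prop) h2] with ξ hξ
  by_contra hc
  simp only [not_lt, top_le_iff] at hc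
  rw [hc, ENNReal.mul_top (br_ne_zero s ξ)] at hξ
  simp at hξ

/-- Cauchy-Schwarz: one power of `⟨ξ⟩` turns an `L²` bound into an `L¹` bound. -/
lemma lintegral_br_mul_le {s : ℝ} {K : ℝ → ℝ≥0∞} (hK : Measurable K) :
    ∫⁻ ξ, br s ξ * K ξ ≤ 2 * wNorm (s + 1) K := by
  -- `⟨ξ⟩⁻¹` is square integrable, with `∫ ⟨ξ⟩⁻² dξ = π ≤ 4`
  have h1 : ∀ ξ, br s ξ * K ξ = ((br (-1)) * fun ξ => br (s + 1) ξ * K ξ) ξ := fun ξ => by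
    rw [Pi.mul_apply, ← mul_assoc, ← br_add]
    congr 2; ring
  have h2 : ∫⁻ ξ, br (-1) ξ ^ (2 : ℝ) ≤ 4 := by
    have : ∀ ξ, br (-1) ξ ^ (2 : ℝ) = ENNReal.ofReal ((1 + ξ ^ 2)⁻¹) := fun ξ => by
      rw [show (2 : ℝ) = ((2 : ℕ) : ℝ) by norm_num, ENNReal.rpow_natCast, br_sq, ← bracket_sq,
        ← Real.rpow_natCast, ← Real.rpow_neg (bracket_pos ξ).le]
      norm_num
    simp_rw [this]
    rw [← ofReal_integral_eq_lintegral_ofReal integrable_inv_one_add_sq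
      (ae_of_all _ fun x => by positivity), integral_univ_inv_one_add_sq]
    refine (ENNReal.ofReal_le_ofReal Real.pi_le_four).trans ?_
    norm_num
  simp_rw [h1]
  refine (ENNReal.lintegral_mul_le_Lp_mul_Lq volume
    (Real.holderConjugate_iff.2 ⟨by norm_num, by norm_num⟩ : Real.HolderConjugate 2 2) (by fun_prop)
    (by fun_prop)).trans ?_
  refine mul_le_mul' ?_ ?_
  · calc _ ≤ (4 : ℝ≥0∞) ^ (1 / 2 : ℝ) := by gcongr
      _ = ((2 : ℝ≥0∞) ^ (2 : ℝ)) ^ (1 / 2 : ℝ) := by norm_num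
      _ = 2 := by rw [← ENNReal.rpow_mul]; norm_num
  · rw [wNorm, eLpNorm_eq_lintegral_rpow_enorm_toReal (by norm_num) (by norm_num)]
    simp

/-- Young's inequality `‖K * L‖_{L²} ≤ ‖K‖_{L²} ‖L‖_{L¹}`. -/
lemma lintegral_lconvolution_sq_le {K L : ℝ → ℝ≥0∞} (hK : Measurable K) (hL : Measurable L) :
    ∫⁻ ξ, (∫⁻ η, K η * L (ξ - η)) ^ 2 ≤ (∫⁻ ξ, K ξ ^ 2) * (∫⁻ ξ, L ξ) ^ 2 := by
  have h1 : ∀ ξ, (∫⁻ η, K η * L (ξ - η)) ^ 2 ≤ (∫⁻ η, K η ^ 2 * L (ξ - η)) * ∫⁻ η, L η := by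
    intro ξ
    have hh : ∀ x : ℝ≥0∞, x ^ (1 / 2 : ℝ) * x ^ (1 / 2 : ℝ) = x := fun x => by
      rw [← ENNReal.rpow_add_of_nonneg _ _ (by norm_num) (by norm_num)]; norm_num
    have e1 : ∀ η, K η * L (ξ - η) =
        ((fun η => K η * L (ξ - η) ^ (1 / 2 : ℝ)) * fun η => L (ξ - η) ^ (1 / 2 : ℝ)) η := by
      intro η
      simp only [Pi.mul_apply, mul_assoc, hh]
    have hh2 : ∀ x : ℝ≥0∞, (x ^ (1 / 2 : ℝ)) ^ (2 : ℝ) = x := fun x => by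
      rw [← ENNReal.rpow_mul]; norm_num
    have hh3 : ∀ x : ℝ≥0∞, (x ^ (1 / 2 : ℝ)) ^ 2 = x := fun x => by
      rw [← ENNReal.rpow_natCast, ← ENNReal.rpow_mul]; norm_num
    simp_rw [e1]
    calc _ ≤ _ := pow_le_pow_left' (ENNReal.lintegral_mul_le_Lp_mul_Lq volume
            (Real.holderConjugate_iff.2 ⟨by norm_num, by norm_num⟩ : Real.HolderConjugate 2 2)
            (by fun_prop) (by fun_prop)) 2
      _ = _ := by
        rw [mul_pow, hh3, hh3]
        simp_rw [ENNReal.mul_rpow_of_nonneg _ _ (by norm_num : (0 : ℝ) ≤ 2), hh2,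
          lintegral_sub_left_eq_self L ξ, ENNReal.rpow_two]
  calc _ ≤ ∫⁻ ξ, (∫⁻ η, K η ^ 2 * L (ξ - η)) * ∫⁻ η, L η := lintegral_mono h1
    _ = (∫⁻ ξ, ∫⁻ η, K η ^ 2 * L (ξ - η)) * ∫⁻ η, L η :=
      lintegral_mul_const _ (Measurable.lintegral_prod_right (by fun_prop))
    _ = _ := by
      rw [lintegral_lintegral_swap (by fun_prop)]
      have : ∀ η, ∫⁻ ξ, K η ^ 2 * L (ξ - η) = K η ^ 2 * ∫⁻ ξ, L ξ := fun η => by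
        rw [lintegral_const_mul _ (by fun_prop), lintegral_sub_right_eq_self]
      simp_rw [this]
      rw [lintegral_mul_const _ (by fun_prop)]
      ring

/-- Convolution of majorants. -/
def lconv (K L : ℝ → ℝ≥0∞) (ξ : ℝ) : ℝ≥0∞ := ∫⁻ η, K η * L (ξ - η)

@[fun_prop]
lemma measurable_lconv {K L : ℝ → ℝ≥0∞} (hK : Measurable K) (hL : Measurable L) :
    Measurable (lconv K L) :=
  Measurable.lintegral_prod_right (by fun_prop)

lemma lconv_comm (K L : ℝ → ℝ≥0∞) : lconv K L = lconv L K := by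
  ext ξ
  unfold lconv
  rw [← lintegral_sub_left_eq_self _ ξ]
  simp [mul_comm]

/-- The constant in the product estimates. -/
def prodConst (s : ℝ) : ℝ≥0∞ := 2 * ENNReal.ofReal (2 ^ s)

lemma prodConst_ne_top (s : ℝ) : prodConst s ≠ ∞ := by simp [prodConst, ENNReal.mul_eq_top]

/-- Convolution maps `L²(⟨ξ⟩^(2s)) × L²(⟨ξ⟩^(2s+2))` to `L²(⟨ξ⟩^(2s))`, for `s ≥ 0`. -/
lemma wNorm_lconv_le {s : ℝ} (hs : 0 ≤ s) {K L : ℝ → ℝ≥0∞} (hK : Measurable K)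
    (hL : Measurable L) : wNorm s (lconv K L) ≤ prodConst s * (wNorm s K * wNorm (s + 1) L) := by
  have h1 : ∀ ξ, br s ξ * lconv K L ξ ≤
      ENNReal.ofReal (2 ^ s) * ∫⁻ η, (br s η * K η) * (br s (ξ - η) * L (ξ - η)) := by
    intro ξ
    rw [lconv, ← lintegral_const_mul _ (by fun_prop), ← lintegral_const_mul _ (by fun_prop)]
    refine lintegral_mono fun η => ?_
    have : br s ξ ≤ ENNReal.ofReal (2 ^ s) * (br s η * br s (ξ - η)) := by
      unfold br
      rw [← ENNReal.ofReal_mul (Real.rpow_nonneg (bracket_pos _).le _),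
        ← ENNReal.ofReal_mul (by positivity), ← Real.mul_rpow (bracket_pos _).le (bracket_pos _).le,
        ← Real.mul_rpow (by norm_num) (mul_pos (bracket_pos _) (bracket_pos _)).le]
      refine ENNReal.ofReal_le_ofReal (Real.rpow_le_rpow (bracket_pos _).le ?_ hs)
      have := bracket_add_le_mul η (ξ - η)
      rwa [add_sub_cancel, mul_assoc] at this
    calc _ ≤ (ENNReal.ofReal (2 ^ s) * (br s η * br s (ξ - η))) * (K η * L (ξ - η)) := by gcongr
      _ = _ := by ring
  rw [wNorm_le_iff]
  calc _ ≤ ∫⁻ ξ, (ENNReal.ofReal (2 ^ s) *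
          ∫⁻ η, (br s η * K η) * (br s (ξ - η) * L (ξ - η))) ^ 2 := by
        exact lintegral_mono fun ξ => pow_le_pow_left' (h1 ξ) 2
    _ = ENNReal.ofReal (2 ^ s) ^ 2 *
          ∫⁻ ξ, (∫⁻ η, (br s η * K η) * (br s (ξ - η) * L (ξ - η))) ^ 2 := by
        simp_rw [mul_pow]
        rw [lintegral_const_mul]
        exact (Measurable.lintegral_prod_right (by fun_prop)).pow_const 2
    _ ≤ ENNReal.ofReal (2 ^ s) ^ 2 * ((∫⁻ ξ, (br s ξ * K ξ) ^ 2) * (∫⁻ ξ, br s ξ * L ξ) ^ 2) := by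
        gcongr
        exact lintegral_lconvolution_sq_le (K := fun ξ => br s ξ * K ξ)
          (L := fun ξ => br s ξ * L ξ) (by fun_prop) (by fun_prop)
    _ ≤ ENNReal.ofReal (2 ^ s) ^ 2 * (wNorm s K ^ 2 * (2 * wNorm (s + 1) L) ^ 2) := by
        rw [wNorm_sq]
        gcongr
        exact lintegral_br_mul_le hL
    _ = _ := by rw [prodConst]; ring

/-- `L²(⟨ξ⟩^(2s+2))` is an algebra under convolution, for `s ≥ 0`. -/
lemma wNorm_lconv_le' {s : ℝ} (hs : 0 ≤ s) {K L : ℝ → ℝ≥0∞} (hK : Measurable K)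
    (hL : Measurable L) :
    wNorm (s + 1) (lconv K L) ≤ 2 * prodConst s * (wNorm (s + 1) K * wNorm (s + 1) L) := by
  have h1 : ∀ ξ, br 1 ξ * lconv K L ξ ≤
      lconv (fun η => br 1 η * K η) L ξ + lconv (fun η => br 1 η * L η) K ξ := by
    intro ξ
    rw [lconv_comm _ K, lconv, lconv, lconv, ← lintegral_const_mul _ (by fun_prop),
      ← lintegral_add_left (by fun_prop)]
    refine lintegral_mono fun η => ?_
    have : br 1 ξ ≤ br 1 η + br 1 (ξ - η) := by
      rw [br_one, br_one, br_one, ← ENNReal.ofReal_add (bracket_pos _).le (bracket_pos _).le]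
      refine ENNReal.ofReal_le_ofReal ?_
      have := bracket_add_le η (ξ - η)
      rwa [add_sub_cancel] at this
    calc _ ≤ (br 1 η + br 1 (ξ - η)) * (K η * L (ξ - η)) := by gcongr
      _ = _ := by ring
  rw [← wNorm_br_mul]
  calc _ ≤ _ := wNorm_mono h1
    _ ≤ _ := wNorm_add_le (by fun_prop) (by fun_prop)
    _ ≤ prodConst s * (wNorm (s + 1) K * wNorm (s + 1) L) +
          prodConst s * (wNorm (s + 1) L * wNorm (s + 1) K) := by
        gcongr
        · rw [← wNorm_br_mul s 1 K]; exact wNorm_lconv_le hs (by fun_prop) hL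
        · rw [← wNorm_br_mul s 1 L]; exact wNorm_lconv_le hs (by fun_prop) hK
    _ = _ := by ring

/-- By Cauchy-Schwarz the convolution of two square integrable majorants is finite everywhere, not
only almost everywhere. -/
lemma lconv_lt_top {K L : ℝ → ℝ≥0∞} (hK : Measurable K) (hL : Measurable L)
    (h1 : wNorm 0 K ≠ ∞) (h2 : wNorm 0 L ≠ ∞) (ξ : ℝ) : lconv K L ξ < ∞ := by
  have e : lconv K L ξ = ∫⁻ η, (K * fun η => L (ξ - η)) η := rfl
  have hfin : ∀ {K : ℝ → ℝ≥0∞}, wNorm 0 K ≠ ∞ → ∫⁻ η, K η ^ (2 : ℝ) ≠ ∞ := fun {K} h => by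
    have := ENNReal.pow_ne_top (n := 2) h
    rw [wNorm_sq] at this
    simpa [br_zero] using this
  rw [e]
  refine (ENNReal.lintegral_mul_le_Lp_mul_Lq volume
    (Real.holderConjugate_iff.2 ⟨by norm_num, by norm_num⟩ : Real.HolderConjugate 2 2)
    (by fun_prop) (by fun_prop)).trans_lt ?_
  rw [lintegral_sub_left_eq_self (fun η => L η ^ (2 : ℝ)) ξ]
  exact ENNReal.mul_lt_top (ENNReal.rpow_lt_top_of_nonneg (by norm_num) (hfin h1))
    (ENNReal.rpow_lt_top_of_nonneg (by norm_num) (hfin h2))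

/-! ### Convolutions and the nonlinear terms on the Fourier side -/

/-- Convolution on the frequency side. -/
def conv (f g : ℝ → ℂ) (ξ : ℝ) : ℂ := ∫ η, f η * g (ξ - η)

/-- The Fourier-side counterpart of complex conjugation, `f ↦ conj (f (-ξ))`. -/
def refl (f : ℝ → ℂ) (ξ : ℝ) : ℂ := (starRingEnd ℂ) (f (-ξ))

/-- The Fourier-side counterpart of `∂ₓ`. -/
def mulI (f : ℝ → ℂ) (ξ : ℝ) : ℂ := Complex.I * ξ * f ξ

/-- The convolution power `f * ⋯ * f` with `n + 1` factors. -/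
def convPow (f : ℝ → ℂ) : ℕ → ℝ → ℂ
  | 0 => f
  | n + 1 => conv f (convPow f n)

/-- The Fourier-side counterpart of `s ↦ c s^(n+1)` at `s = |a|²`. -/
def powOp (c : ℝ) (n : ℕ) (q : ℝ → ℂ) (ξ : ℝ) : ℂ := (c : ℂ) * convPow (conv q (refl q)) n ξ

/-- The Fourier-side counterpart of `½ (∂ₓφ)² + ½ g(|a|²) ∂ₓφ + f(|a|²)`. -/
def phaseOp (N : Nonlinearity) (p q : ℝ → ℂ) (ξ : ℝ) : ℂ :=
  1 / 2 * conv (mulI p) (mulI p) ξ + 1 / 2 * conv (powOp N.α (N.γ - 1) q) (mulI p) ξ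
    + powOp N.lam (N.σ - 1) q ξ

/-- The Fourier-side counterpart of `∂ₓφ ∂ₓa + ½ a ∂ₓ²φ + ½ ∂ₓ(g(|a|²) a)`. -/
def ampOp (N : Nonlinearity) (p q : ℝ → ℂ) (ξ : ℝ) : ℂ :=
  conv (mulI p) (mulI q) ξ + 1 / 2 * conv q (mulI (mulI p)) ξ
    + 1 / 2 * mulI (conv (powOp N.α (N.γ - 1) q) q) ξ

lemma enorm_conv_le (f g : ℝ → ℂ) (ξ : ℝ) :
    ‖conv f g ξ‖ₑ ≤ ∫⁻ η, ‖f η‖ₑ * ‖g (ξ - η)‖ₑ := by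
  refine (enorm_integral_le_lintegral_enorm _).trans (le_of_eq ?_)
  simp [enorm_mul]

lemma conv_congr_ae {f f' g g' : ℝ → ℂ} (hf : f =ᵐ[volume] f') (hg : g =ᵐ[volume] g') (ξ : ℝ) :
    conv f g ξ = conv f' g' ξ := by
  refine integral_congr_ae ?_
  have h2 : ∀ᵐ η, g (ξ - η) = g' (ξ - η) :=
    (quasiMeasurePreserving_sub_left_of_right_invariant volume ξ).ae hg
  filter_upwards [hf, h2] with η h1 h2
  rw [h1, h2]

lemma conv_comm (f g : ℝ → ℂ) : conv f g = conv g f := by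
  ext ξ
  unfold conv
  rw [← integral_sub_left_eq_self _ volume ξ]
  simp [mul_comm]

lemma aestronglyMeasurable_conv {f g : ℝ → ℂ} (hf : AEStronglyMeasurable f volume)
    (hg : AEStronglyMeasurable g volume) : AEStronglyMeasurable (conv f g) volume := by
  obtain ⟨f', hf', hff⟩ := hf
  obtain ⟨g', hg', hgg⟩ := hg
  rw [show conv f g = conv f' g' from funext fun ξ => conv_congr_ae hff hgg ξ]
  have : StronglyMeasurable fun z : ℝ × ℝ => f' z.2 * g' (z.1 - z.2) :=
    (hf'.comp_measurable measurable_snd).mul (hg'.comp_measurable (by fun_prop))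
  exact this.integral_prod_right.aestronglyMeasurable

/-! ### Functions of time and frequency dominated uniformly in time -/

/-- The decaying weight `e^(-ω(t)⟨ξ⟩)`. -/
def ex (ω : ℝ → ℝ) (t ξ : ℝ) : ℝ≥0∞ := ENNReal.ofReal (Real.exp (-(ω t * bracket ξ)))

lemma ex_mul_ex_le {ω : ℝ → ℝ} {t : ℝ} (h : 0 ≤ ω t) (ξ η : ℝ) :
    ex ω t η * ex ω t (ξ - η) ≤ ex ω t ξ := by
  unfold ex
  rw [← ENNReal.ofReal_mul (Real.exp_pos _).le, ← Real.exp_add]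
  refine ENNReal.ofReal_le_ofReal (Real.exp_le_exp.2 ?_)
  have := bracket_add_le η (ξ - η)
  rw [add_sub_cancel] at this
  nlinarith

lemma ex_neg (ω : ℝ → ℝ) (t ξ : ℝ) : ex ω t (-ξ) = ex ω t ξ := by simp [ex, bracket_neg]

lemma ex_le_one {ω : ℝ → ℝ} {t : ℝ} (h : 0 ≤ ω t) (ξ : ℝ) : ex ω t ξ ≤ 1 := by
  unfold ex
  rw [ENNReal.ofReal_le_one]
  exact Real.exp_le_one_iff.2 (by nlinarith [mul_nonneg h (bracket_pos ξ).le])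

lemma ex_ne_top (ω : ℝ → ℝ) (t ξ : ℝ) : ex ω t ξ ≠ ∞ := ENNReal.ofReal_ne_top

/-- `f(t, ξ)` is dominated on `S` by `e^(-ω(t)⟨ξ⟩) K(ξ)` with a time-independent majorant `K` of
norm at most `R` in `L²(⟨ξ⟩^(2s))`. The infimum of these `R` is the norm of
`t ↦ e^(ω(t)⟨ξ⟩) f(t, ξ)` in `L²(⟨ξ⟩^(2s) dξ; L^∞(S))`. -/
def Dom (ω : ℝ → ℝ) (S : Set ℝ) (s : ℝ) (f : ℝ → ℝ → ℂ) (R : ℝ≥0∞) : Prop :=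
  (∀ t ∈ S, AEStronglyMeasurable (f t) volume) ∧
  ∃ K : ℝ → ℝ≥0∞, Measurable K ∧ wNorm s K ≤ R ∧
    ∀ᵐ ξ, ∀ t ∈ S, ‖f t ξ‖ₑ ≤ ex ω t ξ * K ξ

section Dom

variable {ω ω' : ℝ → ℝ} {S S' : Set ℝ} {s s' : ℝ} {f g f' g' : ℝ → ℝ → ℂ} {R R' : ℝ≥0∞}

lemma Dom.mono (h : Dom ω S s f R) (hR : R ≤ R') : Dom ω S s f R' := by
  obtain ⟨hm, K, hK, hKR, hb⟩ := h
  exact ⟨hm, K, hK, hKR.trans hR, hb⟩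

lemma Dom.mono_exp (h : Dom ω S s f R) (hs : s' ≤ s) : Dom ω S s' f R := by
  obtain ⟨hm, K, hK, hKR, hb⟩ := h
  exact ⟨hm, K, hK, (wNorm_mono_exp hs K).trans hKR, hb⟩

lemma Dom.mono_weight (h : Dom ω S s f R) (hω : ∀ t ∈ S, ω' t ≤ ω t) : Dom ω' S s f R := by
  obtain ⟨hm, K, hK, hKR, hb⟩ := h
  refine ⟨hm, K, hK, hKR, hb.mono fun ξ h t ht => (h t ht).trans ?_⟩
  gcongr
  refine ENNReal.ofReal_le_ofReal (Real.exp_le_exp.2 (neg_le_neg ?_))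
  exact mul_le_mul_of_nonneg_right (hω t ht) (bracket_pos ξ).le

lemma Dom.congr (h : Dom ω S s f R) (hfg : ∀ᵐ ξ, ∀ t ∈ S, f t ξ = g t ξ) : Dom ω S s g R := by
  obtain ⟨hm, K, hK, hKR, hb⟩ := h
  refine ⟨fun t ht => (hm t ht).congr (hfg.mono fun ξ h => h t ht), K, hK, hKR, ?_⟩
  filter_upwards [hb, hfg] with ξ h1 h2 t ht
  rw [← h2 t ht]; exact h1 t ht

lemma Dom.zero : Dom ω S s (fun _ _ => 0) 0 :=
  ⟨fun _ _ => aestronglyMeasurable_const, fun _ => 0, measurable_const, by simp [wNorm],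
    by simp⟩

lemma Dom.of_bound {c : ℝ≥0∞} (hf : Dom ω S s f R)
    (hm : ∀ t ∈ S, AEStronglyMeasurable (g t) volume)
    (hb : ∀ᵐ ξ, ∀ t ∈ S, ‖g t ξ‖ₑ ≤ c * ‖f t ξ‖ₑ) : Dom ω S s g (c * R) := by
  obtain ⟨-, K, hK, hKR, h⟩ := hf
  refine ⟨hm, fun ξ => c * K ξ, by fun_prop, ?_, ?_⟩
  · rw [wNorm_const_mul c hK]; gcongr
  · filter_upwards [h, hb] with ξ h1 h2 t ht
    calc _ ≤ c * ‖f t ξ‖ₑ := h2 t ht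
      _ ≤ c * (ex ω t ξ * K ξ) := by gcongr; exact h1 t ht
      _ = _ := by ring

lemma Dom.const_mul (h : Dom ω S s f R) (c : ℂ) : Dom ω S s (fun t ξ => c * f t ξ) (‖c‖ₑ * R) :=
  h.of_bound (fun t ht => (h.1 t ht).const_mul c)
    (ae_of_all _ fun ξ t _ => by rw [enorm_mul])

lemma Dom.add (hf : Dom ω S s f R) (hg : Dom ω S s g R') :
    Dom ω S s (fun t ξ => f t ξ + g t ξ) (R + R') := by
  obtain ⟨hm, K, hK, hKR, h⟩ := hf
  obtain ⟨hm', L, hL, hLR, h'⟩ := hg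
  refine ⟨fun t ht => (hm t ht).add (hm' t ht), fun ξ => K ξ + L ξ, by fun_prop,
    (wNorm_add_le hK hL).trans (by gcongr), ?_⟩
  filter_upwards [h, h'] with ξ h1 h2 t ht
  rw [mul_add]
  exact (enorm_add_le _ _).trans (add_le_add (h1 t ht) (h2 t ht))

lemma Dom.sub (hf : Dom ω S s f R) (hg : Dom ω S s g R') :
    Dom ω S s (fun t ξ => f t ξ - g t ξ) (R + R') := by
  have := hf.add (hg.const_mul (-1))
  simp only [enorm_neg, enorm_one, one_mul] at this
  exact this.congr (ae_of_all _ fun ξ t _ => by ring)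

lemma Dom.sub_comm (h : Dom ω S s (fun t ξ => f t ξ - g t ξ) R) :
    Dom ω S s (fun t ξ => g t ξ - f t ξ) R := by
  have := h.const_mul (-1)
  simp only [enorm_neg, enorm_one, one_mul] at this
  exact this.congr (ae_of_all _ fun ξ t _ => by ring)

lemma aestronglyMeasurable_refl {f : ℝ → ℂ} (hf : AEStronglyMeasurable f volume) :
    AEStronglyMeasurable (refl f) volume :=
  Complex.continuous_conj.comp_aestronglyMeasurable
    (hf.comp_quasiMeasurePreserving (Measure.measurePreserving_neg volume).quasiMeasurePreserving)

lemma Dom.refl (hf : Dom ω S s f R) : Dom ω S s (fun t => refl (f t)) R := by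
  obtain ⟨hm, K, hK, hKR, h⟩ := hf
  refine ⟨fun t ht => aestronglyMeasurable_refl (hm t ht), fun ξ => K (-ξ), by fun_prop,
    (wNorm_comp_neg hK).trans_le hKR, ?_⟩
  filter_upwards [(Measure.measurePreserving_neg volume).quasiMeasurePreserving.ae h] with ξ h1 t ht
  have := h1 t ht
  rw [ex_neg] at this
  rwa [WKB.refl, RCLike.enorm_conj]

lemma aestronglyMeasurable_mulI {f : ℝ → ℂ} (hf : AEStronglyMeasurable f volume) :
    AEStronglyMeasurable (mulI f) volume :=
  AEStronglyMeasurable.mul (Continuous.aestronglyMeasurable (by fun_prop)) hf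

lemma enorm_mulI_le (f : ℝ → ℂ) (ξ : ℝ) : ‖mulI f ξ‖ₑ ≤ br 1 ξ * ‖f ξ‖ₑ := by
  rw [mulI, enorm_mul, enorm_mul, br_one]
  gcongr
  rw [← ofReal_norm, ← ofReal_norm]
  simp only [Complex.norm_I, ENNReal.ofReal_one, one_mul]
  refine ENNReal.ofReal_le_ofReal ?_
  simpa using abs_le_bracket ξ

lemma Dom.mulI (hf : Dom ω S (s + 1) f R) : Dom ω S s (fun t => mulI (f t)) R := by
  obtain ⟨hm, K, hK, hKR, h⟩ := hf
  refine ⟨fun t ht => aestronglyMeasurable_mulI (hm t ht), fun ξ => br 1 ξ * K ξ, by fun_prop,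
    (wNorm_br_mul s 1 K).trans_le hKR, ?_⟩
  filter_upwards [h] with ξ h1 t ht
  calc _ ≤ br 1 ξ * ‖f t ξ‖ₑ := enorm_mulI_le _ _
    _ ≤ br 1 ξ * (ex ω t ξ * K ξ) := by gcongr; exact h1 t ht
    _ = _ := by ring

lemma ae_sub_left {P : ℝ → Prop} (h : ∀ᵐ η, P η) (ξ : ℝ) : ∀ᵐ η, P (ξ - η) :=
  (quasiMeasurePreserving_sub_left_of_right_invariant volume ξ).ae h

/-- The analytic weight is submultiplicative, so majorants of a convolution are convolutions of
majorants. -/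
lemma lintegral_conv_le_of_majorant {K L : ℝ → ℝ≥0∞} {t : ℝ} (hω : 0 ≤ ω t)
    (hK : ∀ᵐ ξ, ‖f t ξ‖ₑ ≤ ex ω t ξ * K ξ) (hL : ∀ᵐ ξ, ‖g t ξ‖ₑ ≤ ex ω t ξ * L ξ)
    (hKm : Measurable K) (hLm : Measurable L) (ξ : ℝ) :
    ∫⁻ η, ‖f t η‖ₑ * ‖g t (ξ - η)‖ₑ ≤ ex ω t ξ * lconv K L ξ := by
  rw [lconv, ← lintegral_const_mul _ (by fun_prop)]
  refine lintegral_mono_ae ?_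
  filter_upwards [hK, ae_sub_left hL ξ] with η h1 h2
  calc _ ≤ (ex ω t η * K η) * (ex ω t (ξ - η) * L (ξ - η)) := mul_le_mul' h1 h2
    _ = (ex ω t η * ex ω t (ξ - η)) * (K η * L (ξ - η)) := by ring
    _ ≤ _ := by gcongr; exact ex_mul_ex_le hω ξ η

lemma Dom.conv_aux (hω : ∀ t ∈ S, 0 ≤ ω t) {K L : ℝ → ℝ≥0∞} (hKm : Measurable K)
    (hLm : Measurable L) (hK : ∀ᵐ ξ, ∀ t ∈ S, ‖f t ξ‖ₑ ≤ ex ω t ξ * K ξ)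
    (hL : ∀ᵐ ξ, ∀ t ∈ S, ‖g t ξ‖ₑ ≤ ex ω t ξ * L ξ) :
    ∀ᵐ ξ, ∀ t ∈ S, ‖conv (f t) (g t) ξ‖ₑ ≤ ex ω t ξ * lconv K L ξ :=
  ae_of_all _ fun ξ t ht => (enorm_conv_le _ _ _).trans
    (lintegral_conv_le_of_majorant (hω t ht) (hK.mono fun _ h => h t ht)
      (hL.mono fun _ h => h t ht) hKm hLm ξ)

lemma Dom.conv (hω : ∀ t ∈ S, 0 ≤ ω t) (hs : 0 ≤ s) (hf : Dom ω S s f R)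
    (hg : Dom ω S (s + 1) g R') :
    Dom ω S s (fun t => conv (f t) (g t)) (prodConst s * (R * R')) := by
  obtain ⟨hm, K, hK, hKR, h⟩ := hf
  obtain ⟨hm', L, hL, hLR, h'⟩ := hg
  exact ⟨fun t ht => aestronglyMeasurable_conv (hm t ht) (hm' t ht), lconv K L, by fun_prop,
    (wNorm_lconv_le hs hK hL).trans (by gcongr), Dom.conv_aux hω hK hL h h'⟩

/-- The spaces of index at least `1` are algebras: `s + 1 > 1/2` and the analytic weight is
submultiplicative. -/
lemma Dom.conv_alg (hω : ∀ t ∈ S, 0 ≤ ω t) (hs : 0 ≤ s) (hf : Dom ω S (s + 1) f R)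
    (hg : Dom ω S (s + 1) g R') :
    Dom ω S (s + 1) (fun t => WKB.conv (f t) (g t)) (2 * prodConst s * (R * R')) := by
  obtain ⟨hm, K, hK, hKR, h⟩ := hf
  obtain ⟨hm', L, hL, hLR, h'⟩ := hg
  exact ⟨fun t ht => aestronglyMeasurable_conv (hm t ht) (hm' t ht), lconv K L, by fun_prop,
    (wNorm_lconv_le' hs hK hL).trans (by gcongr), Dom.conv_aux hω hK hL h h'⟩

lemma Dom.integrable_conv (hω : ∀ t ∈ S, 0 ≤ ω t) (hs : 0 ≤ s) (hs' : 0 ≤ s')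
    (hf : Dom ω S s f R) (hg : Dom ω S s' g R') (hR : R ≠ ∞) (hR' : R' ≠ ∞) {t : ℝ} (ht : t ∈ S)
    (ξ : ℝ) : Integrable (fun η => f t η * g t (ξ - η)) := by
  obtain ⟨hm, K, hK, hKR, h⟩ := hf.mono_exp hs
  obtain ⟨hm', L, hL, hLR, h'⟩ := hg.mono_exp hs'
  refine ⟨(hm t ht).mul ((hm' t ht).comp_quasiMeasurePreserving
    (quasiMeasurePreserving_sub_left_of_right_invariant volume ξ)), ?_⟩
  have h3 := lintegral_conv_le_of_majorant (hω t ht) (h.mono fun _ h => h t ht)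
    (h'.mono fun _ h => h t ht) hK hL ξ
  refine lt_of_le_of_lt ?_ (h3.trans_lt (ENNReal.mul_lt_top (ex_ne_top _ _ _).lt_top
    (lconv_lt_top hK hL (ne_top_of_le_ne_top hR hKR) (ne_top_of_le_ne_top hR' hLR) ξ)))
  simp [enorm_mul]

/-- `f` is jointly measurable, and continuous in time on `S` at almost every frequency. -/
def Reg (S : Set ℝ) (f : ℝ → ℝ → ℂ) : Prop :=
  Measurable (Function.uncurry f) ∧ ∀ᵐ ξ, ContinuousOn (fun t => f t ξ) S

/-- A convolution of dominated functions is continuous in time at every frequency, by dominated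
convergence. -/
lemma Reg.conv (hω : ∀ t ∈ S, 0 ≤ ω t) (hs : 0 ≤ s) (hs' : 0 ≤ s')
    (hf : Dom ω S s f R) (hg : Dom ω S s' g R') (hR : R ≠ ∞) (hR' : R' ≠ ∞)
    (rf : Reg S f) (rg : Reg S g) : Reg S (fun t => WKB.conv (f t) (g t)) := by
  refine ⟨?_, ae_of_all _ fun ξ => ?_⟩
  · have : StronglyMeasurable fun z : (ℝ × ℝ) × ℝ =>
        Function.uncurry f (z.1.1, z.2) * Function.uncurry g (z.1.1, z.1.2 - z.2) :=
      ((rf.1.comp (by fun_prop)).mul (rg.1.comp (by fun_prop))).stronglyMeasurable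
    exact this.integral_prod_right.measurable
  · obtain ⟨hm, K, hK, hKR, h⟩ := hf.mono_exp hs
    obtain ⟨hm', L, hL, hLR, h'⟩ := hg.mono_exp hs'
    have hlt := lconv_lt_top hK hL (ne_top_of_le_ne_top hR hKR) (ne_top_of_le_ne_top hR' hLR) ξ
    have hprod : Measurable fun η => K η * L (ξ - η) := by fun_prop
    refine continuousOn_of_dominated (bound := fun η => (K η * L (ξ - η)).toReal) ?_ ?_ ?_ ?_
    · exact fun t ht => (hm t ht).mul ((hm' t ht).comp_quasiMeasurePreserving
        (quasiMeasurePreserving_sub_left_of_right_invariant volume ξ))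
    · intro t ht
      filter_upwards [h, ae_sub_left h' ξ, ae_lt_top hprod hlt.ne] with η h1 h2 h3
      rw [← toReal_enorm, enorm_mul]
      refine ENNReal.toReal_mono h3.ne ?_
      refine mul_le_mul' ((h1 t ht).trans ?_) ((h2 t ht).trans ?_)
      · exact mul_le_of_le_one_left' (ex_le_one (hω t ht) _)
      · exact mul_le_of_le_one_left' (ex_le_one (hω t ht) _)
    · exact integrable_toReal_of_lintegral_ne_top hprod.aemeasurable hlt.ne
    · filter_upwards [rf.2, ae_sub_left rg.2 ξ] with η h1 h2
      exact h1.mul h2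

lemma Reg.add (hf : Reg S f) (hg : Reg S g) : Reg S (fun t ξ => f t ξ + g t ξ) :=
  ⟨hf.1.add hg.1, by filter_upwards [hf.2, hg.2] with ξ h1 h2 using h1.add h2⟩

lemma Reg.const_mul (hf : Reg S f) (c : ℂ) : Reg S (fun t ξ => c * f t ξ) :=
  ⟨hf.1.const_mul c, by filter_upwards [hf.2] with ξ h1 using continuousOn_const.mul h1⟩

lemma Reg.mulI (hf : Reg S f) : Reg S (fun t => WKB.mulI (f t)) := by
  refine ⟨?_, by filter_upwards [hf.2] with ξ h1 using continuousOn_const.mul h1⟩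
  have : Measurable fun z : ℝ × ℝ => Complex.I * (z.2 : ℂ) * Function.uncurry f z :=
    (Measurable.const_mul (by fun_prop) _).mul hf.1
  exact this

lemma Reg.refl (hf : Reg S f) : Reg S (fun t => WKB.refl (f t)) := by
  constructor
  · have : Measurable fun z : ℝ × ℝ => (starRingEnd ℂ) (Function.uncurry f (z.1, -z.2)) :=
      Complex.continuous_conj.measurable.comp (hf.1.comp (by fun_prop))
    exact this
  · filter_upwards [(Measure.measurePreserving_neg volume).quasiMeasurePreserving.ae hf.2]
      with ξ h1
    exact Complex.continuous_conj.comp_continuousOn h1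

end Dom

/-! ### Lipschitz estimates for the nonlinear terms -/

/-- Two pairs `(p, q)`, `(p', q')` in the ball of radius `R`, at distance at most `r`. The phase is
measured with one derivative more than the amplitude. -/
structure Close (ω : ℝ → ℝ) (S : Set ℝ) (s : ℝ) (p q p' q' : ℝ → ℝ → ℂ) (R r : ℝ≥0∞) :
    Prop where
  p₁ : Dom ω S (s + 2) p R
  q₁ : Dom ω S (s + 1) q R
  p₂ : Dom ω S (s + 2) p' R
  q₂ : Dom ω S (s + 1) q' R
  dp : Dom ω S (s + 2) (fun t ξ => p t ξ - p' t ξ) r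
  dq : Dom ω S (s + 1) (fun t ξ => q t ξ - q' t ξ) r

/-- The operator `Ψ`, acting on `(p, q)` at each fixed time, is Lipschitz on balls, from the space
of `Close` (with index `s₀`) to the level `s`, uniformly in the weight `ω ≥ 0` and the time set.
It also preserves regularity. -/
def LipOp (s₀ s : ℝ) (Ψ : (ℝ → ℂ) → (ℝ → ℂ) → ℝ → ℂ) : Prop :=
  ∀ R : ℝ≥0, ∃ A : ℝ≥0, ∀ (ω : ℝ → ℝ) (S : Set ℝ) (p q p' q' : ℝ → ℝ → ℂ) (r : ℝ≥0∞),
    (∀ t ∈ S, 0 ≤ ω t) → Close ω S s₀ p q p' q' R r →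
      Dom ω S s (fun t => Ψ (p t) (q t)) A ∧ Dom ω S s (fun t => Ψ (p' t) (q' t)) A ∧
      Dom ω S s (fun t ξ => Ψ (p t) (q t) ξ - Ψ (p' t) (q' t) ξ) (A * r) ∧
      (Reg S p → Reg S q → Reg S fun t => Ψ (p t) (q t))

section LipOp

variable {s₀ s : ℝ} {Ψ Ψ' : (ℝ → ℂ) → (ℝ → ℂ) → ℝ → ℂ}

lemma LipOp.mono_exp {s' : ℝ} (h : LipOp s₀ s Ψ) (hs : s' ≤ s) : LipOp s₀ s' Ψ := fun R => by
  obtain ⟨A, hA⟩ := h R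
  refine ⟨A, fun ω S p q p' q' r hω hc => ?_⟩
  obtain ⟨h1, h2, h3, h4⟩ := hA ω S p q p' q' r hω hc
  exact ⟨h1.mono_exp hs, h2.mono_exp hs, h3.mono_exp hs, h4⟩

lemma LipOp.amp : LipOp s₀ (s₀ + 1) fun _ q => q := fun R =>
  ⟨R + 1, fun ω S p q p' q' r _ hc => ⟨hc.q₁.mono (by simp), hc.q₂.mono (by simp),
    hc.dq.mono (le_mul_of_one_le_left' (by simp)), fun _ h => h⟩⟩

lemma LipOp.phaseDeriv : LipOp s₀ (s₀ + 1) fun p _ => mulI p := fun R => by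
  refine ⟨R + 1, fun ω S p q p' q' r _ hc => ?_⟩
  have e : s₀ + 2 = s₀ + 1 + 1 := by ring
  have h1 := hc.p₁; have h2 := hc.p₂; have h3 := hc.dp
  rw [e] at h1 h2 h3
  refine ⟨h1.mulI.mono (by simp), h2.mulI.mono (by simp), ?_, fun h _ => h.mulI⟩
  refine (h3.mulI.mono (R' := (R + 1 : ℝ≥0) * r) (le_mul_of_one_le_left' (by simp))).congr
    (ae_of_all _ fun ξ t _ => ?_)
  simp only [WKB.mulI]; ring

lemma LipOp.refl (h : LipOp s₀ s Ψ) : LipOp s₀ s fun p q => WKB.refl (Ψ p q) := fun R => by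
  obtain ⟨A, hA⟩ := h R
  refine ⟨A, fun ω S p q p' q' r hω hc => ?_⟩
  obtain ⟨h1, h2, h3, h4⟩ := hA ω S p q p' q' r hω hc
  refine ⟨h1.refl, h2.refl, h3.refl.congr (ae_of_all _ fun ξ t _ => ?_),
    fun hp hq => (h4 hp hq).refl⟩
  simp [WKB.refl]

lemma LipOp.mulI (h : LipOp s₀ (s + 1) Ψ) : LipOp s₀ s fun p q => WKB.mulI (Ψ p q) := fun R => by
  obtain ⟨A, hA⟩ := h R
  refine ⟨A, fun ω S p q p' q' r hω hc => ?_⟩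
  obtain ⟨h1, h2, h3, h4⟩ := hA ω S p q p' q' r hω hc
  refine ⟨h1.mulI, h2.mulI, h3.mulI.congr (ae_of_all _ fun ξ t _ => ?_),
    fun hp hq => (h4 hp hq).mulI⟩
  simp only [WKB.mulI]; ring

lemma LipOp.const_mul (h : LipOp s₀ s Ψ) (c : ℂ) : LipOp s₀ s fun p q ξ => c * Ψ p q ξ :=
  fun R => by
  obtain ⟨A, hA⟩ := h R
  refine ⟨‖c‖₊ * A, fun ω S p q p' q' r hω hc => ?_⟩
  obtain ⟨h1, h2, h3, h4⟩ := hA ω S p q p' q' r hω hc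
  refine ⟨(h1.const_mul c).mono (by simp [enorm]), (h2.const_mul c).mono (by simp [enorm]),
    ((h3.const_mul c).mono (by simp [enorm, mul_assoc])).congr (ae_of_all _ fun ξ t _ => ?_),
    fun hp hq => (h4 hp hq).const_mul c⟩
  ring

lemma LipOp.add (h : LipOp s₀ s Ψ) (h' : LipOp s₀ s Ψ') :
    LipOp s₀ s fun p q ξ => Ψ p q ξ + Ψ' p q ξ := fun R => by
  obtain ⟨A, hA⟩ := h R
  obtain ⟨B, hB⟩ := h' R
  refine ⟨A + B, fun ω S p q p' q' r hω hc => ?_⟩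
  obtain ⟨h1, h2, h3, h4⟩ := hA ω S p q p' q' r hω hc
  obtain ⟨k1, k2, k3, k4⟩ := hB ω S p q p' q' r hω hc
  refine ⟨(h1.add k1).mono (by simp), (h2.add k2).mono (by simp),
    ((h3.add k3).mono (by simp [add_mul])).congr (ae_of_all _ fun ξ t _ => ?_),
    fun hp hq => (h4 hp hq).add (k4 hp hq)⟩
  ring

/-- The difference of two products, `fg - f'g' = (f - f')g + f'(g - g')`. -/
lemma Dom.conv_sub {ω : ℝ → ℝ} {S : Set ℝ} {s₁ s₂ : ℝ} {f g f' g' : ℝ → ℝ → ℂ} {A B : ℝ≥0}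
    {a b : ℝ≥0∞} (hω : ∀ t ∈ S, 0 ≤ ω t) (hs₁ : 0 ≤ s₁) (hs₂ : 0 ≤ s₂)
    (hf : Dom ω S s₁ f A) (hf' : Dom ω S s₁ f' A) (hg : Dom ω S s₂ g B) (hg' : Dom ω S s₂ g' B)
    (h1 : Dom ω S s (fun t => WKB.conv (fun ξ => f t ξ - f' t ξ) (g t)) a)
    (h2 : Dom ω S s (fun t => WKB.conv (f' t) (fun ξ => g t ξ - g' t ξ)) b) :
    Dom ω S s (fun t ξ => WKB.conv (f t) (g t) ξ - WKB.conv (f' t) (g' t) ξ) (a + b) := by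
  refine (h1.add h2).congr (ae_of_all _ fun ξ t ht => ?_)
  have i1 := Dom.integrable_conv hω hs₁ hs₂ hf hg (by simp) (by simp) ht ξ
  have i2 := Dom.integrable_conv hω hs₁ hs₂ hf' hg (by simp) (by simp) ht ξ
  have i3 := Dom.integrable_conv hω hs₁ hs₂ hf' hg' (by simp) (by simp) ht ξ
  unfold WKB.conv
  simp only [sub_mul, mul_sub]
  rw [integral_sub i1 i2, integral_sub i2 i3]
  ring

lemma LipOp.conv (hs : 0 ≤ s) (h : LipOp s₀ s Ψ) (h' : LipOp s₀ (s + 1) Ψ') :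
    LipOp s₀ s fun p q => WKB.conv (Ψ p q) (Ψ' p q) := fun R => by
  obtain ⟨A, hA⟩ := h R
  obtain ⟨B, hB⟩ := h' R
  lift prodConst s to ℝ≥0 using prodConst_ne_top s with c hc'
  refine ⟨c * (A * B) + c * (A * B), fun ω S p q p' q' r hω hc => ?_⟩
  obtain ⟨h1, h2, h3, h4⟩ := hA ω S p q p' q' r hω hc
  obtain ⟨k1, k2, k3, k4⟩ := hB ω S p q p' q' r hω hc
  refine ⟨(h1.conv hω hs k1).mono ?_, (h2.conv hω hs k2).mono ?_,
    (Dom.conv_sub hω hs (by linarith) h1 h2 k1 k2 (h3.conv hω hs k1) (h2.conv hω hs k3)).mono ?_,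
    fun hp hq => Reg.conv hω hs (by linarith) h1 k1 (by simp) (by simp) (h4 hp hq) (k4 hp hq)⟩
  · rw [← hc']; push_cast; exact le_self_add
  · rw [← hc']; push_cast; exact le_self_add
  · rw [← hc']; push_cast; apply le_of_eq; ring

lemma LipOp.conv_alg (hs : 0 ≤ s) (h : LipOp s₀ (s + 1) Ψ) (h' : LipOp s₀ (s + 1) Ψ') :
    LipOp s₀ (s + 1) fun p q => WKB.conv (Ψ p q) (Ψ' p q) := fun R => by
  obtain ⟨A, hA⟩ := h R
  obtain ⟨B, hB⟩ := h' R
  lift prodConst s to ℝ≥0 using prodConst_ne_top s with c hc'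
  refine ⟨2 * c * (A * B) + 2 * c * (A * B), fun ω S p q p' q' r hω hc => ?_⟩
  obtain ⟨h1, h2, h3, h4⟩ := hA ω S p q p' q' r hω hc
  obtain ⟨k1, k2, k3, k4⟩ := hB ω S p q p' q' r hω hc
  refine ⟨(h1.conv_alg hω hs k1).mono ?_, (h2.conv_alg hω hs k2).mono ?_,
    (Dom.conv_sub hω (by linarith) (by linarith) h1 h2 k1 k2 (h3.conv_alg hω hs k1)
      (h2.conv_alg hω hs k3)).mono ?_,
    fun hp hq => Reg.conv hω (by linarith) (by linarith) h1 k1 (by simp) (by simp) (h4 hp hq)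
      (k4 hp hq)⟩
  · rw [← hc']; push_cast; exact le_self_add
  · rw [← hc']; push_cast; exact le_self_add
  · rw [← hc']; push_cast; apply le_of_eq; ring

lemma LipOp.convPow (hs : 0 ≤ s) (h : LipOp s₀ (s + 1) Ψ) (n : ℕ) :
    LipOp s₀ (s + 1) fun p q => WKB.convPow (Ψ p q) n := by
  induction n with
  | zero => exact h
  | succ n ih => exact h.conv_alg hs ih

lemma LipOp.powOp (hs : 0 ≤ s₀) (c : ℝ) (n : ℕ) :
    LipOp s₀ (s₀ + 1) fun _ q => WKB.powOp c n q :=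
  ((LipOp.amp.conv_alg hs LipOp.amp.refl).convPow hs n).const_mul c

/-- The nonlinear terms of the phase equation lose one derivative: the phase is controlled at the
level `s₀ + 2`, they are controlled at the level `s₀ + 1`. -/
lemma LipOp.phaseOp (hs : 0 ≤ s₀) (N : Nonlinearity) : LipOp s₀ (s₀ + 1) (WKB.phaseOp N) :=
  (((LipOp.phaseDeriv.conv_alg hs LipOp.phaseDeriv).const_mul _).add
    (((LipOp.powOp hs _ _).conv_alg hs LipOp.phaseDeriv).const_mul _)).add (LipOp.powOp hs _ _)

/-- The nonlinear terms of the amplitude equation lose one derivative: the amplitude is controlled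
at the level `s₀ + 1`, they are controlled at the level `s₀`. -/
lemma LipOp.ampOp (hs : 0 ≤ s₀) (N : Nonlinearity) : LipOp s₀ s₀ (WKB.ampOp N) := by
  have h1 : LipOp s₀ s₀ fun p q => WKB.conv (WKB.mulI p) (WKB.mulI q) := by
    have := LipOp.conv (s₀ := s₀) hs LipOp.amp.mulI LipOp.phaseDeriv
    simpa only [conv_comm] using this
  have h2 : LipOp s₀ s₀ fun p q => WKB.conv q (WKB.mulI (WKB.mulI p)) := by
    have := LipOp.conv (s₀ := s₀) hs LipOp.phaseDeriv.mulI LipOp.amp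
    simpa only [conv_comm] using this
  exact (h1.add (h2.const_mul _)).add
    (LipOp.mulI (((LipOp.powOp hs _ _).conv_alg hs LipOp.amp)) |>.const_mul _)

end LipOp

/-! ### Gain of one derivative from the shrinking analytic weight -/

/-- The weight `ω(t) = ω₀ - μ t` gains one power of `⟨ξ⟩` and a factor `1/μ` when a source term is
integrated in time: `∫_{t₀}^t e^(-ω(τ)⟨ξ⟩) dτ ≤ e^(-ω(t)⟨ξ⟩) / (μ⟨ξ⟩)`. The skew-adjoint term
`-iκ y` does not contribute. -/
lemma Dom.gain {ω₀ μ t₀ t₁ s : ℝ} (hμ : 0 < μ) {κ : ℝ → ℝ} {y h : ℝ → ℝ → ℂ} {ρ₀ ρ : ℝ≥0∞}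
    (hm : ∀ t ∈ Icc t₀ t₁, AEStronglyMeasurable (y t) volume)
    (hy : ∀ᵐ ξ, ∀ t ∈ Icc t₀ t₁, HasDerivWithinAt (fun τ => y τ ξ)
      (-(Complex.I * κ ξ * y t ξ) + h t ξ) (Icc t₀ t₁) t)
    (h0 : Dom (weight ω₀ μ) {t₀} (s + 1) y ρ₀) (hh : Dom (weight ω₀ μ) (Icc t₀ t₁) s h ρ) :
    Dom (weight ω₀ μ) (Icc t₀ t₁) (s + 1) y (ρ₀ + ENNReal.ofReal μ⁻¹ * ρ) := by
  obtain ⟨-, K₀, hK₀, hKR₀, hb₀⟩ := h0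
  obtain ⟨-, K, hK, hKR, hb⟩ := hh
  refine ⟨hm, fun ξ => K₀ ξ + ENNReal.ofReal μ⁻¹ * (br (-1) ξ * K ξ), by fun_prop, ?_, ?_⟩
  · refine (wNorm_add_le hK₀ (by fun_prop)).trans ?_
    rw [wNorm_const_mul _ (by fun_prop), wNorm_br_mul]
    gcongr
    simpa using hKR
  filter_upwards [hy, hb₀, hb] with ξ h1 h2 h3 t ht
  have hex : ∀ τ, ex (weight ω₀ μ) τ ξ ≠ 0 := fun τ => by simp [ex, Real.exp_pos]
  by_cases k1 : K₀ ξ = ∞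
  · simp [k1, hex]
  by_cases k2 : K ξ = ∞
  · simp [k2, hex, hμ, ENNReal.mul_top, br_ne_zero]
  set b := bracket ξ with hbdef
  have hb0 : 0 < b := bracket_pos ξ
  set k₀ := (K₀ ξ).toReal
  set k := (K ξ).toReal
  have hk₀ : K₀ ξ = ENNReal.ofReal k₀ := (ENNReal.ofReal_toReal k1).symm
  have hk : K ξ = ENNReal.ofReal k := (ENNReal.ofReal_toReal k2).symm
  have hk₀' : 0 ≤ k₀ := ENNReal.toReal_nonneg
  have hk' : 0 ≤ k := ENNReal.toReal_nonneg
  have ht₀ : t₀ ∈ Icc t₀ t₁ := ⟨le_rfl, ht.1.trans ht.2⟩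
  set B : ℝ → ℝ := fun τ => Real.exp (-(weight ω₀ μ t₀ * b)) * k₀
    + k / (μ * b) * Real.exp (-(weight ω₀ μ τ * b)) with hB
  have hBd : ∀ τ, HasDerivAt B (k * Real.exp (-(weight ω₀ μ τ * b))) τ := by
    intro τ
    have e1 : HasDerivAt (fun τ => -(weight ω₀ μ τ * b)) (μ * b) τ := by
      have := (((hasDerivAt_id τ).const_mul μ).const_sub ω₀).mul_const b |>.neg
      exact this.congr_deriv (by ring)
    have := (e1.exp.const_mul (k / (μ * b))).const_add (Real.exp (-(weight ω₀ μ t₀ * b)) * k₀)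
    refine this.congr_deriv ?_
    field_simp
  -- conjugating by the unitary factor removes the skew-adjoint term
  set z : ℝ → ℂ := fun τ => Complex.exp (Complex.I * κ ξ * τ) * y τ ξ with hz
  set z' : ℝ → ℂ := fun τ => Complex.exp (Complex.I * κ ξ * τ) * h τ ξ with hz'
  have hu : ∀ τ : ℝ, ‖Complex.exp (Complex.I * κ ξ * τ)‖ = 1 := fun τ => by
    rw [show Complex.I * κ ξ * τ = ((κ ξ * τ : ℝ) : ℂ) * Complex.I by push_cast; ring]
    exact Complex.norm_exp_ofReal_mul_I _
  have hzd : ∀ τ ∈ Icc t₀ t₁, HasDerivWithinAt z (z' τ) (Icc t₀ t₁) τ := by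
    intro τ hτ
    have e1 : HasDerivAt (fun τ : ℝ => Complex.exp (Complex.I * κ ξ * τ))
        (Complex.exp (Complex.I * κ ξ * τ) * (Complex.I * κ ξ)) τ := by
      have := (Complex.ofRealCLM.hasDerivAt (x := τ)).const_mul (Complex.I * κ ξ)
      simpa using this.cexp
    refine (e1.hasDerivWithinAt.mul (h1 τ hτ)).congr_deriv ?_
    simp only [hz']; ring
  have key : ‖z t‖ ≤ B t := by
    refine image_norm_le_of_norm_deriv_right_le_deriv_boundary (f' := z') (a := t₀) (b := t₁)
      (fun τ hτ => (hzd τ hτ).continuousWithinAt) (fun τ hτ => ?_) ?_ hBd (fun τ hτ => ?_) ht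
    · exact (hzd τ (Ico_subset_Icc_self hτ)).mono_of_mem_nhdsWithin (Icc_mem_nhdsGE_of_mem hτ)
    · have := h2 t₀ rfl
      rw [hk₀, ex, ← ENNReal.ofReal_mul (Real.exp_pos _).le, ← ofReal_norm,
        ENNReal.ofReal_le_ofReal_iff (by positivity)] at this
      simp only [hz, norm_mul, hu, one_mul]
      refine this.trans ?_
      simp only [hB, hbdef]
      have : 0 ≤ k / (μ * bracket ξ) * Real.exp (-(weight ω₀ μ t₀ * bracket ξ)) := by positivity
      linarith
    · have := h3 τ (Ico_subset_Icc_self hτ)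
      rw [hk, ex, ← ENNReal.ofReal_mul (Real.exp_pos _).le, ← ofReal_norm,
        ENNReal.ofReal_le_ofReal_iff (by positivity)] at this
      simp only [hz', norm_mul, hu, one_mul]
      linarith
  simp only [hz, norm_mul, hu, one_mul] at key
  have h5 : Real.exp (-(weight ω₀ μ t₀ * b)) ≤ Real.exp (-(weight ω₀ μ t * b)) := by
    refine Real.exp_le_exp.2 (neg_le_neg (mul_le_mul_of_nonneg_right ?_ hb0.le))
    simp only [weight]
    nlinarith [ht.1]
  have h6 : ‖y t ξ‖ ≤ Real.exp (-(weight ω₀ μ t * b)) * (k₀ + μ⁻¹ * (b ^ (-1 : ℝ) * k)) := by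
    refine key.trans ?_
    have : Real.exp (-(weight ω₀ μ t₀ * b)) * k₀ ≤ Real.exp (-(weight ω₀ μ t * b)) * k₀ := by
      gcongr
    rw [Real.rpow_neg_one]
    calc B t ≤ Real.exp (-(weight ω₀ μ t * b)) * k₀
          + k / (μ * b) * Real.exp (-(weight ω₀ μ t * b)) := by simp only [hB]; linarith
      _ = _ := by field_simp
  rw [hk₀, hk, ex, br, ← ENNReal.ofReal_mul (by positivity), ← ENNReal.ofReal_mul (by positivity),
    ← ENNReal.ofReal_add (by positivity) (by positivity), ← ENNReal.ofReal_mul (by positivity),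
    ← ofReal_norm]
  exact ENNReal.ofReal_le_ofReal h6

/-- `(p₁, q₁)` solves, at almost every frequency and for all times in `[t₀, t₁]`, the linear
equations obtained by freezing the nonlinear terms of `(S_ε)` at `(p, q)`, with an additional source
in the amplitude equation. The case `(p₁, q₁) = (p, q)`, without source, is `(S_ε)` itself. -/
def IsStep (N : Nonlinearity) (ε t₀ t₁ : ℝ) (src p q p₁ q₁ : ℝ → ℝ → ℂ) : Prop :=
  (∀ t ∈ Icc t₀ t₁, AEStronglyMeasurable (p₁ t) volume ∧ AEStronglyMeasurable (q₁ t) volume) ∧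
  ∀ᵐ ξ, ∀ t ∈ Icc t₀ t₁,
    HasDerivWithinAt (fun τ => p₁ τ ξ) (-(phaseOp N (p t) (q t) ξ)) (Icc t₀ t₁) t ∧
    HasDerivWithinAt (fun τ => q₁ τ ξ) (-(Complex.I * (ε / 2 * ξ ^ 2 : ℝ) * q₁ t ξ)
      + (src t ξ - ampOp N (p t) (q t) ξ)) (Icc t₀ t₁) t

/-- The frozen-coefficient step maps balls to bounded sets and is Lipschitz with constant `A/μ`,
where `A` depends only on the radius. -/
lemma exists_step_bound (N : Nonlinearity) {s : ℝ} (hs : 0 ≤ s) (R : ℝ≥0) :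
    ∃ A : ℝ≥0, ∀ (ω₀ μ t₀ t₁ ε : ℝ) (src p q p₁ q₁ p' q' p₁' q₁' : ℝ → ℝ → ℂ)
      (r ρ₀ ρ : ℝ≥0∞), 0 < μ → (∀ t ∈ Icc t₀ t₁, 0 ≤ weight ω₀ μ t) →
      Close (weight ω₀ μ) (Icc t₀ t₁) s p q p' q' R r →
      IsStep N ε t₀ t₁ 0 p q p₁ q₁ → IsStep N ε t₀ t₁ src p' q' p₁' q₁' →
      Dom (weight ω₀ μ) (Icc t₀ t₁) s src ρ →
      (Dom (weight ω₀ μ) {t₀} (s + 2) p₁ ρ₀ → Dom (weight ω₀ μ) {t₀} (s + 1) q₁ ρ₀ →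
        Dom (weight ω₀ μ) (Icc t₀ t₁) (s + 2) p₁ (ρ₀ + ENNReal.ofReal μ⁻¹ * A) ∧
        Dom (weight ω₀ μ) (Icc t₀ t₁) (s + 1) q₁ (ρ₀ + ENNReal.ofReal μ⁻¹ * A)) ∧
      (Dom (weight ω₀ μ) {t₀} (s + 2) (fun t ξ => p₁ t ξ - p₁' t ξ) ρ₀ →
        Dom (weight ω₀ μ) {t₀} (s + 1) (fun t ξ => q₁ t ξ - q₁' t ξ) ρ₀ →
        Dom (weight ω₀ μ) (Icc t₀ t₁) (s + 2) (fun t ξ => p₁ t ξ - p₁' t ξ)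
          (ρ₀ + ENNReal.ofReal μ⁻¹ * (A * r + ρ)) ∧
        Dom (weight ω₀ μ) (Icc t₀ t₁) (s + 1) (fun t ξ => q₁ t ξ - q₁' t ξ)
          (ρ₀ + ENNReal.ofReal μ⁻¹ * (A * r + ρ))) := by
  obtain ⟨A, hA⟩ := LipOp.phaseOp hs N R
  obtain ⟨B, hB⟩ := LipOp.ampOp hs N R
  have e : s + 2 = s + 1 + 1 := by ring
  refine ⟨max A B, fun ω₀ μ t₀ t₁ ε src p q p₁ q₁ p' q' p₁' q₁' r ρ₀ ρ hμ hω hc h1 h2 hsrc => ?_⟩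
  obtain ⟨a1, -, a3, -⟩ := hA _ _ p q p' q' r hω hc
  obtain ⟨b1, -, b3, -⟩ := hB _ _ p q p' q' r hω hc
  have hAm : (A : ℝ≥0∞) ≤ (max A B : ℝ≥0) := by exact_mod_cast le_max_left A B
  have hBm : (B : ℝ≥0∞) ≤ (max A B : ℝ≥0) := by exact_mod_cast le_max_right A B
  refine ⟨fun i1 i2 => ⟨?_, ?_⟩, fun i1 i2 => ⟨?_, ?_⟩⟩
  · rw [e] at i1 ⊢
    refine (Dom.gain hμ (κ := 0) (fun t ht => (h1.1 t ht).1) ?_ i1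
      ((a1.const_mul (-1)).mono (R' := A) (by simp))).mono (by gcongr)
    filter_upwards [h1.2] with ξ h t ht
    simpa using (h t ht).1
  · refine (Dom.gain hμ (κ := fun ξ => ε / 2 * ξ ^ 2) (fun t ht => (h1.1 t ht).2) ?_ i2
      ((b1.const_mul (-1)).mono (R' := B) (by simp))).mono (by gcongr)
    filter_upwards [h1.2] with ξ h t ht
    simpa using (h t ht).2
  · rw [e] at i1 ⊢
    refine (Dom.gain hμ (κ := 0) (fun t ht => (h1.1 t ht).1.sub (h2.1 t ht).1) ?_ i1
      ((a3.const_mul (-1)).mono (R' := A * r) (by simp))).mono ?_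
    · filter_upwards [h1.2, h2.2] with ξ h h' t ht
      refine ((h t ht).1.sub (h' t ht).1).congr_deriv ?_
      simp only [Pi.zero_apply, Pi.sub_apply, Complex.ofReal_zero]
      ring
    · gcongr
      exact (mul_le_mul_left hAm r).trans le_self_add
  · refine (Dom.gain hμ (κ := fun ξ => ε / 2 * ξ ^ 2)
      (fun t ht => (h1.1 t ht).2.sub (h2.1 t ht).2) ?_ i2
      (((b3.const_mul (-1)).add (hsrc.const_mul (-1))).mono (R' := B * r + ρ) (by simp))).mono
      (by gcongr)
    filter_upwards [h1.2, h2.2] with ξ h h' t ht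
    refine ((h t ht).2.sub (h' t ht).2).congr_deriv ?_
    simp only [Pi.zero_apply, Pi.sub_apply]
    ring

/-! ### Invariance properties of the nonlinear terms -/

lemma mulI_congr_ae {f g : ℝ → ℂ} (h : f =ᵐ[volume] g) : mulI f =ᵐ[volume] mulI g := by
  filter_upwards [h] with ξ hξ
  simp [mulI, hξ]

lemma refl_congr_ae {f g : ℝ → ℂ} (h : f =ᵐ[volume] g) : refl f =ᵐ[volume] refl g := by
  filter_upwards [(Measure.measurePreserving_neg volume).quasiMeasurePreserving.ae h] with ξ hξ
  simp [refl, hξ]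

lemma powOp_congr_ae {q q' : ℝ → ℂ} (h : q =ᵐ[volume] q') (c : ℝ) (n : ℕ) :
    powOp c n q = powOp c n q' := by
  have : conv q (refl q) = conv q' (refl q') :=
    funext fun ξ => conv_congr_ae h (refl_congr_ae h) ξ
  ext ξ
  simp [powOp, this]

/-- Convolutions do not see null sets, so the nonlinear terms agree at every frequency. -/
lemma phaseOp_congr_ae {p q p' q' : ℝ → ℂ} (N : Nonlinearity) (hp : p =ᵐ[volume] p')
    (hq : q =ᵐ[volume] q') : phaseOp N p q = phaseOp N p' q' := by
  ext ξ
  simp only [phaseOp, powOp_congr_ae hq]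
  rw [conv_congr_ae (mulI_congr_ae hp) (mulI_congr_ae hp),
    conv_congr_ae (ae_eq_refl _) (mulI_congr_ae hp)]

lemma ampOp_congr_ae {p q p' q' : ℝ → ℂ} (N : Nonlinearity) (hp : p =ᵐ[volume] p')
    (hq : q =ᵐ[volume] q') : ampOp N p q = ampOp N p' q' := by
  ext ξ
  simp only [ampOp, powOp_congr_ae hq, mulI]
  rw [conv_congr_ae (mulI_congr_ae hp) (mulI_congr_ae hq),
    conv_congr_ae hq (mulI_congr_ae (mulI_congr_ae hp)), conv_congr_ae (ae_eq_refl _) hq]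

lemma refl_refl (f : ℝ → ℂ) : refl (refl f) = f := by ext ξ; simp [refl]

lemma refl_mulI (f : ℝ → ℂ) : refl (mulI f) = mulI (refl f) := by
  ext ξ; simp [refl, mulI]

lemma refl_conv (f g : ℝ → ℂ) : refl (conv f g) = conv (refl f) (refl g) := by
  ext ξ
  simp only [refl, conv]
  rw [← integral_conj, ← integral_neg_eq_self]
  simp [sub_eq_add_neg, add_comm]

lemma refl_powOp (c : ℝ) (n : ℕ) (q : ℝ → ℂ) : refl (powOp c n q) = powOp c n q := by
  have h : ∀ f : ℝ → ℂ, refl f = f → ∀ n, refl (convPow f n) = convPow f n := by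
    intro f hf n
    induction n with
    | zero => exact hf
    | succ n ih => simp only [convPow, refl_conv, hf, ih]
  have h1 := h (conv q (refl q)) (by rw [refl_conv, refl_refl, conv_comm]) n
  ext ξ
  have := congrFun h1 ξ
  simp only [refl, powOp, map_mul, Complex.conj_ofReal] at this ⊢
  rw [this]

/-- The phase equation has a real right-hand side when the phase is real. -/
lemma refl_phaseOp {p q : ℝ → ℂ} (N : Nonlinearity) (hp : refl p =ᵐ[volume] p) :
    refl (phaseOp N p q) = phaseOp N p q := by
  conv_rhs => rw [← phaseOp_congr_ae N hp (ae_eq_refl q)]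
  ext ξ
  have h1 := congrFun (refl_conv (mulI p) (mulI p)) ξ
  have h2 := congrFun (refl_conv (powOp N.α (N.γ - 1) q) (mulI p)) ξ
  have h3 := congrFun (refl_powOp N.lam (N.σ - 1) q) ξ
  rw [refl_mulI, refl_powOp] at h2
  rw [refl_mulI] at h1
  simp only [refl] at h1 h2 h3
  simp only [phaseOp, ← h1, ← h2]
  simp only [refl, phaseOp, map_add, map_mul, map_div₀, map_one, map_ofNat, h3]

/-! ### The Duhamel formula -/

/-- The Duhamel formula for the solution of `y' = -iκ(ξ) y + h`, `y(0) = y₀`, for each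
frequency `ξ`. -/
def evol (κ : ℝ → ℝ) (y₀ : ℝ → ℂ) (h : ℝ → ℝ → ℂ) (t ξ : ℝ) : ℂ :=
  Complex.exp (-(Complex.I * κ ξ * t)) *
    (y₀ ξ + ∫ τ in Ioc 0 t, Complex.exp (Complex.I * κ ξ * τ) * h τ ξ)

lemma evol_zero (κ : ℝ → ℝ) (y₀ : ℝ → ℂ) (h : ℝ → ℝ → ℂ) : evol κ y₀ h 0 = y₀ := by
  ext ξ; simp [evol]

lemma measurable_evol {κ : ℝ → ℝ} {y₀ : ℝ → ℂ} {h : ℝ → ℝ → ℂ} (hκ : Measurable κ)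
    (hy₀ : Measurable y₀) (hh : Measurable (Function.uncurry h)) :
    Measurable (Function.uncurry (evol κ y₀ h)) := by
  have h1 : StronglyMeasurable fun z : (ℝ × ℝ) × ℝ =>
      {z : (ℝ × ℝ) × ℝ | z.2 ∈ Ioc 0 z.1.1}.indicator
      (fun z => Complex.exp (Complex.I * κ z.1.2 * z.2) * Function.uncurry h (z.2, z.1.2)) z := by
    refine (Measurable.indicator ?_ ?_).stronglyMeasurable
    · exact Measurable.mul (by fun_prop) (hh.comp (by fun_prop))
    · exact (measurableSet_lt measurable_const measurable_snd).inter
        (measurableSet_le measurable_snd (by fun_prop))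
  have h2 : Function.uncurry (evol κ y₀ h) = fun z : ℝ × ℝ =>
      Complex.exp (-(Complex.I * κ z.2 * z.1)) * (y₀ z.2 + ∫ τ,
        {z : (ℝ × ℝ) × ℝ | z.2 ∈ Ioc 0 z.1.1}.indicator
      (fun z => Complex.exp (Complex.I * κ z.1.2 * z.2) * Function.uncurry h (z.2, z.1.2))
      (z, τ)) := by
    ext ⟨t, ξ⟩
    simp only [Function.uncurry, evol]
    rw [← integral_indicator measurableSet_Ioc]
    rfl
  rw [h2]
  exact Measurable.mul (by fun_prop)
    ((hy₀.comp measurable_snd).add h1.integral_prod_right.measurable)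

lemma hasDerivWithinAt_evol {κ : ℝ → ℝ} {y₀ : ℝ → ℂ} {h : ℝ → ℝ → ℂ} {T ξ t : ℝ}
    (hh : ContinuousOn (fun τ => h τ ξ) (Icc 0 T)) (ht : t ∈ Icc 0 T) :
    HasDerivWithinAt (fun τ => evol κ y₀ h τ ξ)
      (-(Complex.I * κ ξ * evol κ y₀ h t ξ) + h t ξ) (Icc 0 T) t := by
  have hT : 0 ≤ T := ht.1.trans ht.2
  set g : ℝ → ℂ := fun τ => Complex.exp (Complex.I * κ ξ * τ) * h τ ξ with hg
  have hgc : ContinuousOn g (Icc 0 T) := ContinuousOn.mul (by fun_prop) hh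
  -- extending the integrand continuously gives two-sided derivatives, also at the end points
  set G : ℝ → ℂ := IccExtend hT ((Icc 0 T).domRestrict g) with hG
  have hGc : Continuous G := (continuousOn_iff_continuous_domRestrict.1 hgc).Icc_extend'
  have hGg : ∀ τ ∈ Icc 0 T, G τ = g τ := fun τ hτ => by
    rw [hG, IccExtend_of_mem hT _ hτ]; rfl
  have h1 : HasDerivAt (fun τ : ℝ => Complex.exp (-(Complex.I * κ ξ * τ)))
      (Complex.exp (-(Complex.I * κ ξ * t)) * -(Complex.I * κ ξ)) t := by
    have := (Complex.ofRealCLM.hasDerivAt (x := t)).const_mul (Complex.I * κ ξ)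
    simpa using this.neg.cexp
  have h2 : HasDerivAt (fun τ => y₀ ξ + ∫ u in (0 : ℝ)..τ, G u) (G t) t :=
    (intervalIntegral.integral_hasDerivAt_right (hGc.intervalIntegrable _ _)
      (hGc.stronglyMeasurableAtFilter _ _) hGc.continuousAt).const_add _
  have h3 : ∀ τ ∈ Icc 0 T, evol κ y₀ h τ ξ =
      Complex.exp (-(Complex.I * κ ξ * τ)) * (y₀ ξ + ∫ u in (0 : ℝ)..τ, G u) := by
    intro τ hτ
    rw [evol, intervalIntegral.integral_of_le hτ.1]
    congr 2
    refine setIntegral_congr_fun measurableSet_Ioc fun u hu => ?_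
    exact (hGg u ⟨hu.1.le, hu.2.trans hτ.2⟩).symm
  refine ((h1.mul h2).hasDerivWithinAt.congr h3 (h3 t ht)).congr_deriv ?_
  rw [h3 t ht, hGg t ht, hg]
  have : Complex.exp (-(Complex.I * κ ξ * t)) * Complex.exp (Complex.I * κ ξ * t) = 1 := by
    rw [← Complex.exp_add]; simp
  linear_combination (h t ξ) * this

/-! ### Limits of sequences of dominated functions -/

section Limit

variable {ω : ℝ → ℝ} {S : Set ℝ} {s : ℝ}

/-- A function dominated with arbitrarily small constants vanishes, at almost every frequency for
all times: the infimum of the majorants is `0` almost everywhere. -/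
lemma Dom.ae_eq_zero {f : ℝ → ℝ → ℂ} {r : ℕ → ℝ≥0∞} (hr : Tendsto r atTop (𝓝 0))
    (h : ∀ n, Dom ω S s f (r n)) : ∀ᵐ ξ, ∀ t ∈ S, f t ξ = 0 := by
  choose _ K hK hKr hb using h
  have h0 : wNorm s (fun ξ => ⨅ n, K n ξ) = 0 := by
    refine le_antisymm (ge_of_tendsto' hr fun n => ?_) zero_le
    exact (wNorm_mono fun ξ => iInf_le _ n).trans (hKr n)
  rw [wNorm, eLpNorm_eq_zero_iff (Measurable.aestronglyMeasurable (by fun_prop))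
    (by norm_num)] at h0
  filter_upwards [h0, ae_all_iff.2 hb] with ξ h1 h2 t ht
  have h3 : ⨅ n, K n ξ = 0 := by simpa [br_ne_zero] using h1
  have h4 : ‖f t ξ‖ₑ ≤ ex ω t ξ * ⨅ n, K n ξ := by
    rw [ENNReal.mul_iInf_of_ne (by simp [ex, Real.exp_pos]) (ex_ne_top _ _ _)]
    exact le_iInf fun n => h2 n t ht
  simpa [h3] using h4

/-- A sequence whose increments decay geometrically converges. The common majorant
`(∑ 4ⁿ Kₙ²)^(1/2)` of the increments makes the convergence uniform in time at almost every
frequency. -/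
lemma exists_limit {f : ℕ → ℝ → ℝ → ℂ} {r : ℝ≥0} (hω : ∀ t ∈ S, 0 ≤ ω t)
    (hf : ∀ n, Reg S (f n))
    (hd : ∀ n, Dom ω S s (fun t ξ => f (n + 1) t ξ - f n t ξ) (r * 4⁻¹ ^ n)) :
    ∃ g, Reg S g ∧ (∀ n, Dom ω S s (fun t ξ => g t ξ - f n t ξ) (4 * r * 2⁻¹ ^ n)) ∧
      ∀ᵐ ξ, ∀ t ∈ S, Tendsto (fun n => f n t ξ) atTop (𝓝 (g t ξ)) := by
  choose _ K hK hKr hb using hd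
  set L : ℝ → ℝ≥0∞ := fun ξ => (∑' n, 4 ^ n * K n ξ ^ 2) ^ (1 / 2 : ℝ) with hL
  have hLm : Measurable L := by
    refine Measurable.pow_const (Measurable.tsum fun n => ?_) _
    fun_prop
  have hL2 : ∀ ξ, L ξ ^ 2 = ∑' n, 4 ^ n * K n ξ ^ 2 := fun ξ => by
    rw [hL, ← ENNReal.rpow_natCast, ← ENNReal.rpow_mul]; norm_num
  have hLn : wNorm s L ≤ 2 * r := by
    rw [wNorm_le_iff]
    simp_rw [mul_pow, hL2]
    simp_rw [← ENNReal.tsum_mul_left]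
    rw [lintegral_tsum fun n => by fun_prop]
    calc ∑' n, ∫⁻ ξ, br s ξ ^ 2 * (4 ^ n * K n ξ ^ 2)
        ≤ ∑' n : ℕ, (r : ℝ≥0∞) ^ 2 * 4⁻¹ ^ n := by
          refine ENNReal.tsum_le_tsum fun n => ?_
          have : ∀ ξ, br s ξ ^ 2 * (4 ^ n * K n ξ ^ 2) = 4 ^ n * (br s ξ * K n ξ) ^ 2 :=
            fun ξ => by ring
          simp_rw [this]
          rw [lintegral_const_mul _ (by fun_prop), ← wNorm_sq]
          calc _ ≤ 4 ^ n * ((r : ℝ≥0∞) * 4⁻¹ ^ n) ^ 2 := by gcongr; exact hKr n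
            _ = r ^ 2 * ((4 * 4⁻¹) ^ n * 4⁻¹ ^ n) := by ring
            _ = _ := by
              rw [ENNReal.mul_inv_cancel (by norm_num) (by norm_num)]; simp
      _ = (r : ℝ≥0∞) ^ 2 * (1 - 4⁻¹)⁻¹ := by
          rw [ENNReal.tsum_mul_left, ENNReal.tsum_geometric]
      _ ≤ r ^ 2 * 4 := by
          gcongr
          rw [ENNReal.inv_le_iff_inv_le]
          have h4 : (4⁻¹ : ℝ≥0∞) = ENNReal.ofReal (1 / 4) := by
            rw [ENNReal.ofReal_div_of_pos (by norm_num)]; simp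
          rw [h4, ← ENNReal.ofReal_one, ← ENNReal.ofReal_sub _ (by norm_num)]
          exact ENNReal.ofReal_le_ofReal (by norm_num)
      _ = _ := by ring
  have hKL : ∀ n ξ, K n ξ ≤ 2⁻¹ ^ n * L ξ := by
    intro n ξ
    have h1 : (2 ^ n * K n ξ) ^ 2 ≤ L ξ ^ 2 := by
      rw [hL2]
      refine le_trans (le_of_eq ?_) (ENNReal.le_tsum n)
      rw [mul_pow, ← pow_mul, mul_comm n 2, pow_mul]; norm_num
    have h2 := (ENNReal.pow_le_pow_left_iff (by norm_num)).1 h1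
    calc K n ξ = 2⁻¹ ^ n * (2 ^ n * K n ξ) := by
          rw [← mul_assoc, ← mul_pow, ENNReal.inv_mul_cancel (by norm_num) (by norm_num)]; simp
      _ ≤ _ := by gcongr
  have hLfin := ae_lt_top_of_wNorm hLm (s := s)
    (ne_top_of_le_ne_top (ENNReal.mul_ne_top (by norm_num) (by simp)) hLn)
  have hdist : ∀ᵐ ξ, ∀ t ∈ S, ∀ n,
      dist (f n t ξ) (f (n + 1) t ξ) ≤ (ex ω t ξ * L ξ).toReal * (1 / 2) ^ n := by
    filter_upwards [hLfin, ae_all_iff.2 hb] with ξ h1 h2 t ht n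
    rw [dist_comm, dist_eq_norm, ← toReal_enorm]
    have : ‖f (n + 1) t ξ - f n t ξ‖ₑ ≤ ex ω t ξ * L ξ * 2⁻¹ ^ n := by
      refine (h2 n t ht).trans ?_
      calc _ ≤ ex ω t ξ * (2⁻¹ ^ n * L ξ) := by gcongr; exact hKL n ξ
        _ = _ := by ring
    refine (ENNReal.toReal_mono (ENNReal.mul_ne_top (ENNReal.mul_ne_top (ex_ne_top _ _ _) h1.ne)
      (ENNReal.pow_ne_top (by simp))) this).trans (le_of_eq ?_)
    simp [ENNReal.toReal_mul]
  set g : ℝ → ℝ → ℂ := fun t ξ => limUnder atTop fun n => f n t ξ with hg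
  have hlim : ∀ᵐ ξ, ∀ t ∈ S, Tendsto (fun n => f n t ξ) atTop (𝓝 (g t ξ)) := by
    filter_upwards [hdist] with ξ h1 t ht
    exact (cauchySeq_of_le_geometric _ _ (by norm_num) (h1 t ht)).tendsto_limUnder
  -- geometric increments: the distance to the limit is at most twice the next increment
  have hest : ∀ᵐ ξ, ∀ t ∈ S, ∀ n, dist (f n t ξ) (g t ξ) ≤
      2 * (ex ω t ξ * L ξ).toReal * (1 / 2) ^ n := by
    filter_upwards [hdist, hlim] with ξ h1 h2 t ht n
    refine (dist_le_of_le_geometric_of_tendsto _ _ (by norm_num) (h1 t ht) (h2 t ht) n).trans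
      (le_of_eq ?_)
    ring
  have hgm : Measurable (Function.uncurry g) := by
    have : StronglyMeasurable fun z : ℝ × ℝ => limUnder atTop fun n => Function.uncurry (f n) z :=
      StronglyMeasurable.limUnder fun n => (hf n).1.stronglyMeasurable
    exact this.measurable
  refine ⟨g, ⟨hgm, ?_⟩, fun n => ⟨?_, fun ξ => 2 * 2⁻¹ ^ n * L ξ, by fun_prop, ?_, ?_⟩, hlim⟩
  · filter_upwards [hest, hLfin, ae_all_iff.2 fun n => (hf n).2] with ξ h1 h2 h3
    have : TendstoUniformlyOn (fun n t => f n t ξ) (fun t => g t ξ) atTop S := by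
      rw [Metric.tendstoUniformlyOn_iff]
      intro δ hδ
      have h4 : Tendsto (fun n : ℕ => 2 * (L ξ).toReal * (1 / 2 : ℝ) ^ n) atTop (𝓝 0) := by
        simpa using (tendsto_pow_atTop_nhds_zero_of_lt_one (by norm_num : (0 : ℝ) ≤ 1 / 2)
          (by norm_num)).const_mul (2 * (L ξ).toReal)
      filter_upwards [h4.eventually (gt_mem_nhds hδ)] with n hn t ht
      rw [dist_comm]
      refine (h1 t ht n).trans_lt (lt_of_le_of_lt ?_ hn)
      gcongr
      · exact h2.ne
      · exact mul_le_of_le_one_left' (ex_le_one (hω t ht) ξ)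
    exact this.continuousOn (Frequently.of_forall h3)
  · exact fun t ht => ((hgm.comp measurable_prodMk_left).sub
      ((hf n).1.comp measurable_prodMk_left)).aestronglyMeasurable
  · rw [wNorm_const_mul _ hLm]
    calc _ ≤ 2 * 2⁻¹ ^ n * (2 * (r : ℝ≥0∞)) := by gcongr
      _ = _ := by ring
  · filter_upwards [hest, hLfin] with ξ h1 h2 t ht
    have := h1 t ht n
    rw [dist_comm, dist_eq_norm] at this
    rw [← ofReal_norm]
    refine (ENNReal.ofReal_le_ofReal this).trans (le_of_eq ?_)
    rw [ENNReal.ofReal_mul (by positivity), ENNReal.ofReal_mul (by positivity),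
      ENNReal.ofReal_toReal (ENNReal.mul_ne_top (ex_ne_top _ _ _) h2.ne),
      ENNReal.ofReal_pow (by positivity)]
    have : ENNReal.ofReal (1 / 2) = 2⁻¹ := by
      rw [ENNReal.ofReal_div_of_pos (by norm_num)]; simp
    rw [this, ENNReal.ofReal_ofNat]
    ring

end Limit

/-! ### Existence on the Fourier side -/

/-- One step of the Picard iteration: the linear equations with nonlinear terms frozen at `u`. -/
def picard (N : Nonlinearity) (ε : ℝ) (p₀ q₀ : ℝ → ℂ) (u : (ℝ → ℝ → ℂ) × (ℝ → ℝ → ℂ)) :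
    (ℝ → ℝ → ℂ) × (ℝ → ℝ → ℂ) :=
  (evol 0 p₀ fun t ξ => -phaseOp N (u.1 t) (u.2 t) ξ,
    evol (fun ξ => ε / 2 * ξ ^ 2) q₀ fun t ξ => 0 - ampOp N (u.1 t) (u.2 t) ξ)

/-- The Picard iterates, starting from `0`. -/
def picardSeq (N : Nonlinearity) (ε : ℝ) (p₀ q₀ : ℝ → ℂ) : ℕ → (ℝ → ℝ → ℂ) × (ℝ → ℝ → ℂ)
  | 0 => (0, 0)
  | n + 1 => picard N ε p₀ q₀ (picardSeq N ε p₀ q₀ n)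

lemma picard_fst_zero (N : Nonlinearity) (ε : ℝ) (p₀ q₀ : ℝ → ℂ)
    (u : (ℝ → ℝ → ℂ) × (ℝ → ℝ → ℂ)) : (picard N ε p₀ q₀ u).1 0 = p₀ := evol_zero _ _ _

lemma picard_snd_zero (N : Nonlinearity) (ε : ℝ) (p₀ q₀ : ℝ → ℂ)
    (u : (ℝ → ℝ → ℂ) × (ℝ → ℝ → ℂ)) : (picard N ε p₀ q₀ u).2 0 = q₀ := evol_zero _ _ _

section Picard

variable {N : Nonlinearity} {ε T s : ℝ} {p₀ q₀ : ℝ → ℂ} {u : (ℝ → ℝ → ℂ) × (ℝ → ℝ → ℂ)}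
  {ω : ℝ → ℝ} {S : Set ℝ}

lemma Dom.diff_self {f : ℝ → ℝ → ℂ} : Dom ω S s (fun t ξ => f t ξ - f t ξ) 0 :=
  Dom.zero.congr (ae_of_all _ fun ξ t _ => by simp)

lemma Close.self {p q : ℝ → ℝ → ℂ} {R : ℝ≥0∞} (hp : Dom ω S (s + 2) p R)
    (hq : Dom ω S (s + 1) q R) : Close ω S s p q p q R 0 :=
  ⟨hp, hq, hp, hq, Dom.diff_self, Dom.diff_self⟩

lemma Reg.sections {f : ℝ → ℝ → ℂ} (h : Reg S f) (t : ℝ) : AEStronglyMeasurable (f t) volume :=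
  (h.1.comp measurable_prodMk_left).aestronglyMeasurable

lemma evol_reg {κ : ℝ → ℝ} {y₀ : ℝ → ℂ} {h : ℝ → ℝ → ℂ} (hκ : Measurable κ) (hy : Measurable y₀)
    (hh : Reg (Icc 0 T) h) : Reg (Icc 0 T) (evol κ y₀ h) := by
  refine ⟨measurable_evol hκ hy hh.1, ?_⟩
  filter_upwards [hh.2] with ξ h1 t ht
  exact (hasDerivWithinAt_evol h1 ht).continuousWithinAt

lemma picard_step (hs : 0 ≤ s) (hω : ∀ t ∈ Icc 0 T, 0 ≤ ω t) (hp₀ : Measurable p₀)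
    (hq₀ : Measurable q₀) {R : ℝ≥0} (h1 : Reg (Icc 0 T) u.1) (h2 : Reg (Icc 0 T) u.2)
    (d1 : Dom ω (Icc 0 T) (s + 2) u.1 R) (d2 : Dom ω (Icc 0 T) (s + 1) u.2 R) :
    Reg (Icc 0 T) (picard N ε p₀ q₀ u).1 ∧ Reg (Icc 0 T) (picard N ε p₀ q₀ u).2 ∧
      IsStep N ε 0 T 0 u.1 u.2 (picard N ε p₀ q₀ u).1 (picard N ε p₀ q₀ u).2 := by
  obtain ⟨A, hA⟩ := LipOp.phaseOp hs N R
  obtain ⟨B, hB⟩ := LipOp.ampOp hs N R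
  have r1 := (hA _ _ _ _ _ _ _ hω (Close.self d1 d2)).2.2.2 h1 h2
  have r2 := (hB _ _ _ _ _ _ _ hω (Close.self d1 d2)).2.2.2 h1 h2
  have r1' : Reg (Icc 0 T) fun t ξ => -phaseOp N (u.1 t) (u.2 t) ξ := by
    simpa using r1.const_mul (-1)
  have r2' : Reg (Icc 0 T) fun t ξ => 0 - ampOp N (u.1 t) (u.2 t) ξ := by
    simpa using r2.const_mul (-1)
  have g1 : Reg (Icc 0 T) (picard N ε p₀ q₀ u).1 := evol_reg measurable_const hp₀ r1'
  have g2 : Reg (Icc 0 T) (picard N ε p₀ q₀ u).2 := evol_reg (by fun_prop) hq₀ r2'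
  refine ⟨g1, g2, fun t _ => ⟨g1.sections t, g2.sections t⟩, ?_⟩
  filter_upwards [r1'.2, r2'.2] with ξ k1 k2 t ht
  have e1 := hasDerivWithinAt_evol (κ := 0) (y₀ := p₀)
    (h := fun t ξ => -phaseOp N (u.1 t) (u.2 t) ξ) k1 ht
  have e2 := hasDerivWithinAt_evol (κ := fun ξ => ε / 2 * ξ ^ 2) (y₀ := q₀)
    (h := fun t ξ => 0 - ampOp N (u.1 t) (u.2 t) ξ) k2 ht
  exact ⟨e1.congr_deriv (by simp), e2⟩

/-- The phase remains real: without the skew-adjoint term the Duhamel formula commutes with the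
reflection. -/
lemma refl_evol_zero {h : ℝ → ℝ → ℂ} (t : ℝ) (hp₀ : refl p₀ =ᵐ[volume] p₀)
    (hh : ∀ τ ∈ Ioc 0 t, refl (h τ) = h τ) : refl (evol 0 p₀ h t) =ᵐ[volume] evol 0 p₀ h t := by
  filter_upwards [hp₀] with ξ h1
  simp only [refl] at h1
  simp only [refl, evol, Pi.zero_apply, Complex.ofReal_zero, mul_zero, zero_mul, neg_zero,
    Complex.exp_zero, one_mul, map_add, h1]
  rw [← integral_conj]
  congr 1
  refine setIntegral_congr_fun measurableSet_Ioc fun τ hτ => ?_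
  exact congrFun (hh τ hτ) ξ

lemma refl_picard (hp₀ : refl p₀ =ᵐ[volume] p₀)
    (hu : ∀ t ∈ Icc 0 T, refl (u.1 t) =ᵐ[volume] u.1 t) :
    ∀ t ∈ Icc 0 T, refl ((picard N ε p₀ q₀ u).1 t) =ᵐ[volume] (picard N ε p₀ q₀ u).1 t := by
  intro t ht
  refine refl_evol_zero t hp₀ fun τ hτ => ?_
  have h := refl_phaseOp N (q := u.2 τ) (hu τ ⟨hτ.1.le, hτ.2.trans ht.2⟩)
  ext ξ
  have := congrFun h ξ
  simp only [refl, map_neg] at this ⊢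
  rw [this]

end Picard

lemma IsStep.congr {N : Nonlinearity} {ε t₀ t₁ : ℝ} {src p q p' q' p₁ q₁ : ℝ → ℝ → ℂ}
    (h : IsStep N ε t₀ t₁ src p q p₁ q₁)
    (hp : ∀ t ∈ Icc t₀ t₁, p t =ᵐ[volume] p' t) (hq : ∀ t ∈ Icc t₀ t₁, q t =ᵐ[volume] q' t) :
    IsStep N ε t₀ t₁ src p' q' p₁ q₁ := by
  refine ⟨h.1, h.2.mono fun ξ hξ t ht => ?_⟩
  rw [← phaseOp_congr_ae N (hp t ht) (hq t ht), ← ampOp_congr_ae N (hp t ht) (hq t ht)]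
  exact hξ t ht

/-- Existence for the system on the Fourier side. If the weight shrinks fast enough, depending only
on the size of the data, Picard's iteration converges geometrically: the derivative lost in the
nonlinear terms is the one gained from the weight. -/
theorem exists_fourier_solution (N : Nonlinearity) {s : ℝ} (hs : 0 ≤ s) (R₀ : ℝ≥0) :
    ∃ μ₀ : ℝ, 0 < μ₀ ∧ ∃ R : ℝ≥0, ∀ (μ ω₀ T ε : ℝ) (p₀ q₀ : ℝ → ℂ), μ₀ ≤ μ → 0 ≤ T →
      (∀ t ∈ Icc 0 T, 0 ≤ weight ω₀ μ t) → Measurable p₀ → Measurable q₀ →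
      refl p₀ =ᵐ[volume] p₀ → Dom (weight ω₀ μ) {0} (s + 2) (fun _ => p₀) R₀ →
      Dom (weight ω₀ μ) {0} (s + 1) (fun _ => q₀) R₀ →
      ∃ p q : ℝ → ℝ → ℂ, IsStep N ε 0 T 0 p q p q ∧
        Dom (weight ω₀ μ) (Icc 0 T) (s + 2) p R ∧ Dom (weight ω₀ μ) (Icc 0 T) (s + 1) q R ∧
        p 0 = p₀ ∧ q 0 = q₀ ∧ ∀ t ∈ Icc 0 T, refl (p t) =ᵐ[volume] p t := by
  set R : ℝ≥0 := R₀ + 1 with hR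
  obtain ⟨A, hA⟩ := exists_step_bound N hs (4 * R)
  refine ⟨4 * A + 1, by positivity, 4 * R, ?_⟩
  intro μ ω₀ T ε p₀ q₀ hμ hT hω hp₀ hq₀ hsym hd1 hd2
  have hμ0 : 0 < μ := lt_of_lt_of_le (by positivity) hμ
  have hA4 : ENNReal.ofReal μ⁻¹ * A ≤ 4⁻¹ := by
    have h4 : (4⁻¹ : ℝ≥0∞) = ENNReal.ofReal (1 / 4) := by
      rw [ENNReal.ofReal_div_of_pos (by norm_num)]; simp
    rw [h4, ← ENNReal.ofReal_coe_nnreal, ← ENNReal.ofReal_mul (by positivity)]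
    refine ENNReal.ofReal_le_ofReal ?_
    rw [inv_mul_le_iff₀ hμ0]
    linarith
  have hR4 : ((R : ℝ≥0) : ℝ≥0∞) ≤ (4 * R : ℝ≥0) := by
    exact_mod_cast le_mul_of_one_le_left' (by norm_num)
  set ω := weight ω₀ μ with hωdef
  obtain ⟨U, hU, hUs⟩ : ∃ U : ℕ → (ℝ → ℝ → ℂ) × (ℝ → ℝ → ℂ), U 0 = (0, 0) ∧
      ∀ n, U (n + 1) = picard N ε p₀ q₀ (U n) :=
    ⟨picardSeq N ε p₀ q₀, rfl, fun _ => rfl⟩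
  have hU0 : ∀ n, ∀ ξ, (U (n + 1)).1 0 ξ = p₀ ξ ∧ (U (n + 1)).2 0 ξ = q₀ ξ := fun n ξ => by
    rw [hUs, picard_fst_zero, picard_snd_zero]
    exact ⟨rfl, rfl⟩
  -- all iterates are regular and stay in the ball of radius `R`
  have hball : ∀ n, Reg (Icc 0 T) (U n).1 ∧ Reg (Icc 0 T) (U n).2 ∧
      Dom ω (Icc 0 T) (s + 2) (U n).1 R ∧ Dom ω (Icc 0 T) (s + 1) (U n).2 R := by
    intro n
    induction n with
    | zero =>
      have hz : Reg (Icc 0 T) (0 : ℝ → ℝ → ℂ) :=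
        ⟨measurable_const, ae_of_all _ fun _ => continuousOn_const⟩
      rw [hU]
      exact ⟨hz, hz, Dom.zero.mono zero_le, Dom.zero.mono zero_le⟩
    | succ n ih =>
      obtain ⟨r1, r2, d1, d2⟩ := ih
      obtain ⟨r1', r2', hst⟩ := picard_step (N := N) (ε := ε) hs hω hp₀ hq₀ r1 r2 d1 d2
      rw [← hUs] at r1' r2' hst
      have d := (hA ω₀ μ 0 T ε 0 _ _ _ _ _ _ _ _ 0 R₀ 0 hμ0 hω
        (Close.self (d1.mono hR4) (d2.mono hR4)) hst hst Dom.zero).1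
        (hd1.congr (ae_of_all _ fun ξ t ht => by rw [mem_singleton_iff.1 ht, (hU0 n ξ).1]))
        (hd2.congr (ae_of_all _ fun ξ t ht => by rw [mem_singleton_iff.1 ht, (hU0 n ξ).2]))
      have hle : (R₀ : ℝ≥0∞) + ENNReal.ofReal μ⁻¹ * A ≤ (R : ℝ≥0) := by
        rw [hR]; push_cast
        gcongr
        exact hA4.trans (by norm_num)
      exact ⟨r1', r2', d.1.mono hle, d.2.mono hle⟩
  have hstep : ∀ n, IsStep N ε 0 T 0 (U n).1 (U n).2 (U (n + 1)).1 (U (n + 1)).2 := fun n => by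
    rw [hUs]
    exact (picard_step hs hω hp₀ hq₀ (hball n).1 (hball n).2.1 (hball n).2.2.1 (hball n).2.2.2).2.2
  have hzero : ∀ {σ : ℝ} {f g : ℝ → ℝ → ℂ}, (∀ ξ, f 0 ξ = g 0 ξ) →
      Dom ω {0} σ (fun t ξ => f t ξ - g t ξ) 0 := fun h =>
    Dom.zero.congr (ae_of_all _ fun ξ t ht => by rw [mem_singleton_iff.1 ht, h ξ, sub_self])
  -- increments decay by the factor `A/μ ≤ 1/4`, as consecutive iterates have the same data
  have hdiff : ∀ n, Dom ω (Icc 0 T) (s + 2) (fun t ξ => (U (n + 1)).1 t ξ - (U n).1 t ξ)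
        (R * 4⁻¹ ^ n) ∧
      Dom ω (Icc 0 T) (s + 1) (fun t ξ => (U (n + 1)).2 t ξ - (U n).2 t ξ) (R * 4⁻¹ ^ n) := by
    intro n
    induction n with
    | zero =>
      obtain ⟨-, -, d1, d2⟩ := hball 1
      simp only [zero_add, pow_zero, mul_one, hU]
      exact ⟨d1.congr (ae_of_all _ fun ξ t _ => (sub_zero _).symm),
        d2.congr (ae_of_all _ fun ξ t _ => (sub_zero _).symm)⟩
    | succ n ih =>
      obtain ⟨-, -, d1, d2⟩ := hball (n + 1)
      obtain ⟨-, -, e1, e2⟩ := hball n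
      have d := (hA ω₀ μ 0 T ε 0 _ _ _ _ _ _ _ _ _ 0 0 hμ0 hω
        ⟨d1.mono hR4, d2.mono hR4, e1.mono hR4, e2.mono hR4, ih.1, ih.2⟩ (hstep (n + 1)) (hstep n)
        Dom.zero).2 (hzero fun ξ => by rw [(hU0 _ ξ).1, (hU0 _ ξ).1])
        (hzero fun ξ => by rw [(hU0 _ ξ).2, (hU0 _ ξ).2])
      have hle : 0 + ENNReal.ofReal μ⁻¹ * (A * (R * 4⁻¹ ^ n) + 0) ≤ (R : ℝ≥0∞) * 4⁻¹ ^ (n + 1) := by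
        calc _ = (ENNReal.ofReal μ⁻¹ * A) * (R * 4⁻¹ ^ n) := by ring
          _ ≤ 4⁻¹ * (R * 4⁻¹ ^ n) := by gcongr
          _ = _ := by ring
      exact ⟨d.1.mono hle, d.2.mono hle⟩
  obtain ⟨p, rp, dp, lp⟩ := exists_limit hω (fun n => (hball n).1) fun n => (hdiff n).1
  obtain ⟨q, rq, dq, lq⟩ := exists_limit hω (fun n => (hball n).2.1) fun n => (hdiff n).2
  have bp : Dom ω (Icc 0 T) (s + 2) p (4 * R : ℝ≥0) :=
    ((dp 0).congr (g := p) (ae_of_all _ fun ξ t _ => by simp [hU])).mono (by simp)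
  have bq : Dom ω (Icc 0 T) (s + 1) q (4 * R : ℝ≥0) :=
    ((dq 0).congr (g := q) (ae_of_all _ fun ξ t _ => by simp [hU])).mono (by simp)
  obtain ⟨-, -, hst⟩ := picard_step (N := N) (ε := ε) (u := (p, q)) hs hω hp₀ hq₀ rp rq bp bq
  have hPQ0 := And.intro (picard_fst_zero N ε p₀ q₀ (p, q)) (picard_snd_zero N ε p₀ q₀ (p, q))
  -- the image of the limit is equal to it only almost everywhere, but has the derivatives in time
  -- and the exact initial values, and is therefore the solution that is returned
  generalize (picard N ε p₀ q₀ (p, q)).1 = P at hst hPQ0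
  generalize (picard N ε p₀ q₀ (p, q)).2 = Q at hst hPQ0
  have h2n : Tendsto (fun n : ℕ => (8 * R : ℝ≥0∞) * 2⁻¹ ^ n) atTop (𝓝 0) := by
    have := ENNReal.Tendsto.const_mul (a := 8 * (R : ℝ≥0∞))
      (ENNReal.tendsto_pow_atTop_nhds_zero_of_lt_one (r := 2⁻¹) (by norm_num))
      (Or.inr (ENNReal.mul_ne_top (by norm_num) (by simp)))
    simpa using this
  -- the limit is a fixed point of the iteration
  have hfix : ∀ n, Dom ω (Icc 0 T) (s + 2) (fun t ξ => P t ξ - p t ξ) (8 * R * 2⁻¹ ^ n) ∧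
      Dom ω (Icc 0 T) (s + 1) (fun t ξ => Q t ξ - q t ξ) (8 * R * 2⁻¹ ^ n) := by
    intro n
    obtain ⟨-, -, e1, e2⟩ := hball n
    have d := (hA ω₀ μ 0 T ε 0 _ _ _ _ _ _ _ _ _ 0 0 hμ0 hω
        ⟨bp, bq, e1.mono hR4, e2.mono hR4, dp n, dq n⟩ hst (hstep n)
        Dom.zero).2 (hzero fun ξ => by rw [(hU0 _ ξ).1]; exact congrFun hPQ0.1 ξ)
        (hzero fun ξ => by rw [(hU0 _ ξ).2]; exact congrFun hPQ0.2 ξ)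
    have hle : 0 + ENNReal.ofReal μ⁻¹ * (A * (4 * R * 2⁻¹ ^ n) + 0) + 4 * R * 2⁻¹ ^ (n + 1) ≤
        (8 * R : ℝ≥0∞) * 2⁻¹ ^ n := by
      calc _ = (ENNReal.ofReal μ⁻¹ * A) * (4 * R * 2⁻¹ ^ n) + 4 * R * 2⁻¹ ^ n * 2⁻¹ := by ring
        _ ≤ 1 * (4 * R * 2⁻¹ ^ n) + 4 * R * 2⁻¹ ^ n * 1 := by
          gcongr
          · exact hA4.trans (by norm_num)
          · norm_num
        _ = _ := by ring
    exact ⟨((d.1.add (dp (n + 1)).sub_comm).congr (ae_of_all _ fun ξ t _ => by ring)).mono hle,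
      ((d.2.add (dq (n + 1)).sub_comm).congr (ae_of_all _ fun ξ t _ => by ring)).mono hle⟩
  have ep := Dom.ae_eq_zero h2n fun n => (hfix n).1
  have eq := Dom.ae_eq_zero h2n fun n => (hfix n).2
  have ep' : ∀ᵐ ξ, ∀ t ∈ Icc 0 T, p t ξ = P t ξ :=
    ep.mono fun ξ h t ht => (sub_eq_zero.1 (h t ht)).symm
  have eq' : ∀ᵐ ξ, ∀ t ∈ Icc 0 T, q t ξ = Q t ξ :=
    eq.mono fun ξ h t ht => (sub_eq_zero.1 (h t ht)).symm
  -- reality of the phase passes from the iterates to the limit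
  have hsymn : ∀ n, ∀ t ∈ Icc 0 T, refl ((U n).1 t) =ᵐ[volume] (U n).1 t := by
    intro n
    induction n with
    | zero => intro t _; exact ae_of_all _ fun ξ => by simp [refl, hU]
    | succ n ih => rw [hUs]; exact refl_picard hsym ih
  refine ⟨P, Q, hst.congr (fun t ht => ep'.mono fun ξ h => h t ht)
    (fun t ht => eq'.mono fun ξ h => h t ht), bp.congr ep', bq.congr eq', hPQ0.1, hPQ0.2, ?_⟩
  intro t ht
  filter_upwards [ep', lp, (Measure.measurePreserving_neg volume).quasiMeasurePreserving.ae lp,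
    (Measure.measurePreserving_neg volume).quasiMeasurePreserving.ae ep',
    ae_all_iff.2 fun n => hsymn n t ht] with ξ h1 h2 h3 h4 h5
  rw [← h1 t ht, refl, ← h4 t ht]
  refine tendsto_nhds_unique ((Complex.continuous_conj.tendsto _).comp (h3 t ht)) ?_
  exact (h2 t ht).congr fun n => (h5 n).symm

/-! ### Fourier synthesis and the `L²` Fourier transform -/

/-- Fourier synthesis `x ↦ ∫ e^(ixξ) f(ξ) dξ`. -/
def synth (f : ℝ → ℂ) (x : ℝ) : ℂ := ∫ ξ : ℝ, Complex.exp (Complex.I * x * ξ) * f ξ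

lemma norm_exp_I_mul_mul (x ξ : ℝ) : ‖Complex.exp (Complex.I * x * ξ)‖ = 1 := by
  rw [show Complex.I * x * ξ = ((x * ξ : ℝ) : ℂ) * Complex.I by push_cast; ring]
  exact Complex.norm_exp_ofReal_mul_I _

lemma integrable_exp_mul {f : ℝ → ℂ} (hf : Integrable f) (x : ℝ) :
    Integrable fun ξ : ℝ => Complex.exp (Complex.I * x * ξ) * f ξ :=
  hf.bdd_mul (c := 1) (Continuous.aestronglyMeasurable (by fun_prop))
    (ae_of_all _ fun ξ => (norm_exp_I_mul_mul x ξ).le)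

lemma synth_congr_ae {f g : ℝ → ℂ} (h : f =ᵐ[volume] g) : synth f = synth g := by
  ext x
  refine integral_congr_ae ?_
  filter_upwards [h] with ξ hξ
  rw [hξ]

lemma synth_add {f g : ℝ → ℂ} (hf : Integrable f) (hg : Integrable g) (x : ℝ) :
    synth (fun ξ => f ξ + g ξ) x = synth f x + synth g x := by
  simp only [synth, mul_add]
  exact integral_add (integrable_exp_mul hf x) (integrable_exp_mul hg x)

lemma synth_sub {f g : ℝ → ℂ} (hf : Integrable f) (hg : Integrable g) (x : ℝ) :
    synth (fun ξ => f ξ - g ξ) x = synth f x - synth g x := by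
  simp only [synth, mul_sub]
  exact integral_sub (integrable_exp_mul hf x) (integrable_exp_mul hg x)

lemma synth_const_mul (c : ℂ) (f : ℝ → ℂ) (x : ℝ) :
    synth (fun ξ => c * f ξ) x = c * synth f x := by
  simp only [synth, ← integral_const_mul]
  congr 1; ext ξ; ring

lemma synth_refl (f : ℝ → ℂ) (x : ℝ) : synth (refl f) x = (starRingEnd ℂ) (synth f x) := by
  simp only [synth, refl]
  rw [← integral_conj, ← integral_neg_eq_self]
  congr 1; ext ξ
  simp [← Complex.exp_conj]

/-- The synthesis of a convolution is a product. -/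
lemma synth_conv {f g : ℝ → ℂ} (hf : Integrable f) (hg : Integrable g) (x : ℝ) :
    synth (conv f g) x = synth f x * synth g x := by
  have h := integral_convolution (ContinuousLinearMap.mul ℂ ℂ) (μ := (volume : Measure ℝ))
    (ν := volume)
    (integrable_exp_mul hf x) (integrable_exp_mul hg x)
  simp only [ContinuousLinearMap.mul_apply'] at h
  rw [synth, synth, synth, ← h]
  congr 1; ext ξ
  simp only [convolution, ContinuousLinearMap.mul_apply', conv, ← integral_const_mul]
  congr 1; ext η
  have : Complex.exp (Complex.I * x * ξ) =
      Complex.exp (Complex.I * x * η) * Complex.exp (Complex.I * x * (ξ - η : ℝ)) := by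
    rw [← Complex.exp_add]; congr 1; push_cast; ring
  rw [this]; ring

lemma continuous_synth {f : ℝ → ℂ} (hf : Integrable f) : Continuous (synth f) := by
  refine continuous_of_dominated (bound := fun ξ => ‖f ξ‖) (fun x => (integrable_exp_mul hf x).1)
    (fun x => ae_of_all _ fun ξ => ?_) hf.norm (ae_of_all _ fun ξ => by fun_prop)
  rw [norm_mul, norm_exp_I_mul_mul, one_mul]

lemma hasDerivAt_synth {f : ℝ → ℂ} (hf : Integrable f) (hf' : Integrable (mulI f)) (x : ℝ) :
    HasDerivAt (synth f) (synth (mulI f) x) x := by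
  refine (hasDerivAt_integral_of_dominated_loc_of_deriv_le (bound := fun ξ => ‖mulI f ξ‖)
    (F' := fun x ξ => Complex.exp (Complex.I * x * ξ) * mulI f ξ) univ_mem
    (Eventually.of_forall fun x => (integrable_exp_mul hf x).1) (integrable_exp_mul hf x)
    (integrable_exp_mul hf' x).1 (ae_of_all _ fun ξ x _ => ?_) hf'.norm
    (ae_of_all _ fun ξ x _ => ?_)).2
  · rw [norm_mul, norm_exp_I_mul_mul, one_mul]
  · have h1 := ((Complex.ofRealCLM.hasDerivAt (x := x)).const_mul Complex.I).mul_const (ξ : ℂ)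
    have h2 := h1.cexp.mul_const (f ξ)
    simp only [Complex.ofRealCLM_apply, Complex.ofReal_one, mul_one] at h2
    refine h2.congr_deriv ?_
    simp only [mulI]; ring

lemma deriv_synth {f : ℝ → ℂ} (hf : Integrable f) (hf' : Integrable (mulI f)) :
    deriv (synth f) = synth (mulI f) :=
  funext fun x => (hasDerivAt_synth hf hf' x).deriv

lemma contDiff_two_synth {f : ℝ → ℂ} (h0 : Integrable f) (h1 : Integrable (mulI f))
    (h2 : Integrable (mulI (mulI f))) : ContDiff ℝ 2 (synth f) := by
  rw [show (2 : WithTop ℕ∞) = 1 + 1 by norm_num, contDiff_succ_iff_deriv]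
  refine ⟨fun x => (hasDerivAt_synth h0 h1 x).differentiableAt, by simp, ?_⟩
  rw [deriv_synth h0 h1, show (1 : WithTop ℕ∞) = 0 + 1 by norm_num, contDiff_succ_iff_deriv]
  refine ⟨fun x => (hasDerivAt_synth h1 h2 x).differentiableAt, by simp, ?_⟩
  rw [deriv_synth h1 h2, contDiff_zero]
  exact continuous_synth h2

/-- On `L¹ ∩ L²` the `L²` inverse Fourier transform is given by the integral: both define the same
tempered distribution. -/
lemma fourierInv_toLp_ae {g : ℝ → ℂ} (h1 : Integrable g) (h2 : MemLp g 2 volume) :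
    ((𝓕⁻ (h2.toLp g) : Lp ℂ 2 (volume : Measure ℝ)) : ℝ → ℂ) =ᵐ[volume] 𝓕⁻ g := by
  have hcont : Continuous (𝓕⁻ g) := by
    have : 𝓕⁻ g = fun x => synth g (2 * Real.pi * x) := by
      ext x
      rw [Real.fourierInv_eq', synth]
      congr 1; ext ξ
      simp only [RCLike.inner_apply, conj_trivial, smul_eq_mul]
      congr 2
      push_cast; ring
    rw [this]
    exact (continuous_synth h1).comp (by fun_prop)
  refine ae_eq_of_integral_contDiff_smul_eq ?_ hcont.locallyIntegrable fun θ hθ hθc => ?_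
  · exact (Lp.memLp _).locallyIntegrable (by norm_num)
  have hθ' : ContDiff ℝ (⊤ : ℕ∞) fun x => (θ x : ℂ) := Complex.ofRealCLM.contDiff.comp hθ
  have hθc' : HasCompactSupport fun x => (θ x : ℂ) := hθc.comp_left Complex.ofReal_zero
  set Θ := hθc'.toSchwartzMap hθ'
  have key := congrArg (fun u => u Θ) (Lp.fourierInv_toTemperedDistribution_eq (h2.toLp g))
  simp only [TemperedDistribution.fourierInv_apply, Lp.toTemperedDistribution_apply] at key
  have e1 : ∫ x, 𝓕⁻ Θ x • (h2.toLp g) x = ∫ x, 𝓕⁻ (Θ : ℝ → ℂ) x • g x := by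
    refine integral_congr_ae ?_
    filter_upwards [h2.coeFn_toLp] with x hx
    rw [hx, SchwartzMap.fourierInv_coe]
  have e2 : ∫ x, 𝓕⁻ (Θ : ℝ → ℂ) x • g x = ∫ x, Θ x • 𝓕⁻ g x := by
    have := VectorFourier.integral_fourierIntegral_smul_eq_flip (μ := (volume : Measure ℝ))
      (ν := (volume : Measure ℝ)) (L := -(innerₗ ℝ)) (f := (Θ : ℝ → ℂ)) (g := g)
      Real.continuous_fourierChar (by
        have : Continuous fun p : ℝ × ℝ => -(inner ℝ p.1 p.2) := continuous_inner.neg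
        exact this) Θ.integrable h1
    have f1 : ∀ (h : ℝ → ℂ) x, VectorFourier.fourierIntegral Real.fourierChar
        (volume : Measure ℝ) (-(innerₗ ℝ)) h x = 𝓕⁻ h x := fun h x => by
      simp only [Real.fourierInv_eq, VectorFourier.fourierIntegral]
      simp
    have f2 : ∀ (h : ℝ → ℂ) x, VectorFourier.fourierIntegral Real.fourierChar
        (volume : Measure ℝ) (-(innerₗ ℝ)).flip h x = 𝓕⁻ h x := fun h x => by
      simp only [Real.fourierInv_eq, VectorFourier.fourierIntegral]
      simp [mul_comm]
    simpa only [f1, f2] using this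
  rw [e1, e2] at key
  have hΘ : ∀ x, Θ x = (θ x : ℂ) := fun x => rfl
  simp only [hΘ, smul_eq_mul] at key
  simp only [Complex.real_smul]
  exact key.symm

lemma quasiMeasurePreserving_mul {a : ℝ} (ha : a ≠ 0) :
    Measure.QuasiMeasurePreserving (fun x => a * x) (volume : Measure ℝ) volume := by
  refine ⟨by fun_prop, ?_⟩
  rw [Real.map_volume_mul_left ha]
  exact Measure.smul_absolutelyContinuous

lemma memLp_comp_mul {f : ℝ → ℂ} (hf : MemLp f 2 volume) {a : ℝ} (ha : a ≠ 0) :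
    MemLp (fun x => f (a * x)) 2 volume := by
  have hm : AEStronglyMeasurable (fun x => f (a * x)) volume :=
    hf.1.comp_quasiMeasurePreserving (quasiMeasurePreserving_mul ha)
  rw [memLp_two_iff_integrable_sq_norm hm]
  exact ((memLp_two_iff_integrable_sq_norm hf.1).1 hf).comp_mul_left' ha

lemma two_pi_ne : (2 * Real.pi) ≠ 0 := by positivity

/-- The rescaling between the two normalizations of the Fourier transform. -/
lemma synth_eq_fourierInv (f : ℝ → ℂ) :
    synth f = 𝓕⁻ fun η : ℝ => ((2 * Real.pi : ℝ) : ℂ) * f (2 * Real.pi * η) := by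
  ext x
  rw [Real.fourierInv_eq', synth]
  have := Measure.integral_comp_mul_left
    (fun ξ : ℝ => Complex.exp (Complex.I * x * ξ) * f ξ) (2 * Real.pi)
  rw [abs_of_pos (by positivity), ← smul_right_inj two_pi_ne, smul_smul,
    mul_inv_cancel₀ two_pi_ne, one_smul] at this
  rw [← this, ← integral_smul]
  congr 1; ext η
  simp only [RCLike.inner_apply, conj_trivial, smul_eq_mul, Complex.real_smul]
  rw [show Complex.I * x * ((2 * Real.pi * η : ℝ) : ℂ)
    = ((2 * Real.pi * (x * η) : ℝ) : ℂ) * Complex.I by push_cast; ring]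
  ring

/-- `synth f` is, up to the rescaling, the `L²` inverse Fourier transform of `f`. -/
lemma synth_toLp {f : ℝ → ℂ} (h1 : Integrable f) (h2 : MemLp f 2 volume) :
    ∃ (h3 : MemLp (fun η : ℝ => ((2 * Real.pi : ℝ) : ℂ) * f (2 * Real.pi * η)) 2 volume),
      synth f =ᵐ[volume] ((𝓕⁻ (h3.toLp _) : Lp ℂ 2 (volume : Measure ℝ)) : ℝ → ℂ) := by
  have h3 := (memLp_comp_mul h2 two_pi_ne).const_mul ((2 * Real.pi : ℝ) : ℂ)
  refine ⟨h3, ?_⟩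
  rw [synth_eq_fourierInv]
  exact (fourierInv_toLp_ae ((h1.comp_mul_left' two_pi_ne).const_mul _) h3).symm

lemma memLp_synth {f : ℝ → ℂ} (h1 : Integrable f) (h2 : MemLp f 2 volume) :
    MemLp (synth f) 2 volume := by
  obtain ⟨h3, h⟩ := synth_toLp h1 h2
  exact (memLp_congr_ae h).2 (Lp.memLp _)

lemma ae_comp_div {P : ℝ → Prop} (h : ∀ᵐ η, P η) : ∀ᵐ ξ : ℝ, P (ξ / (2 * Real.pi)) := by
  have := (quasiMeasurePreserving_mul (inv_ne_zero two_pi_ne)).ae h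
  simpa [div_eq_inv_mul] using this

/-- Fourier inversion, from the frequency side. -/
lemma fourierL2_synth {f : ℝ → ℂ} (h1 : Integrable f) (h2 : MemLp f 2 volume) :
    fourierL2 (synth f) =ᵐ[volume] fun ξ => ((√(2 * Real.pi) : ℝ) : ℂ) * f ξ := by
  obtain ⟨h3, h⟩ := synth_toLp h1 h2
  have hm := memLp_synth h1 h2
  have e : hm.toLp _ = 𝓕⁻ (h3.toLp _) := Lp.ext (hm.coeFn_toLp.trans h)
  have e2 : 𝓕 (hm.toLp _) = h3.toLp _ := by rw [e]; exact FourierTransform.fourier_fourierInv_eq _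
  filter_upwards [ae_comp_div h3.coeFn_toLp] with ξ hξ
  rw [fourierL2, dif_pos hm, e2, hξ, ← mul_assoc, ← Complex.ofReal_mul,
    mul_div_cancel₀ _ two_pi_ne]
  congr 2
  rw [inv_mul_eq_iff_eq_mul₀ (by positivity), Real.mul_self_sqrt (by positivity)]

lemma measurable_fourierL2 (ψ : ℝ → ℂ) : Measurable (fourierL2 ψ) := by
  unfold fourierL2
  split_ifs with h
  · exact ((Lp.stronglyMeasurable _).measurable.comp (by fun_prop)).const_mul _
  · exact measurable_const

/-- Fourier inversion, from the physical side. -/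
lemma synth_fourierL2 {ψ : ℝ → ℂ} (hψ : MemLp ψ 2 volume) (h1 : Integrable (fourierL2 ψ)) :
    ψ =ᵐ[volume] synth fun ξ => (((√(2 * Real.pi))⁻¹ : ℝ) : ℂ) * fourierL2 ψ ξ := by
  set u : Lp ℂ 2 (volume : Measure ℝ) := 𝓕 (hψ.toLp ψ) with hu
  have e1 : ∀ η : ℝ, ((2 * Real.pi : ℝ) : ℂ) * ((((√(2 * Real.pi))⁻¹ : ℝ) : ℂ) *
      fourierL2 ψ (2 * Real.pi * η)) = u η := fun η => by
    rw [fourierL2, dif_pos hψ, ← hu, mul_div_cancel_left₀ _ two_pi_ne, ← mul_assoc, ← mul_assoc,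
      ← Complex.ofReal_mul, ← Complex.ofReal_mul, mul_assoc, ← mul_inv,
      Real.mul_self_sqrt (by positivity), mul_inv_cancel₀ two_pi_ne]
    simp
  rw [synth_eq_fourierInv]
  simp only [e1]
  have hui : Integrable (fun η => u η) := by
    simp only [← e1]
    exact ((h1.comp_mul_left' two_pi_ne).const_mul _).const_mul _
  have h3 := fourierInv_toLp_ae hui (Lp.memLp u)
  rw [Lp.toLp_coeFn] at h3
  rw [show 𝓕⁻ u = hψ.toLp ψ from FourierTransform.fourierInv_fourier_eq _] at h3
  exact hψ.coeFn_toLp.symm.trans h3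

lemma fourierL2_sub {ψ χ : ℝ → ℂ} (hψ : MemLp ψ 2 volume) (hχ : MemLp χ 2 volume) :
    fourierL2 (fun x => ψ x - χ x) =ᵐ[volume] fun ξ => fourierL2 ψ ξ - fourierL2 χ ξ := by
  have h : MemLp (fun x => ψ x - χ x) 2 volume := hψ.sub hχ
  have e : 𝓕 (h.toLp _) = 𝓕 (hψ.toLp ψ) - 𝓕 (hχ.toLp χ) := by
    rw [show h.toLp _ = hψ.toLp ψ - hχ.toLp χ from MemLp.toLp_sub hψ hχ]
    exact (Lp.fourierTransformₗᵢ ℝ ℂ).map_sub _ _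
  filter_upwards [ae_comp_div (Lp.coeFn_sub (𝓕 (hψ.toLp ψ)) (𝓕 (hχ.toLp χ)))] with ξ hξ
  rw [fourierL2, fourierL2, fourierL2, dif_pos h, dif_pos hψ, dif_pos hχ, e, hξ, Pi.sub_apply,
    mul_sub]

/-! ### Rapidly decaying amplitudes and the nonlinear terms in physical space -/

section Decay

variable {ω ω' : ℝ → ℝ} {S : Set ℝ} {s : ℝ} {f : ℝ → ℝ → ℂ} {R : ℝ≥0∞}

lemma exists_rpow_le_exp {η : ℝ} (hη : 0 < η) (k : ℝ) :
    ∃ C : ℝ≥0, ∀ b : ℝ, 1 ≤ b → b ^ k ≤ C * Real.exp (η * b) := by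
  obtain ⟨n, hn⟩ := exists_nat_ge k
  refine ⟨NNReal.mk (n.factorial / η ^ n) (by positivity), fun b hb => ?_⟩
  have h1 := Real.pow_div_factorial_le_exp (η * b) (by positivity) n
  have h2 : b ^ k ≤ b ^ n := by
    rw [← Real.rpow_natCast]
    exact Real.rpow_le_rpow_of_exponent_le hb hn
  refine h2.trans ?_
  rw [NNReal.coe_mk, div_mul_eq_mul_div, le_div_iff₀ (by positivity)]
  rw [div_le_iff₀ (by positivity), mul_pow] at h1
  linarith

/-- A loss in the exponential weight compensates any power of `⟨ξ⟩`. -/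
lemma Dom.exp_gain {η : ℝ} (hη : 0 < η) (k : ℝ) : ∃ C : ℝ≥0, ∀ (ω ω' : ℝ → ℝ) (S : Set ℝ)
    (s : ℝ) (f : ℝ → ℝ → ℂ) (R : ℝ≥0∞), (∀ t ∈ S, ω' t + η ≤ ω t) → Dom ω S s f R →
    Dom ω' S (s + k) f (C * R) := by
  obtain ⟨C, hC⟩ := exists_rpow_le_exp hη k
  refine ⟨C, fun ω ω' S s f R hω ⟨hm, K, hK, hKR, hb⟩ => ⟨hm, fun ξ => C * (br (-k) ξ * K ξ),
    by fun_prop, ?_, ?_⟩⟩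
  · rw [wNorm_const_mul _ (by fun_prop), wNorm_br_mul]
    gcongr
    simpa using hKR
  · filter_upwards [hb] with ξ h t ht
    refine (h t ht).trans ?_
    have h1 : ex ω t ξ ≤ ex ω' t ξ * (C * br (-k) ξ) := by
      unfold ex br
      rw [← ENNReal.ofReal_coe_nnreal, ← ENNReal.ofReal_mul (by positivity),
        ← ENNReal.ofReal_mul (by positivity)]
      refine ENNReal.ofReal_le_ofReal ?_
      have h2 := hC (bracket ξ) (one_le_bracket ξ)
      have hbk : 0 < bracket ξ ^ k := Real.rpow_pos_of_pos (bracket_pos ξ) k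
      rw [Real.rpow_neg (bracket_pos ξ).le]
      have h3 : Real.exp (-(ω t * bracket ξ)) ≤
          Real.exp (-(ω' t * bracket ξ)) * Real.exp (-(η * bracket ξ)) := by
        rw [← Real.exp_add]
        refine Real.exp_le_exp.2 ?_
        nlinarith [hω t ht, bracket_pos ξ]
      refine h3.trans ?_
      gcongr
      rw [Real.exp_neg, inv_le_iff_one_le_mul₀ (Real.exp_pos _), mul_assoc,
        inv_mul_eq_div, mul_div_assoc', le_div_iff₀ hbk]
      linarith
    calc _ ≤ ex ω' t ξ * (C * br (-k) ξ) * K ξ := by gcongr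
      _ = _ := by ring

/-- An integrable majorant, uniform in time. -/
lemma Dom.exists_bound (h : Dom ω S 1 f R) (hω : ∀ t ∈ S, 0 ≤ ω t) (hR : R ≠ ∞) :
    ∃ b : ℝ → ℝ, Integrable b ∧ (∀ᵐ ξ, ∀ t ∈ S, ‖f t ξ‖ ≤ b ξ) ∧ ∫ ξ, b ξ ≤ 2 * R.toReal := by
  obtain ⟨hm, K, hK, hKR, hb⟩ := h
  have h1 : ∫⁻ ξ, K ξ ≤ 2 * R := by
    have := lintegral_br_mul_le (s := 0) hK
    simp only [br_zero, one_mul, zero_add] at this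
    exact this.trans (by gcongr)
  have h2 : ∫⁻ ξ, K ξ ≠ ∞ := ne_top_of_le_ne_top (ENNReal.mul_ne_top (by norm_num) hR) h1
  refine ⟨fun ξ => (K ξ).toReal, integrable_toReal_of_lintegral_ne_top hK.aemeasurable h2, ?_, ?_⟩
  · filter_upwards [hb, ae_lt_top hK h2] with ξ h3 h4 t ht
    rw [← toReal_enorm]
    exact ENNReal.toReal_mono h4.ne
      ((h3 t ht).trans (mul_le_of_le_one_left' (ex_le_one (hω t ht) ξ)))
  · rw [integral_toReal hK.aemeasurable (ae_lt_top hK h2)]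
    refine (ENNReal.toReal_mono (ENNReal.mul_ne_top (by norm_num) hR) h1).trans (by simp)

lemma Dom.integrable (h : Dom ω S 1 f R) (hω : ∀ t ∈ S, 0 ≤ ω t) (hR : R ≠ ∞) {t : ℝ}
    (ht : t ∈ S) : Integrable (f t) := by
  obtain ⟨b, hb, hfb, -⟩ := h.exists_bound hω hR
  exact hb.mono' (h.1 t ht) (hfb.mono fun ξ h => h t ht)

lemma Dom.lintegral_sq_le (h : Dom ω S 0 f R) (hω : ∀ t ∈ S, 0 ≤ ω t) {t : ℝ}
    (ht : t ∈ S) : ∫⁻ ξ, ‖f t ξ‖ₑ ^ 2 ≤ R ^ 2 := by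
  obtain ⟨hm, K, hK, hKR, hb⟩ := h
  rw [wNorm_le_iff] at hKR
  refine le_trans (lintegral_mono_ae ?_) hKR
  filter_upwards [hb] with ξ h
  rw [br_zero, one_mul]
  gcongr
  exact (h t ht).trans (mul_le_of_le_one_left' (ex_le_one (hω t ht) ξ))

lemma Dom.memLp (h : Dom ω S 0 f R) (hω : ∀ t ∈ S, 0 ≤ ω t) (hR : R ≠ ∞) {t : ℝ}
    (ht : t ∈ S) : MemLp (f t) 2 volume := by
  refine ⟨h.1 t ht, ?_⟩
  rw [eLpNorm_lt_top_iff_lintegral_rpow_enorm_lt_top (by norm_num) (by norm_num)]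
  simp only [ENNReal.toReal_ofNat, ENNReal.rpow_ofNat]
  exact (h.lintegral_sq_le hω ht).trans_lt (ENNReal.pow_lt_top hR.lt_top)

end Decay

/-- `f` belongs to `L²(⟨ξ⟩^(2s) dξ)` for all `s`. -/
def RapidDecay (f : ℝ → ℂ) : Prop := ∀ s : ℝ, ∃ R : ℝ≥0, Dom 0 {0} s (fun _ => f) R

section RapidDecay

variable {f g p q : ℝ → ℂ}

lemma Dom.rapidDecay {ω : ℝ → ℝ} {S : Set ℝ} {s : ℝ} {f : ℝ → ℝ → ℂ} {R : ℝ≥0∞} (h : Dom ω S s f R)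
    (hR : R ≠ ∞) {t : ℝ} (ht : t ∈ S) (hω : 0 < ω t) : RapidDecay (f t) := by
  intro s'
  obtain ⟨C, hC⟩ := Dom.exp_gain hω (s' - s)
  have h1 : Dom (fun _ => ω t) {0} s (fun _ => f t) R := by
    obtain ⟨hm, K, hK, hKR, hb⟩ := h
    exact ⟨fun _ _ => hm t ht, K, hK, hKR, hb.mono fun ξ h _ _ => h t ht⟩
  have h2 := hC _ 0 _ _ _ _ (by simp) h1
  rw [add_sub_cancel] at h2
  lift R to ℝ≥0 using hR
  exact ⟨C * R, by simpa using h2⟩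

lemma RapidDecay.integrable (h : RapidDecay f) : Integrable f := by
  obtain ⟨R, hR⟩ := h 1
  exact hR.integrable (by simp) (by simp) (mem_singleton 0)

lemma RapidDecay.memLp (h : RapidDecay f) : MemLp f 2 volume := by
  obtain ⟨R, hR⟩ := h 0
  exact hR.memLp (by simp) (by simp) (mem_singleton 0)

lemma RapidDecay.mulI (h : RapidDecay f) : RapidDecay (mulI f) := fun s => by
  obtain ⟨R, hR⟩ := h (s + 1)
  exact ⟨R, hR.mulI⟩

lemma RapidDecay.refl (h : RapidDecay f) : RapidDecay (refl f) := fun s => by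
  obtain ⟨R, hR⟩ := h s
  exact ⟨R, hR.refl⟩

lemma RapidDecay.add (h : RapidDecay f) (h' : RapidDecay g) : RapidDecay fun ξ => f ξ + g ξ :=
  fun s => by
  obtain ⟨R, hR⟩ := h s
  obtain ⟨R', hR'⟩ := h' s
  exact ⟨R + R', by simpa using hR.add hR'⟩

lemma RapidDecay.const_mul (h : RapidDecay f) (c : ℂ) : RapidDecay fun ξ => c * f ξ := fun s => by
  obtain ⟨R, hR⟩ := h s
  exact ⟨‖c‖₊ * R, (hR.const_mul c).mono (by simp [enorm])⟩

lemma RapidDecay.conv (h : RapidDecay f) (h' : RapidDecay g) : RapidDecay (conv f g) := fun s => by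
  obtain ⟨R, hR⟩ := h (max s 0 + 1)
  obtain ⟨R', hR'⟩ := h' (max s 0 + 1)
  have h1 := Dom.conv_alg (by simp) (le_max_right s 0) hR hR'
  have hc : 2 * prodConst (max s 0) * ((R : ℝ≥0∞) * R') ≠ ∞ :=
    ENNReal.mul_ne_top (ENNReal.mul_ne_top (by norm_num) (prodConst_ne_top _))
      (ENNReal.mul_ne_top (by simp) (by simp))
  lift 2 * prodConst (max s 0) * ((R : ℝ≥0∞) * R') to ℝ≥0 using hc with R''
  exact ⟨R'', h1.mono_exp (by linarith [le_max_left s 0])⟩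

lemma RapidDecay.convPow (h : RapidDecay f) (n : ℕ) : RapidDecay (convPow f n) := by
  induction n with
  | zero => exact h
  | succ n ih => exact h.conv ih

lemma RapidDecay.powOp (h : RapidDecay q) (c : ℝ) (n : ℕ) : RapidDecay (powOp c n q) :=
  ((h.conv h.refl).convPow n).const_mul _

lemma RapidDecay.ampOp (hp : RapidDecay p) (hq : RapidDecay q) (N : Nonlinearity) :
    RapidDecay (ampOp N p q) :=
  ((hp.mulI.conv hq.mulI).add ((hq.conv hp.mulI.mulI).const_mul _)).add
    (((hq.powOp _ _).conv hq).mulI.const_mul _)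

lemma RapidDecay.contDiff (h : RapidDecay f) : ContDiff ℝ 2 (synth f) :=
  contDiff_two_synth h.integrable h.mulI.integrable h.mulI.mulI.integrable

lemma RapidDecay.deriv_synth (h : RapidDecay f) : deriv (synth f) = synth (WKB.mulI f) :=
  WKB.deriv_synth h.integrable h.mulI.integrable

lemma synth_powOp (hq : RapidDecay q) (c : ℝ) (n : ℕ) (x : ℝ) :
    synth (powOp c n q) x = ((c * (‖synth q x‖ ^ 2) ^ (n + 1) : ℝ) : ℂ) := by
  have h1 : ∀ n, synth (convPow (conv q (refl q)) n) x = ((‖synth q x‖ ^ 2 : ℝ) : ℂ) ^ (n + 1) := by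
    intro n
    have h0 : synth (conv q (refl q)) x = ((‖synth q x‖ ^ 2 : ℝ) : ℂ) := by
      rw [synth_conv hq.integrable hq.refl.integrable, synth_refl, Complex.mul_conj,
        Complex.normSq_eq_norm_sq]
    induction n with
    | zero => simpa [convPow] using h0
    | succ n ih =>
      rw [convPow, synth_conv (hq.conv hq.refl).integrable ((hq.conv hq.refl).convPow n).integrable,
        h0, ih]
      ring
  change synth (fun ξ => (c : ℂ) * convPow (conv q (refl q)) n ξ) x = _
  rw [synth_const_mul, h1]
  push_cast; ring

lemma synth_powOp_g (hq : RapidDecay q) (N : Nonlinearity) (x : ℝ) :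
    synth (powOp N.α (N.γ - 1) q) x = (N.g (‖synth q x‖ ^ 2) : ℂ) := by
  rw [synth_powOp hq, Nat.sub_add_cancel N.γ_pos, Nonlinearity.g]

lemma synth_powOp_f (hq : RapidDecay q) (N : Nonlinearity) (x : ℝ) :
    synth (powOp N.lam (N.σ - 1) q) x = (N.f (‖synth q x‖ ^ 2) : ℂ) := by
  rw [synth_powOp hq, Nat.sub_add_cancel N.σ_pos, Nonlinearity.f]

/-- `phaseOp` is the nonlinear part of the phase equation. -/
lemma synth_phaseOp (hp : RapidDecay p) (hq : RapidDecay q) (N : Nonlinearity) (x : ℝ) :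
    synth (phaseOp N p q) x = 1 / 2 * synth (mulI p) x ^ 2
      + 1 / 2 * (N.g (‖synth q x‖ ^ 2) : ℂ) * synth (mulI p) x + (N.f (‖synth q x‖ ^ 2) : ℂ) := by
  change synth (fun ξ => (1 / 2 * conv (mulI p) (mulI p) ξ
    + 1 / 2 * conv (powOp N.α (N.γ - 1) q) (mulI p) ξ) + powOp N.lam (N.σ - 1) q ξ) x = _
  have h1 := (hp.mulI.conv hp.mulI).const_mul (1 / 2)
  have h2 := ((hq.powOp N.α (N.γ - 1)).conv hp.mulI).const_mul (1 / 2)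
  rw [synth_add (h1.add h2).integrable (hq.powOp _ _).integrable,
    synth_add h1.integrable h2.integrable, synth_const_mul, synth_const_mul,
    synth_conv hp.mulI.integrable hp.mulI.integrable,
    synth_conv (hq.powOp _ _).integrable hp.mulI.integrable, synth_powOp_g hq, synth_powOp_f hq]
  ring

/-- `ampOp` is the nonlinear part of the amplitude equation. -/
lemma synth_ampOp (hp : RapidDecay p) (hq : RapidDecay q) (N : Nonlinearity) (x : ℝ) :
    synth (ampOp N p q) x = synth (mulI p) x * deriv (synth q) x
      + 1 / 2 * synth q x * synth (mulI (mulI p)) x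
      + 1 / 2 * deriv (fun y => (N.g (‖synth q y‖ ^ 2) : ℂ) * synth q y) x := by
  change synth (fun ξ => (conv (mulI p) (mulI q) ξ + 1 / 2 * conv q (mulI (mulI p)) ξ)
    + 1 / 2 * mulI (conv (powOp N.α (N.γ - 1) q) q) ξ) x = _
  have h1 := hp.mulI.conv hq.mulI
  have h2 := (hq.conv hp.mulI.mulI).const_mul (1 / 2)
  have h3 := (hq.powOp N.α (N.γ - 1)).conv hq
  have e : (fun y => (N.g (‖synth q y‖ ^ 2) : ℂ) * synth q y) =
      synth (conv (powOp N.α (N.γ - 1) q) q) := by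
    ext y
    rw [synth_conv (hq.powOp _ _).integrable hq.integrable, synth_powOp_g hq]
  rw [synth_add (h1.add h2).integrable (h3.mulI.const_mul _).integrable,
    synth_add h1.integrable h2.integrable, synth_const_mul, synth_const_mul,
    synth_conv hp.mulI.integrable hq.mulI.integrable,
    synth_conv hq.integrable hp.mulI.mulI.integrable, e, h3.deriv_synth, hq.deriv_synth]
  ring

/-- The synthesis of a reflection-invariant function is real. -/
lemma synth_re_of_refl (h : refl f =ᵐ[volume] f) (x : ℝ) : ((synth f x).re : ℂ) = synth f x := by
  rw [← Complex.conj_eq_iff_re, ← synth_refl, synth_congr_ae h]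

lemma deriv_synth_re (hp : RapidDecay p) : deriv (fun x => (synth p x).re) =
    fun x => (synth (mulI p) x).re := by
  ext x
  exact (Complex.reCLM.hasFDerivAt.comp_hasDerivAt x
    (hasDerivAt_synth hp.integrable hp.mulI.integrable x)).deriv

end RapidDecay

/-! ### Time derivatives of Fourier integrals -/

/-- Differentiation under the integral sign, with one-sided derivatives at the end points. -/
lemma hasDerivWithinAt_integral_Icc {F F' : ℝ → ℝ → ℂ} {t₀ t₁ : ℝ}
    (hF : ∀ t ∈ Icc t₀ t₁, Integrable (F t)) {b : ℝ → ℝ} (hb : Integrable b)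
    (hF' : ∀ᵐ ξ, ∀ t ∈ Icc t₀ t₁, HasDerivWithinAt (fun τ => F τ ξ) (F' t ξ) (Icc t₀ t₁) t)
    (hFb : ∀ᵐ ξ, ∀ t ∈ Icc t₀ t₁, ‖F' t ξ‖ ≤ b ξ) {t : ℝ} (ht : t ∈ Icc t₀ t₁) :
    HasDerivWithinAt (fun τ => ∫ ξ, F τ ξ) (∫ ξ, F' t ξ) (Icc t₀ t₁) t := by
  rw [hasDerivWithinAt_iff_tendsto_slope]
  have hmem : ∀ᶠ τ in 𝓝[Icc t₀ t₁ \ {t}] t, τ ∈ Icc t₀ t₁ \ {t} := self_mem_nhdsWithin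
  have h1 : ∀ᶠ τ in 𝓝[Icc t₀ t₁ \ {t}] t,
      ∫ ξ, slope (fun τ => F τ ξ) t τ = slope (fun τ => ∫ ξ, F τ ξ) t τ := by
    filter_upwards [hmem] with τ hτ
    simp only [slope_def_module]
    rw [integral_smul, integral_sub (hF τ hτ.1) (hF t ht)]
  refine Tendsto.congr' h1 ?_
  refine tendsto_integral_filter_of_dominated_convergence b ?_ ?_ hb ?_
  · filter_upwards [hmem] with τ hτ
    simp only [slope_def_module]
    exact (((hF τ hτ.1).sub (hF t ht)).smul _).1
  · filter_upwards [hmem] with τ hτ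
    filter_upwards [hF', hFb] with ξ h2 h3
    have := (convex_Icc t₀ t₁).norm_image_sub_le_of_norm_hasDerivWithin_le h2 h3 ht hτ.1
    rw [slope_def_module, norm_smul, norm_inv,
      inv_mul_le_iff₀ (norm_pos_iff.2 (sub_ne_zero.2 hτ.2))]
    linarith
  · filter_upwards [hF'] with ξ h2
    exact hasDerivWithinAt_iff_tendsto_slope.1 (h2 t ht)

lemma hasDerivWithinAt_synth_time {f f' : ℝ → ℝ → ℂ} {t₀ t₁ : ℝ} {R : ℝ≥0}
    (hf : ∀ t ∈ Icc t₀ t₁, Integrable (f t))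
    (hd : ∀ᵐ ξ, ∀ t ∈ Icc t₀ t₁, HasDerivWithinAt (fun τ => f τ ξ) (f' t ξ) (Icc t₀ t₁) t)
    (hb : Dom 0 (Icc t₀ t₁) 1 f' R) {t : ℝ} (ht : t ∈ Icc t₀ t₁) (x : ℝ) :
    HasDerivWithinAt (fun τ => synth (f τ) x) (synth (f' t) x) (Icc t₀ t₁) t := by
  obtain ⟨b, hbi, hb, -⟩ := hb.exists_bound (by simp) (by simp)
  refine hasDerivWithinAt_integral_Icc
    (F' := fun t ξ => Complex.exp (Complex.I * x * ξ) * f' t ξ)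
    (fun t ht => integrable_exp_mul (hf t ht) x) hbi ?_ ?_ ht
  · filter_upwards [hd] with ξ h t ht
    exact (h t ht).const_mul _
  · filter_upwards [hb] with ξ h t ht
    rw [norm_mul, norm_exp_I_mul_mul, one_mul]
    exact h t ht

/-! ### Solutions in physical space from solutions on the Fourier side -/

lemma mulI_mulI (f : ℝ → ℂ) (ξ : ℝ) : mulI (mulI f) ξ = -((ξ : ℂ) ^ 2 * f ξ) := by
  simp only [mulI]
  linear_combination (ξ : ℂ) ^ 2 * f ξ * Complex.I_sq

/-- Bounds in a positive analytic weight give bounds, uniform in time, in every polynomial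
weight. -/
lemma Dom.exists_level {ω : ℝ → ℝ} {S : Set ℝ} {s η : ℝ} {f : ℝ → ℝ → ℂ} {R : ℝ≥0∞} (hη : 0 < η)
    (hω : ∀ t ∈ S, η ≤ ω t) (hf : Dom ω S s f R) (hR : R ≠ ∞) (s' : ℝ) :
    ∃ R' : ℝ≥0, Dom 0 S s' f R' := by
  obtain ⟨C, hC⟩ := Dom.exp_gain hη (s' - s)
  lift R to ℝ≥0 using hR
  have := hC ω 0 S s f R (by simpa using hω) hf
  rw [add_sub_cancel] at this
  exact ⟨C * R, by simpa using this⟩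

section

variable {N : Nonlinearity} {ε T s η : ℝ} {p q : ℝ → ℝ → ℂ} {ω : ℝ → ℝ} {R : ℝ≥0}

lemma synth_amp_rhs (hp : RapidDecay (p T)) (hq : RapidDecay (q T)) (x : ℝ) :
    synth (fun ξ => -(Complex.I * (ε / 2 * ξ ^ 2 : ℝ) * q T ξ) + (0 - ampOp N (p T) (q T) ξ)) x =
      Complex.I * ε / 2 * deriv (deriv (synth (q T))) x - synth (ampOp N (p T) (q T)) x := by
  have e : (fun ξ : ℝ => -(Complex.I * (ε / 2 * ξ ^ 2 : ℝ) * q T ξ)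
      + (0 - ampOp N (p T) (q T) ξ)) =
      fun ξ => Complex.I * ε / 2 * mulI (mulI (q T)) ξ - ampOp N (p T) (q T) ξ := by
    ext ξ
    rw [mulI_mulI]; push_cast; ring
  rw [e, synth_sub (hq.mulI.mulI.const_mul _).integrable (hp.ampOp hq N).integrable,
    synth_const_mul, hq.deriv_synth, hq.mulI.deriv_synth]

/-- The right-hand side of the equation for the amplitude, uniformly in time. -/
lemma exists_amp_rhs_bound {S : Set ℝ} (hs : 0 ≤ s) (hη : 0 < η) (hω : ∀ t ∈ S, η ≤ ω t)
    (hp : Dom ω S (s + 2) p R) (hq : Dom ω S (s + 1) q R) (N : Nonlinearity) (ε : ℝ) :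
    ∃ R' : ℝ≥0, Dom 0 S 1 (fun t ξ => -(Complex.I * (ε / 2 * ξ ^ 2 : ℝ) * q t ξ)
      + (0 - ampOp N (p t) (q t) ξ)) R' := by
  have hω0 : ∀ t ∈ S, 0 ≤ ω t := fun t ht => hη.le.trans (hω t ht)
  obtain ⟨A, hA⟩ := LipOp.ampOp hs N R
  have h1 := (hA _ _ _ _ _ _ _ hω0 (Close.self hp hq)).1
  obtain ⟨R₁, h1⟩ := h1.exists_level hη hω (by simp) 1
  obtain ⟨R₂, h2⟩ := hq.exists_level hη hω (by simp) (1 + 1 + 1)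
  refine ⟨‖Complex.I * ε / 2‖₊ * R₂ + R₁,
    (((h2.mulI.mulI.const_mul (Complex.I * ε / 2)).sub h1).mono (by simp [enorm])).congr
      (ae_of_all _ fun ξ t _ => ?_)⟩
  rw [mulI_mulI]; push_cast; ring

/-- A solution on the Fourier side, dominated in a positive analytic weight, is a classical
solution. -/
lemma isSolution_of_isStep (hs : 0 ≤ s) (hη : 0 < η) (hω : ∀ t ∈ Icc 0 T, η ≤ ω t)
    (hst : IsStep N ε 0 T 0 p q p q) (hp : Dom ω (Icc 0 T) (s + 2) p R)
    (hq : Dom ω (Icc 0 T) (s + 1) q R) (hsym : ∀ t ∈ Icc 0 T, refl (p t) =ᵐ[volume] p t)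
    {φ₀ : ℝ → ℝ} {a₀ : ℝ → ℂ} (hφ₀ : (fun x => (φ₀ x : ℂ)) =ᵐ[volume] synth (p 0))
    (ha₀ : a₀ =ᵐ[volume] synth (q 0)) :
    IsSolution N ε T φ₀ a₀ (fun t x => (synth (p t) x).re) (fun t => synth (q t)) := by
  have hω0 : ∀ t ∈ Icc 0 T, 0 ≤ ω t := fun t ht => hη.le.trans (hω t ht)
  have np : ∀ t ∈ Icc 0 T, RapidDecay (p t) := fun t ht =>
    hp.rapidDecay (by simp) ht (hη.trans_le (hω t ht))
  have nq : ∀ t ∈ Icc 0 T, RapidDecay (q t) := fun t ht =>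
    hq.rapidDecay (by simp) ht (hη.trans_le (hω t ht))
  have hre : ∀ t ∈ Icc 0 T, ∀ x, ((synth (p t) x).re : ℂ) = synth (p t) x := fun t ht x =>
    synth_re_of_refl (hsym t ht) x
  have hre1 : ∀ t ∈ Icc 0 T, ∀ x, ((synth (mulI (p t)) x).re : ℂ) = synth (mulI (p t)) x :=
    fun t ht x => synth_re_of_refl (by rw [refl_mulI]; exact mulI_congr_ae (hsym t ht)) x
  have hre2 : ∀ t ∈ Icc 0 T, ∀ x,
      ((synth (mulI (mulI (p t))) x).re : ℂ) = synth (mulI (mulI (p t))) x := fun t ht x =>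
    synth_re_of_refl (by
      rw [refl_mulI, refl_mulI]; exact mulI_congr_ae (mulI_congr_ae (hsym t ht))) x
  constructor
  · exact fun t ht => Complex.reCLM.contDiff.comp (np t ht).contDiff
  · exact fun t ht => (nq t ht).contDiff
  · intro t ht x
    obtain ⟨A, hA⟩ := LipOp.phaseOp hs N R
    have h1 := (hA _ _ _ _ _ _ _ hω0 (Close.self hp hq)).1
    obtain ⟨R', h2⟩ := h1.exists_level hη hω (by simp) 1
    have h3 := hasDerivWithinAt_synth_time (f' := fun t ξ => -1 * phaseOp N (p t) (q t) ξ)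
      (R := ‖(-1 : ℂ)‖₊ * R') (fun t ht => (np t ht).integrable)
      (hst.2.mono fun ξ h t ht => by simpa using (h t ht).1)
      ((h2.const_mul (-1)).mono (by simp [enorm])) ht x
    rw [synth_const_mul, synth_phaseOp (np t ht) (nq t ht)] at h3
    have h4 := Complex.reCLM.hasFDerivAt.comp_hasDerivWithinAt t h3
    refine ⟨_, h4, ?_⟩
    rw [deriv_synth_re (np t ht), ← hre1 t ht x]
    have : ∀ a b c : ℝ, Complex.reCLM (-1 * (1 / 2 * (a : ℂ) ^ 2 + 1 / 2 * (b : ℂ) * (a : ℂ)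
        + (c : ℂ))) = -(1 / 2 * a ^ 2 + 1 / 2 * b * a + c) := fun a b c => by
      rw [show (-1 * (1 / 2 * (a : ℂ) ^ 2 + 1 / 2 * (b : ℂ) * (a : ℂ) + (c : ℂ)))
        = ((-(1 / 2 * a ^ 2 + 1 / 2 * b * a + c) : ℝ) : ℂ) by push_cast; ring]
      exact Complex.ofReal_re _
    rw [this]
    ring
  · intro t ht x
    obtain ⟨R', h2⟩ := exists_amp_rhs_bound hs hη hω hp hq N ε
    have h3 := hasDerivWithinAt_synth_time (fun t ht => (nq t ht).integrable)
      (hst.2.mono fun ξ h t ht => by simpa using (h t ht).2) h2 ht x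
    rw [synth_amp_rhs (np t ht) (nq t ht)] at h3
    refine ⟨_, h3, ?_⟩
    rw [synth_ampOp (np t ht) (nq t ht), deriv_synth_re (np t ht),
      deriv_synth_re (np t ht).mulI, hre1 t ht x, hre2 t ht x]
    ring
  · filter_upwards [hφ₀] with x hx
    rw [← hx, Complex.ofReal_re]
  · exact ha₀.symm

end

/-! ### The norms of the analytic spaces -/

/-- The Fourier coefficients `f` normalized so that `ψ = synth f`. -/
def coef (ψ : ℝ → ℂ) (ξ : ℝ) : ℂ := (((√(2 * Real.pi))⁻¹ : ℝ) : ℂ) * fourierL2 ψ ξ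

lemma measurable_coef (ψ : ℝ → ℂ) : Measurable (coef ψ) := (measurable_fourierL2 ψ).const_mul _

lemma sqrt_two_pi_pos : 0 < √(2 * Real.pi) := Real.sqrt_pos.2 (by positivity)

lemma fourierL2_eq_coef (ψ : ℝ → ℂ) (ξ : ℝ) :
    fourierL2 ψ ξ = ((√(2 * Real.pi) : ℝ) : ℂ) * coef ψ ξ := by
  rw [coef, ← mul_assoc, ← Complex.ofReal_mul, mul_inv_cancel₀ sqrt_two_pi_pos.ne']
  simp

lemma coef_synth {f : ℝ → ℂ} (h1 : Integrable f) (h2 : MemLp f 2 volume) :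
    coef (synth f) =ᵐ[volume] f := by
  filter_upwards [fourierL2_synth h1 h2] with ξ hξ
  rw [coef, hξ, ← mul_assoc, ← Complex.ofReal_mul, inv_mul_cancel₀ sqrt_two_pi_pos.ne']
  simp

/-- The growing weight `e^(w⟨ξ⟩)`. -/
def ew (w ξ : ℝ) : ℝ≥0∞ := ENNReal.ofReal (Real.exp (w * bracket ξ))

@[fun_prop]
lemma measurable_ew (w : ℝ) : Measurable (ew w) := by
  unfold ew
  exact ((measurable_bracket.const_mul _).exp).ennreal_ofReal

lemma ew_add (w v ξ : ℝ) : ew (w + v) ξ = ew w ξ * ew v ξ := by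
  unfold ew
  rw [← ENNReal.ofReal_mul (Real.exp_pos _).le, ← Real.exp_add, add_mul]

lemma ew_zero (ξ : ℝ) : ew 0 ξ = 1 := by simp [ew]

lemma ex_eq_ew (ω : ℝ → ℝ) (t ξ : ℝ) : ex ω t ξ = ew (-(ω t)) ξ := by simp [ex, ew]

lemma ew_mono {w v : ℝ} (h : w ≤ v) (ξ : ℝ) : ew w ξ ≤ ew v ξ :=
  ENNReal.ofReal_le_ofReal (Real.exp_le_exp.2 (mul_le_mul_of_nonneg_right h (bracket_pos ξ).le))

lemma hNorm_integrand (w ℓ : ℝ) (ψ : ℝ → ℂ) (ξ : ℝ) :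
    ENNReal.ofReal (bracket ξ ^ (2 * ℓ) * Real.exp (2 * w * bracket ξ) * ‖fourierL2 ψ ξ‖ ^ 2) =
      ENNReal.ofReal (2 * Real.pi) * (br ℓ ξ * (ew w ξ * ‖coef ψ ξ‖ₑ)) ^ 2 := by
  rw [fourierL2_eq_coef, norm_mul, Complex.norm_real, Real.norm_of_nonneg sqrt_two_pi_pos.le,
    mul_pow, Real.sq_sqrt (by positivity), ← ofReal_norm, mul_pow, mul_pow, br_sq, ew,
    ← ENNReal.ofReal_pow (by positivity), ← ENNReal.ofReal_pow (by positivity),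
    ← ENNReal.ofReal_mul (by positivity),
    ← ENNReal.ofReal_mul (Real.rpow_nonneg (bracket_pos _).le _),
    ← ENNReal.ofReal_mul (by positivity)]
  congr 1
  rw [← Real.exp_nat_mul]
  push_cast
  ring_nf

lemma hNorm_sq {w ℓ : ℝ} {ψ : ℝ → ℂ} (hψ : MemLp ψ 2 volume) : hNorm w ℓ ψ ^ 2 =
    ENNReal.ofReal (2 * Real.pi) * ∫⁻ ξ, (br ℓ ξ * (ew w ξ * ‖coef ψ ξ‖ₑ)) ^ 2 := by
  rw [hNorm, if_pos hψ, ← ENNReal.rpow_natCast, ← ENNReal.rpow_mul]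
  simp_rw [hNorm_integrand]
  rw [lintegral_const_mul]
  · norm_num
  · exact ((measurable_br _).mul ((measurable_ew _).mul (measurable_coef ψ).enorm)).pow_const 2

lemma MemH.memLp {w ℓ : ℝ} {ψ : ℝ → ℂ} (h : MemH w ℓ ψ) : MemLp ψ 2 volume := by
  by_contra hc
  rw [MemH, hNorm, if_neg hc] at h
  exact lt_irrefl _ h

/-- Data in `𝓗_w^ℓ` are dominated with the weight `w`. -/
lemma dom_coef {w ℓ : ℝ} {ψ : ℝ → ℂ} (hψ : MemLp ψ 2 volume) {ω : ℝ → ℝ} {t : ℝ} (hω : ω t = w) :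
    Dom ω {t} ℓ (fun _ => coef ψ) (hNorm w ℓ ψ) := by
  refine ⟨fun _ _ => (measurable_coef ψ).aestronglyMeasurable, fun ξ => ew w ξ * ‖coef ψ ξ‖ₑ,
    (measurable_ew _).mul (measurable_coef ψ).enorm, ?_, ae_of_all _ fun ξ τ hτ => ?_⟩
  · rw [wNorm_le_iff, hNorm_sq hψ]
    refine le_mul_of_one_le_left' ?_
    rw [ENNReal.one_le_ofReal]
    linarith [Real.pi_gt_three]
  · rw [mem_singleton_iff.1 hτ, ex_eq_ew, hω, ← mul_assoc, ← ew_add, neg_add_cancel, ew_zero,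
      one_mul]

lemma MemH.rapidDecay_coef {w ℓ : ℝ} {ψ : ℝ → ℂ} (hw : 0 < w) (h : MemH w ℓ ψ) :
    RapidDecay (coef ψ) :=
  (dom_coef h.memLp (ω := fun _ => w) (t := 0) rfl).rapidDecay h.ne (mem_singleton 0) hw

lemma synth_coef {ψ : ℝ → ℂ} (hψ : MemLp ψ 2 volume) (h : RapidDecay (coef ψ)) :
    ψ =ᵐ[volume] synth (coef ψ) := by
  refine synth_fourierL2 hψ ?_
  have := h.integrable.const_mul ((√(2 * Real.pi) : ℝ) : ℂ)
  simpa only [← fourierL2_eq_coef] using this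

lemma coef_sub {ψ χ : ℝ → ℂ} (hψ : MemLp ψ 2 volume) (hχ : MemLp χ 2 volume) :
    coef (fun x => ψ x - χ x) =ᵐ[volume] fun ξ => coef ψ ξ - coef χ ξ := by
  filter_upwards [fourierL2_sub hψ hχ] with ξ hξ
  rw [coef, hξ, coef, coef, mul_sub]

lemma RapidDecay.memLp_synth {f : ℝ → ℂ} (h : RapidDecay f) : MemLp (synth f) 2 volume :=
  WKB.memLp_synth h.integrable h.memLp

lemma RapidDecay.coef_synth {f : ℝ → ℂ} (h : RapidDecay f) : coef (synth f) =ᵐ[volume] f :=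
  WKB.coef_synth h.integrable h.memLp

/-- The coefficients of a real function are invariant under reflection. -/
lemma refl_coef_of_real {φ : ℝ → ℝ} (hφ : MemLp (fun x => (φ x : ℂ)) 2 volume)
    (h : RapidDecay (coef fun x => (φ x : ℂ))) :
    refl (coef fun x => (φ x : ℂ)) =ᵐ[volume] coef fun x => (φ x : ℂ) := by
  have h1 := synth_coef hφ h
  have e : synth (refl (coef fun x => (φ x : ℂ))) = synth (coef fun x => (φ x : ℂ)) := by
    have h2 : synth (refl (coef fun x => (φ x : ℂ))) =ᵐ[volume]
        synth (coef fun x => (φ x : ℂ)) := by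
      filter_upwards [h1] with x hx
      rw [synth_refl, ← hx, Complex.conj_ofReal]
    exact Continuous.ae_eq_iff_eq volume (continuous_synth h.refl.integrable)
      (continuous_synth h.integrable) |>.1 h2
  have h3 := h.refl.coef_synth
  rw [e] at h3
  exact h3.symm.trans h.coef_synth

lemma hNorm_sq_synth {w ℓ : ℝ} {f : ℝ → ℂ} (h : RapidDecay f) : hNorm w ℓ (synth f) ^ 2 =
    ENNReal.ofReal (2 * Real.pi) * ∫⁻ ξ, (br ℓ ξ * (ew w ξ * ‖f ξ‖ₑ)) ^ 2 := by
  rw [hNorm_sq h.memLp_synth]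
  congr 1
  refine lintegral_congr_ae ?_
  filter_upwards [h.coef_synth] with ξ hξ
  rw [hξ]

lemma two_pi_le : ENNReal.ofReal (2 * Real.pi) ≤ 8 := by
  refine (ENNReal.ofReal_le_ofReal (q := 8) (by linarith [Real.pi_le_four])).trans ?_
  simp

/-- `∫₀^∞ e^(-M t ⟨ξ⟩) dt = 1 / (M ⟨ξ⟩)`: the source of the gain of half a derivative. -/
lemma lintegral_Icc_ew_le {M T ξ : ℝ} (hM : 0 < M) :
    ∫⁻ t in Icc 0 T, ew (-(M * t)) ξ ≤ ENNReal.ofReal M⁻¹ * br (-1) ξ := by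
  have hb := bracket_pos ξ
  have hneg : -(M * bracket ξ) < 0 := by nlinarith
  have e : ∀ t, ew (-(M * t)) ξ = ENNReal.ofReal (Real.exp (-(M * bracket ξ) * t)) := fun t => by
    rw [ew]; congr 2; ring
  simp_rw [e]
  calc _ ≤ ∫⁻ t in Ici 0, ENNReal.ofReal (Real.exp (-(M * bracket ξ) * t)) :=
        lintegral_mono_set Icc_subset_Ici_self
    _ = ∫⁻ t in Ioi 0, ENNReal.ofReal (Real.exp (-(M * bracket ξ) * t)) := by
        rw [setLIntegral_congr Ioi_ae_eq_Ici]
    _ = ENNReal.ofReal (∫ t in Ioi 0, Real.exp (-(M * bracket ξ) * t)) :=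
        (ofReal_integral_eq_lintegral_ofReal (integrableOn_exp_mul_Ioi hneg 0)
          (ae_of_all _ fun t => (Real.exp_pos _).le)).symm
    _ = _ := by
        rw [integral_exp_mul_Ioi hneg, br, ← ENNReal.ofReal_mul (by positivity),
          Real.rpow_neg_one]
        congr 1
        simp [mul_comm]

section Norms

variable {w₀ M T ℓ : ℝ} {f : ℝ → ℝ → ℂ} {ψ : ℝ → ℝ → ℂ} {R : ℝ≥0∞}

lemma weight_half_pos (hM : 0 < M) (hT : T < w₀ / M) {t : ℝ} (ht : t ∈ Icc 0 T) :
    0 < weight w₀ (M / 2) t := by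
  rw [lt_div_iff₀ hM] at hT
  have h1 : M * t ≤ T * M := by rw [mul_comm]; exact mul_le_mul_of_nonneg_right ht.2 hM.le
  have h2 : 0 ≤ M * t := mul_nonneg hM.le ht.1
  rw [weight]; linarith

/-- The pointwise in time estimate with the factor `e^(-M t ⟨ξ⟩)` left by the difference of the two
weights. -/
lemma hNorm_sq_le_of_dom (hM : 0 < M) (hT : T < w₀ / M) (hR : R ≠ ∞)
    (hf : Dom (weight w₀ (M / 2)) (Icc 0 T) ℓ f R) : ∃ K : ℝ → ℝ≥0∞, Measurable K ∧
      wNorm ℓ K ≤ R ∧ ∀ t ∈ Icc 0 T, ∀ ℓ', hNorm (weight w₀ M t) ℓ' (synth (f t)) ^ 2 ≤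
        8 * ∫⁻ ξ, (br ℓ' ξ * K ξ) ^ 2 * ew (-(M * t)) ξ := by
  have hn : ∀ t ∈ Icc 0 T, RapidDecay (f t) := fun t ht =>
      hf.rapidDecay hR ht (weight_half_pos hM hT ht)
  obtain ⟨hm, K, hK, hKR, hb⟩ := hf
  refine ⟨K, hK, hKR, fun t ht ℓ' => ?_⟩
  rw [hNorm_sq_synth (hn t ht)]
  refine mul_le_mul' two_pi_le (lintegral_mono_ae ?_)
  filter_upwards [hb] with ξ h
  have h1 : ew (weight w₀ M t) ξ * ‖f t ξ‖ₑ ≤ ew (-(M / 2 * t)) ξ * K ξ := by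
    calc _ ≤ ew (weight w₀ M t) ξ * (ex (weight w₀ (M / 2)) t ξ * K ξ) := by gcongr; exact h t ht
      _ = _ := by
        rw [ex_eq_ew, ← mul_assoc, ← ew_add]
        congr 2
        simp only [weight]; ring
  calc _ ≤ (br ℓ' ξ * (ew (-(M / 2 * t)) ξ * K ξ)) ^ 2 := by gcongr
    _ = (br ℓ' ξ * K ξ) ^ 2 * (ew (-(M / 2 * t)) ξ * ew (-(M / 2 * t)) ξ) := by ring
    _ = _ := by rw [← ew_add]; congr 2; ring

/-- Domination with the weight `w₀ - (M/2) t` controls the norm for the weight `w₀ - M t`: the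
difference of the two weights provides the half derivative in `L²` in time. -/
lemma tripleNorm_sq_le (hM : 0 < M) (hT : T < w₀ / M) (hR : R ≠ ∞)
    (hf : Dom (weight w₀ (M / 2)) (Icc 0 T) ℓ f R) (hψ : ∀ t ∈ Icc 0 T, ψ t = synth (f t)) :
    (∀ t ∈ Icc 0 T, hNorm (weight w₀ M t) ℓ (ψ t) ^ 2 ≤ 8 * R ^ 2) ∧
    ENNReal.ofReal (2 * M) *
      ∫⁻ s in Icc 0 T, hNorm (weight w₀ M s) (ℓ + 1 / 2) (ψ s) ^ 2 ≤ 16 * R ^ 2 := by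
  obtain ⟨K, hK, hKR, h⟩ := hNorm_sq_le_of_dom hM hT hR hf
  rw [wNorm_le_iff] at hKR
  constructor
  · intro t ht
    rw [hψ t ht]
    refine (h t ht ℓ).trans ?_
    gcongr
    refine (lintegral_mono fun ξ => ?_).trans hKR
    refine mul_le_of_le_one_right' ?_
    rw [← ew_zero ξ]
    exact ew_mono (by nlinarith [ht.1]) ξ
  · have hew : Measurable fun z : ℝ × ℝ => ew (-(M * z.1)) z.2 := by
      unfold ew
      have := measurable_bracket
      fun_prop
    calc _ ≤ ENNReal.ofReal (2 * M) * ∫⁻ t in Icc 0 T,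
            8 * ∫⁻ ξ, (br (ℓ + 1 / 2) ξ * K ξ) ^ 2 * ew (-(M * t)) ξ := by
          gcongr 1
          refine setLIntegral_mono' measurableSet_Icc fun t ht => ?_
          rw [hψ t ht]
          exact h t ht _
      _ = ENNReal.ofReal (2 * M) * (8 * ∫⁻ ξ, (br (ℓ + 1 / 2) ξ * K ξ) ^ 2 *
            ∫⁻ t in Icc 0 T, ew (-(M * t)) ξ) := by
          have hm : Measurable fun z : ℝ × ℝ =>
              (br (ℓ + 1 / 2) z.2 * K z.2) ^ 2 * ew (-(M * z.1)) z.2 :=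
            Measurable.mul (by fun_prop) hew
          rw [lintegral_const_mul _ (Measurable.lintegral_prod_right (f := fun t ξ =>
              (br (ℓ + 1 / 2) ξ * K ξ) ^ 2 * ew (-(M * t)) ξ) hm),
            lintegral_lintegral_swap (f := fun t ξ =>
              (br (ℓ + 1 / 2) ξ * K ξ) ^ 2 * ew (-(M * t)) ξ) hm.aemeasurable]
          congr 3; ext ξ
          rw [lintegral_const_mul]
          exact hew.comp (f := fun t : ℝ => (t, ξ)) (by fun_prop)
      _ ≤ ENNReal.ofReal (2 * M) * (8 * ∫⁻ ξ, (br (ℓ + 1 / 2) ξ * K ξ) ^ 2 *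
            (ENNReal.ofReal M⁻¹ * br (-1) ξ)) := by
          gcongr
          exact lintegral_Icc_ew_le hM
      _ = (ENNReal.ofReal (2 * M) * ENNReal.ofReal M⁻¹) * (8 * ∫⁻ ξ, (br ℓ ξ * K ξ) ^ 2) := by
          have : ∀ ξ, (br (ℓ + 1 / 2) ξ * K ξ) ^ 2 * (ENNReal.ofReal M⁻¹ * br (-1) ξ) =
              ENNReal.ofReal M⁻¹ * (br ℓ ξ * K ξ) ^ 2 := fun ξ => by
            have e1 : br (1 / 2) ξ * br (1 / 2) ξ * br (-1) ξ = 1 := by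
              rw [← br_add, ← br_add]; norm_num [br_zero]
            rw [br_add]
            calc _ = ENNReal.ofReal M⁻¹ * (br ℓ ξ * K ξ) ^ 2 *
                  (br (1 / 2) ξ * br (1 / 2) ξ * br (-1) ξ) := by ring
              _ = _ := by rw [e1, mul_one]
          simp_rw [this]
          rw [lintegral_const_mul _ (by fun_prop)]
          ring
      _ ≤ 2 * (8 * R ^ 2) := by
          gcongr
          rw [← ENNReal.ofReal_mul (by positivity), mul_assoc, mul_inv_cancel₀ hM.ne']
          simp
      _ = _ := by ring

lemma tripleNorm_le (hM : 0 < M) (hT : T < w₀ / M) (hR : R ≠ ∞)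
    (hf : Dom (weight w₀ (M / 2)) (Icc 0 T) ℓ f R) (hψ : ∀ t ∈ Icc 0 T, ψ t = synth (f t)) :
    tripleNorm w₀ M ℓ T ψ ≤ 4 * R := by
  obtain ⟨h1, h2⟩ := tripleNorm_sq_le hM hT hR hf hψ
  have h3 : (4 * R) = ((4 * R) ^ 2) ^ (1 / 2 : ℝ) := by
    rw [← ENNReal.rpow_natCast, ← ENNReal.rpow_mul]; norm_num
  rw [tripleNorm, h3]
  refine ENNReal.rpow_le_rpow (max_le (iSup₂_le fun t ht => (h1 t ht).trans ?_) (h2.trans ?_))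
    (by norm_num)
  · rw [mul_pow]; gcongr; norm_num
  · rw [mul_pow]; gcongr; norm_num

/-- Domination with the weight `w₀ - (M/2) t` and continuity in time at almost every frequency give
an element of `Y_{w,T}^ℓ` for `w = w₀ - M t`: continuity in norm follows by dominated
convergence. -/
lemma memY_of_dom (hM : 0 < M) (hT : T < w₀ / M) (hR : R ≠ ∞)
    (hf : Dom (weight w₀ (M / 2)) (Icc 0 T) ℓ f R) (hψ : ∀ t ∈ Icc 0 T, ψ t = synth (f t))
    (hc : ∀ᵐ ξ, ContinuousOn (fun t => f t ξ) (Icc 0 T)) : MemY (weight w₀ M) T ℓ ψ := by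
  obtain ⟨h1, h2⟩ := tripleNorm_sq_le hM hT hR hf hψ
  refine ⟨⟨fun t ht => ?_, fun t ht => ?_⟩, ?_⟩
  · have := (h1 t ht).trans_lt (ENNReal.mul_lt_top (by norm_num) (ENNReal.pow_lt_top hR.lt_top))
    exact ((ENNReal.pow_lt_top_iff).1 this).resolve_right (by norm_num)
  · have hn : ∀ t ∈ Icc 0 T, RapidDecay (f t) := fun t ht =>
      hf.rapidDecay hR ht (weight_half_pos hM hT ht)
    obtain ⟨hm, K, hK, hKR, hb⟩ := hf
    set F : ℝ → ℝ → ℝ≥0∞ := fun s ξ => ENNReal.ofReal (bracket ξ ^ (2 * ℓ) *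
      ‖(Real.exp (weight w₀ M s * bracket ξ) : ℂ) * (((√(2 * Real.pi) : ℝ) : ℂ) * f s ξ)
        - (Real.exp (weight w₀ M t * bracket ξ) : ℂ) * (((√(2 * Real.pi) : ℝ) : ℂ) * f t ξ)‖ ^ 2)
      with hF
    have hfou : ∀ s ∈ Icc 0 T, fourierL2 (ψ s) =ᵐ[volume]
        fun ξ => ((√(2 * Real.pi) : ℝ) : ℂ) * f s ξ := fun s hs => by
      rw [hψ s hs]; exact fourierL2_synth (hn s hs).integrable (hn s hs).memLp
    have hmem : ∀ᶠ s in 𝓝[Icc 0 T] t, s ∈ Icc 0 T := self_mem_nhdsWithin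
    have key : Tendsto (fun s => ∫⁻ ξ, F s ξ) (𝓝[Icc 0 T] t) (𝓝 (∫⁻ ξ : ℝ, (0 : ℝ≥0∞))) := by
      refine tendsto_lintegral_filter_of_dominated_convergence'
        (fun ξ => 4 * ENNReal.ofReal (2 * Real.pi) * (br ℓ ξ * K ξ) ^ 2) ?_ ?_ ?_ ?_
      · filter_upwards [hmem] with s hs
        have m1 : ∀ s ∈ Icc 0 T, AEMeasurable (fun ξ =>
            (Real.exp (weight w₀ M s * bracket ξ) : ℂ) * (((√(2 * Real.pi) : ℝ) : ℂ) * f s ξ))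
            volume := fun s hs => by
          refine AEMeasurable.mul ?_ ((hm s hs).aemeasurable.const_mul _)
          exact (Complex.measurable_ofReal.comp
            (measurable_bracket.const_mul _).exp).aemeasurable
        refine AEMeasurable.ennreal_ofReal (AEMeasurable.mul ?_ ?_)
        · exact (measurable_bracket.pow_const _).aemeasurable
        · exact (((m1 s hs).sub (m1 t ht)).norm).pow_const 2
      · filter_upwards [hmem] with s hs
        filter_upwards [hb] with ξ h
        have b1 : ∀ s ∈ Icc 0 T, ‖(Real.exp (weight w₀ M s * bracket ξ) : ℂ) *
            (((√(2 * Real.pi) : ℝ) : ℂ) * f s ξ)‖ₑ ≤ ENNReal.ofReal (√(2 * Real.pi)) * K ξ := by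
          intro s hs
          rw [enorm_mul, enorm_mul, ← ofReal_norm, ← ofReal_norm, Complex.norm_real,
            Complex.norm_real, Real.norm_of_nonneg (Real.exp_pos _).le,
            Real.norm_of_nonneg sqrt_two_pi_pos.le]
          have : ENNReal.ofReal (Real.exp (weight w₀ M s * bracket ξ)) * ‖f s ξ‖ₑ ≤ K ξ := by
            calc _ ≤ ew (weight w₀ M s) ξ * (ex (weight w₀ (M / 2)) s ξ * K ξ) := by
                  rw [ew]; gcongr; exact h s hs
              _ = ew (weight w₀ M s - weight w₀ (M / 2) s) ξ * K ξ := by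
                  rw [ex_eq_ew, ← mul_assoc, ← ew_add, sub_eq_add_neg]
              _ ≤ 1 * K ξ := by
                  gcongr
                  rw [← ew_zero ξ]
                  refine ew_mono ?_ ξ
                  simp only [weight]
                  nlinarith [hs.1]
              _ = K ξ := one_mul _
          calc _ = ENNReal.ofReal (√(2 * Real.pi)) *
                (ENNReal.ofReal (Real.exp (weight w₀ M s * bracket ξ)) * ‖f s ξ‖ₑ) := by ring
            _ ≤ _ := by gcongr
        have b2 := (enorm_sub_le (a := (Real.exp (weight w₀ M s * bracket ξ) : ℂ) *
            (((√(2 * Real.pi) : ℝ) : ℂ) * f s ξ)) (b := (Real.exp (weight w₀ M t * bracket ξ) : ℂ) *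
            (((√(2 * Real.pi) : ℝ) : ℂ) * f t ξ))).trans (add_le_add (b1 s hs) (b1 t ht))
        simp only [hF]
        rw [ENNReal.ofReal_mul (Real.rpow_nonneg (bracket_pos _).le _), ← br_sq,
          ENNReal.ofReal_pow (norm_nonneg _), ofReal_norm]
        calc _ ≤ br ℓ ξ ^ 2 * (ENNReal.ofReal (√(2 * Real.pi)) * K ξ +
              ENNReal.ofReal (√(2 * Real.pi)) * K ξ) ^ 2 := by gcongr
          _ = 4 * ENNReal.ofReal (√(2 * Real.pi)) ^ 2 * (br ℓ ξ * K ξ) ^ 2 := by ring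
          _ = _ := by
            rw [← ENNReal.ofReal_pow (Real.sqrt_nonneg _), Real.sq_sqrt (by positivity)]
      · rw [lintegral_const_mul _ (by fun_prop), ← wNorm_sq]
        exact ENNReal.mul_ne_top (ENNReal.mul_ne_top (by norm_num) ENNReal.ofReal_ne_top)
          (ENNReal.pow_ne_top (ne_top_of_le_ne_top hR hKR))
      · filter_upwards [hc] with ξ h
        have hcont : ContinuousOn (fun s => bracket ξ ^ (2 * ℓ) *
            ‖(Real.exp (weight w₀ M s * bracket ξ) : ℂ) * (((√(2 * Real.pi) : ℝ) : ℂ) * f s ξ)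
            - (Real.exp (weight w₀ M t * bracket ξ) : ℂ) * (((√(2 * Real.pi) : ℝ) : ℂ) * f t ξ)‖
            ^ 2) (Icc 0 T) := by
          simp only [weight]
          fun_prop
        have := ENNReal.tendsto_ofReal (hcont t ht)
        simp only [sub_self, norm_zero, ne_eq, OfNat.ofNat_ne_zero, not_false_eq_true, zero_pow,
          mul_zero, ENNReal.ofReal_zero] at this
        exact this
    rw [lintegral_zero] at key
    refine key.congr' ?_
    filter_upwards [hmem] with s hs
    refine lintegral_congr_ae ?_
    filter_upwards [hfou s hs, hfou t ht] with ξ e1 e2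
    rw [e1, e2]
  · have h3 : ENNReal.ofReal (2 * M) ≠ 0 := by simp [hM]
    by_contra hc
    rw [not_lt, top_le_iff] at hc
    rw [hc, ENNReal.mul_top h3, top_le_iff] at h2
    exact ENNReal.mul_ne_top (by norm_num) (ENNReal.pow_ne_top hR) h2

end Norms

/-! ### Strong differentiability from weak differentiability -/

section Hilbert

variable {H : Type*} [NormedAddCommGroup H] [InnerProductSpace ℝ H] [CompleteSpace H]
  {S : Set H} {u v : ℝ → H} {I : Set ℝ}

/-- The mean value inequality for a curve that is differentiable when tested against a total set. -/
lemma norm_sub_le_of_weak_deriv (hS : ∀ z, (∀ h ∈ S, inner ℝ h z = 0) → z = 0) (hI : Convex ℝ I)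
    (hd : ∀ h ∈ S, ∀ t ∈ I, HasDerivWithinAt (fun τ => inner ℝ h (u τ)) (inner ℝ h (v t)) I t)
    {C : ℝ} (hC : ∀ t ∈ I, ‖v t‖ ≤ C) {t t' : ℝ} (ht : t ∈ I) (ht' : t' ∈ I) :
    ‖u t' - u t‖ ≤ C * |t' - t| := by
  have hd' : ∀ h ∈ Submodule.span ℝ S, ∀ t ∈ I,
      HasDerivWithinAt (fun τ => inner ℝ h (u τ)) (inner ℝ h (v t)) I t := by
    intro h hh
    induction hh using Submodule.span_induction with
    | mem h hh => exact hd h hh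
    | zero => intro t _; simpa using hasDerivWithinAt_const t I (0 : ℝ)
    | add x y _ _ hx hy =>
      intro t ht
      simp only [inner_add_left]
      exact (hx t ht).add (hy t ht)
    | smul c x _ hx =>
      intro t ht
      simp only [real_inner_smul_left]
      exact (hx t ht).const_mul c
  have hb : ∀ h ∈ Submodule.span ℝ S, inner ℝ h (u t' - u t) ≤ ‖h‖ * (C * |t' - t|) := by
    intro h hh
    have := hI.norm_image_sub_le_of_norm_hasDerivWithin_le (C := ‖h‖ * C) (hd' h hh)
      (fun τ hτ => (norm_inner_le_norm _ _).trans
        (mul_le_mul_of_nonneg_left (hC τ hτ) (norm_nonneg _))) ht ht'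
    rw [inner_sub_right, ← mul_assoc]
    exact (le_abs_self _).trans this
  have hdense : Dense (Submodule.span ℝ S : Set H) := by
    rw [Submodule.dense_iff_topologicalClosure_eq_top, Submodule.topologicalClosure_eq_top_iff,
      Submodule.eq_bot_iff]
    intro z hz
    exact hS z fun h hh => (Submodule.mem_orthogonal _ _).1 hz h (Submodule.subset_span hh)
  have hall : ∀ h : H, inner ℝ h (u t' - u t) ≤ ‖h‖ * (C * |t' - t|) := fun h =>
    hdense.induction (P := fun h => inner ℝ h (u t' - u t) ≤ ‖h‖ * (C * |t' - t|)) hb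
      (isClosed_le (by fun_prop) (by fun_prop)) h
  have h1 := hall (u t' - u t)
  rw [real_inner_self_eq_norm_sq, sq] at h1
  by_cases h0 : ‖u t' - u t‖ = 0
  · rw [h0]
    exact mul_nonneg ((norm_nonneg _).trans (hC t ht)) (abs_nonneg _)
  · exact le_of_mul_le_mul_left h1 (lt_of_le_of_ne (norm_nonneg _) (Ne.symm h0))

/-- A curve whose weak derivative is continuous is differentiable in norm. -/
lemma hasDerivWithinAt_of_weak_deriv {a b : ℝ}
    (hS : ∀ z, (∀ h ∈ S, inner ℝ h z = 0) → z = 0)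
    (hd : ∀ h ∈ S, ∀ t ∈ Icc a b,
      HasDerivWithinAt (fun τ => inner ℝ h (u τ)) (inner ℝ h (v t)) (Icc a b) t)
    {t : ℝ} (ht : t ∈ Icc a b) (hv : ContinuousWithinAt v (Icc a b) t) :
    HasDerivWithinAt u (v t) (Icc a b) t := by
  rw [hasDerivWithinAt_iff_isLittleO, Asymptotics.isLittleO_iff]
  intro c hc
  obtain ⟨δ, hδ, hvδ⟩ := Metric.continuousWithinAt_iff.1 hv c hc
  filter_upwards [self_mem_nhdsWithin, mem_nhdsWithin_of_mem_nhds (Metric.ball_mem_nhds t hδ)]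
    with t' ht' hδ'
  have hconv : Convex ℝ (Icc a b ∩ Metric.ball t δ) := (convex_Icc a b).inter (convex_ball t δ)
  have := norm_sub_le_of_weak_deriv (u := fun τ => u τ - τ • v t) (v := fun τ => v τ - v t)
    (C := c) hS hconv (fun h hh τ hτ => ?_) (fun τ hτ => ?_) ⟨ht, Metric.mem_ball_self hδ⟩
    ⟨ht', hδ'⟩
  · calc _ = ‖u t' - t' • v t - (u t - t • v t)‖ := by congr 1; rw [sub_smul]; abel
      _ ≤ _ := this
  · have h1 := (hd h hh τ hτ.1).mono (inter_subset_left (t := Metric.ball t δ))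
    have h2 := ((hasDerivWithinAt_id τ (Icc a b ∩ Metric.ball t δ)).mul_const (inner ℝ h (v t)))
    have h3 := h1.sub h2
    simp only [inner_sub_right, real_inner_smul_right]
    refine h3.congr_deriv (by ring)
  · have := hvδ hτ.1 hτ.2
    rw [dist_eq_norm] at this
    exact this.le

end Hilbert

/-! ### Weighted `L²` vectors -/

/-- `f` has norm at most `C` in `L²(⟨ξ⟩^(2s) e^(2ρ⟨ξ⟩) dξ)`. -/
abbrev DomAt (ρ s : ℝ) (f : ℝ → ℂ) (C : ℝ≥0∞) : Prop :=
  Dom (fun _ => ρ) {0} s (fun _ => f) C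

/-- The weight `⟨ξ⟩^s e^(ρ⟨ξ⟩)`. -/
def wt (ρ s ξ : ℝ) : ℝ := bracket ξ ^ s * Real.exp (ρ * bracket ξ)

lemma wt_pos (ρ s ξ : ℝ) : 0 < wt ρ s ξ :=
  mul_pos (Real.rpow_pos_of_pos (bracket_pos ξ) s) (Real.exp_pos _)

lemma measurable_wt (ρ s : ℝ) : Measurable (wt ρ s) :=
  (measurable_bracket.pow_const s).mul (measurable_bracket.const_mul ρ).exp

lemma enorm_wt (ρ s ξ : ℝ) : ‖(wt ρ s ξ : ℂ)‖ₑ = br s ξ * ew ρ ξ := by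
  rw [← ofReal_norm, Complex.norm_real, Real.norm_of_nonneg (wt_pos ρ s ξ).le, wt, br, ew,
    ENNReal.ofReal_mul (Real.rpow_nonneg (bracket_pos ξ).le _)]

lemma eLpNorm_wt_mul (ρ s : ℝ) (f : ℝ → ℂ) :
    eLpNorm (fun ξ => (wt ρ s ξ : ℂ) * f ξ) 2 volume = wNorm s fun ξ => ew ρ ξ * ‖f ξ‖ₑ := by
  refine eLpNorm_congr_enorm_ae (ae_of_all _ fun ξ => ?_)
  rw [enorm_mul, enorm_wt, enorm_eq_self, mul_assoc]

lemma domAt_iff {ρ s : ℝ} {f : ℝ → ℂ} {C : ℝ≥0∞} : DomAt ρ s f C ↔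
    AEStronglyMeasurable f volume ∧ eLpNorm (fun ξ => (wt ρ s ξ : ℂ) * f ξ) 2 volume ≤ C := by
  constructor
  · rintro ⟨hm, K, hK, hKC, hb⟩
    refine ⟨hm 0 rfl, ?_⟩
    rw [eLpNorm_wt_mul]
    refine (wNorm_mono_ae ?_).trans hKC
    filter_upwards [hb] with ξ h
    calc _ ≤ ew ρ ξ * (ex (fun _ => ρ) 0 ξ * K ξ) := by gcongr; exact h 0 rfl
      _ = K ξ := by rw [ex_eq_ew, ← mul_assoc, ← ew_add, add_neg_cancel, ew_zero, one_mul]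
  · rintro ⟨hm, hC⟩
    rw [eLpNorm_wt_mul] at hC
    refine ⟨fun _ _ => hm, fun ξ => ew ρ ξ * ‖hm.mk f ξ‖ₑ,
      (measurable_ew ρ).mul hm.stronglyMeasurable_mk.measurable.enorm, ?_, ?_⟩
    · refine (wNorm_mono_ae ?_).trans hC
      filter_upwards [hm.ae_eq_mk] with ξ h
      rw [h]
    · filter_upwards [hm.ae_eq_mk] with ξ h t _
      rw [ex_eq_ew, ← mul_assoc, ← ew_add, neg_add_cancel, ew_zero, one_mul, h]

lemma DomAt.memLp {ρ s : ℝ} {f : ℝ → ℂ} {C : ℝ≥0∞} (h : DomAt ρ s f C) (hC : C ≠ ∞) :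
    MemLp (fun ξ => (wt ρ s ξ : ℂ) * f ξ) 2 volume := by
  obtain ⟨hm, h⟩ := domAt_iff.1 h
  exact ⟨(Complex.measurable_ofReal.comp (measurable_wt ρ s)).aestronglyMeasurable.mul hm,
    h.trans_lt hC.lt_top⟩

open scoped Classical in
/-- The vector `⟨ξ⟩^s e^(ρ⟨ξ⟩) f` of `L²` (and `0` if this function is not in `L²`). -/
def vec (ρ s : ℝ) (f : ℝ → ℂ) : Lp ℂ 2 (volume : Measure ℝ) :=
  if h : MemLp (fun ξ => (wt ρ s ξ : ℂ) * f ξ) 2 volume then h.toLp _ else 0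

section vec

variable {ρ s : ℝ} {f g : ℝ → ℂ} {C C' : ℝ≥0∞}

lemma DomAt.coe_vec (h : DomAt ρ s f C) (hC : C ≠ ∞) :
    vec ρ s f =ᵐ[volume] fun ξ => (wt ρ s ξ : ℂ) * f ξ := by
  rw [vec, dif_pos (h.memLp hC)]
  exact MemLp.coeFn_toLp _

lemma DomAt.enorm_vec_le (h : DomAt ρ s f C) : ‖vec ρ s f‖ₑ ≤ C := by
  by_cases hC : C = ∞
  · simp [hC]
  rw [Lp.enorm_def, eLpNorm_congr_ae (h.coe_vec hC)]
  exact (domAt_iff.1 h).2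

lemma DomAt.of_enorm_vec_le (h : DomAt ρ s f C) (hC : C ≠ ∞) (h' : ‖vec ρ s f‖ₑ ≤ C') :
    DomAt ρ s f C' := by
  rw [Lp.enorm_def, eLpNorm_congr_ae (h.coe_vec hC)] at h'
  exact domAt_iff.2 ⟨(domAt_iff.1 h).1, h'⟩

lemma DomAt.sub (h : DomAt ρ s f C) (h' : DomAt ρ s g C') :
    DomAt ρ s (fun ξ => f ξ - g ξ) (C + C') :=
  Dom.sub h h'

lemma vec_sub (h : DomAt ρ s f C) (hC : C ≠ ∞) (h' : DomAt ρ s g C') (hC' : C' ≠ ∞) :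
    vec ρ s (fun ξ => f ξ - g ξ) = vec ρ s f - vec ρ s g := by
  have h2 := DomAt.sub h h'
  refine Lp.ext ?_
  filter_upwards [h.coe_vec hC, h'.coe_vec hC', h2.coe_vec (ENNReal.add_ne_top.2 ⟨hC, hC'⟩),
    Lp.coeFn_sub (vec ρ s f) (vec ρ s g)] with ξ e1 e2 e3 e4
  rw [e3, e4, Pi.sub_apply, e1, e2, mul_sub]

/-- The vector whose inner products are the values of `synth`. -/
def testFun (ρ s : ℝ) (c : ℂ) (x ξ : ℝ) : ℂ :=
  c * ((wt ρ s ξ : ℂ)⁻¹ * Complex.exp (-(Complex.I * x * ξ)))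

lemma memLp_wt_inv (hρ : 0 ≤ ρ) (hs : 1 ≤ s) :
    MemLp (fun ξ => (wt ρ s ξ : ℂ)⁻¹) 2 volume := by
  have hm : Measurable fun ξ => (wt ρ s ξ : ℂ)⁻¹ :=
    (Complex.measurable_ofReal.comp (measurable_wt ρ s)).inv
  rw [memLp_two_iff_integrable_sq_norm hm.aestronglyMeasurable]
  refine integrable_inv_one_add_sq.mono' (hm.norm.pow_const 2).aestronglyMeasurable
    (ae_of_all _ fun ξ => ?_)
  rw [norm_pow, norm_norm, norm_inv, Complex.norm_real, Real.norm_of_nonneg (wt_pos ρ s ξ).le,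
    ← bracket_sq, inv_pow]
  have hb := bracket_pos ξ
  refine inv_anti₀ (by positivity) (pow_le_pow_left₀ hb.le ?_ 2)
  calc bracket ξ = bracket ξ ^ (1 : ℝ) * 1 := by simp
    _ ≤ wt ρ s ξ := by
      rw [wt]
      have h1 : 1 ≤ Real.exp (ρ * bracket ξ) := Real.one_le_exp (by positivity)
      have h2 := Real.rpow_le_rpow_of_exponent_le (one_le_bracket ξ) hs
      gcongr

lemma memLp_testFun (hρ : 0 ≤ ρ) (hs : 1 ≤ s) (c : ℂ) (x : ℝ) :
    MemLp (testFun ρ s c x) 2 volume := by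
  refine MemLp.of_le_mul (c := ‖c‖) (memLp_wt_inv hρ hs) ?_ (ae_of_all _ fun ξ => ?_)
  · refine AEStronglyMeasurable.const_mul (AEStronglyMeasurable.mul (memLp_wt_inv hρ hs).1
      (Continuous.aestronglyMeasurable (by fun_prop))) _
  · rw [testFun, norm_mul, norm_mul]
    have : ‖Complex.exp (-(Complex.I * x * ξ))‖ = 1 := by
      rw [show -(Complex.I * x * ξ) = Complex.I * ((-x : ℝ) : ℂ) * ξ by push_cast; ring]
      exact norm_exp_I_mul_mul _ _
    rw [this, mul_one]

/-- Testing against `testFun` evaluates the synthesis at `x`. -/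
lemma inner_testFun (hρ : 0 ≤ ρ) (hs : 1 ≤ s) (c : ℂ) (x : ℝ)
    (z : Lp ℂ 2 (volume : Measure ℝ)) :
    inner ℝ ((memLp_testFun hρ hs c x).toLp _) z =
      ((starRingEnd ℂ) c * synth (fun ξ => (wt ρ s ξ : ℂ)⁻¹ * z ξ) x).re := by
  have hi : Integrable (fun ξ => (wt ρ s ξ : ℂ)⁻¹ * z ξ) :=
    (memLp_wt_inv hρ hs).integrable_mul (Lp.memLp z)
  rw [L2.inner_def, synth, ← integral_const_mul]
  have := (integral_re ((integrable_exp_mul hi x).const_mul ((starRingEnd ℂ) c)))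
  simp only [RCLike.re_eq_complex_re] at this
  rw [← this]
  refine integral_congr_ae ?_
  filter_upwards [(memLp_testFun hρ hs c x).coeFn_toLp] with ξ e
  rw [e, Complex.inner, testFun]
  congr 1
  have e1 : (starRingEnd ℂ) (Complex.exp (-(Complex.I * x * ξ))) =
      Complex.exp (Complex.I * x * ξ) := by
    rw [← Complex.exp_conj]
    simp
  rw [map_mul, map_mul, map_inv₀, Complex.conj_ofReal, e1]
  ring

/-- The test vectors are total, because a function on the Fourier side is determined by its
synthesis. -/
lemma eq_zero_of_inner_testFun (hρ : 0 ≤ ρ) (hs : 1 ≤ s) {z : Lp ℂ 2 (volume : Measure ℝ)}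
    (h : ∀ c x, inner ℝ ((memLp_testFun hρ hs c x).toLp _) z = 0) : z = 0 := by
  set f : ℝ → ℂ := fun ξ => (wt ρ s ξ : ℂ)⁻¹ * z ξ with hf
  have hi : Integrable f := (memLp_wt_inv hρ hs).integrable_mul (Lp.memLp z)
  have h2 : MemLp f 2 volume := by
    refine MemLp.of_le_mul (c := 1) (Lp.memLp z) hi.1 (ae_of_all _ fun ξ => ?_)
    rw [hf]
    simp only [norm_mul, norm_inv, Complex.norm_real]
    gcongr
    rw [Real.norm_of_nonneg (wt_pos ρ s ξ).le]
    refine inv_le_one_of_one_le₀ ?_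
    rw [wt]
    have hb := bracket_pos ξ
    exact one_le_mul_of_one_le_of_one_le
      (Real.one_le_rpow (one_le_bracket ξ) (by linarith)) (Real.one_le_exp (by positivity))
  have h0 : synth f = synth 0 := by
    ext x
    have h1 := h 1 x
    have h3 := h Complex.I x
    rw [inner_testFun hρ hs] at h1 h3
    have : synth f x = 0 := by
      refine Complex.ext ?_ ?_
      · simpa using h1
      · simpa using h3
    rw [this]; simp [synth]
  have h3 := coef_synth hi h2
  have h4 := coef_synth (f := 0) (integrable_zero _ _ _) MemLp.zero
  rw [h0] at h3
  refine Lp.ext ?_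
  filter_upwards [h3, h4, Lp.coeFn_zero ℂ 2 (volume : Measure ℝ)] with ξ e3 e4 e5
  rw [e5, Pi.zero_apply]
  rw [e4, hf, Pi.zero_apply] at e3
  have := (wt_pos ρ s ξ).ne'
  simpa [this] using e3.symm

lemma DomAt.inner_testFun_vec (hρ : 0 ≤ ρ) (hs : 1 ≤ s) (h : DomAt ρ s f C) (hC : C ≠ ∞) (c : ℂ)
    (x : ℝ) : inner ℝ ((memLp_testFun hρ hs c x).toLp _) (vec ρ s f) =
      ((starRingEnd ℂ) c * synth f x).re := by
  rw [inner_testFun hρ hs, synth_congr_ae]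
  filter_upwards [h.coe_vec hC] with ξ e
  have : (wt ρ s ξ : ℂ) ≠ 0 := by exact_mod_cast (wt_pos ρ s ξ).ne'
  rw [e, inv_mul_cancel_left₀ this]

end vec

/-! ### Differentiability in time of the Fourier coefficients -/

section Time

variable {ρ s a b : ℝ} {f g : ℝ → ℝ → ℂ} {C : ℝ≥0}

/-- Differentiability of the synthesis at every `x` is weak differentiability of the
coefficients. -/
lemma weak_deriv_vec (hρ : 0 ≤ ρ) (hs : 1 ≤ s) (hf : ∀ t ∈ Icc a b, ∃ C : ℝ≥0, DomAt ρ s (f t) C)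
    (hg : ∀ t ∈ Icc a b, ∃ C : ℝ≥0, DomAt ρ s (g t) C)
    (hd : ∀ t ∈ Icc a b, ∀ x, HasDerivWithinAt (fun τ => synth (f τ) x) (synth (g t) x)
      (Icc a b) t) :
    ∀ h ∈ range fun z : ℂ × ℝ => (memLp_testFun hρ hs z.1 z.2).toLp _, ∀ t ∈ Icc a b,
      HasDerivWithinAt (fun τ => inner ℝ h (vec ρ s (f τ))) (inner ℝ h (vec ρ s (g t)))
        (Icc a b) t := by
  rintro _ ⟨⟨c, x⟩, rfl⟩ t ht
  have h1 : ∀ τ ∈ Icc a b, inner ℝ ((memLp_testFun hρ hs c x).toLp _) (vec ρ s (f τ)) =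
      ((starRingEnd ℂ) c * synth (f τ) x).re := fun τ hτ => by
    obtain ⟨C, hC⟩ := hf τ hτ
    exact hC.inner_testFun_vec hρ hs (by simp) c x
  obtain ⟨C, hC⟩ := hg t ht
  have h2 := Complex.reCLM.hasFDerivAt.comp_hasDerivWithinAt t
    ((hd t ht x).const_mul ((starRingEnd ℂ) c))
  refine (h2.congr h1 (h1 t ht)).congr_deriv ?_
  exact (hC.inner_testFun_vec hρ hs (by simp) c x).symm

lemma DomAt.sub_of_synth_deriv (hρ : 0 ≤ ρ) (hs : 1 ≤ s)
    (hf : ∀ t ∈ Icc a b, ∃ C : ℝ≥0, DomAt ρ s (f t) C)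
    (hg : ∀ t ∈ Icc a b, DomAt ρ s (g t) C)
    (hd : ∀ t ∈ Icc a b, ∀ x, HasDerivWithinAt (fun τ => synth (f τ) x) (synth (g t) x)
      (Icc a b) t) {t t' : ℝ} (ht : t ∈ Icc a b) (ht' : t' ∈ Icc a b) :
    DomAt ρ s (fun ξ => f t' ξ - f t ξ) (ENNReal.ofReal (C * |t' - t|)) := by
  have h1 := norm_sub_le_of_weak_deriv (C := C)
    (fun z hz => eq_zero_of_inner_testFun hρ hs fun c x => hz _ (mem_range_self (c, x)))
    (convex_Icc a b)
    (weak_deriv_vec hρ hs hf (fun t ht => ⟨C, hg t ht⟩) hd) (fun t ht => ?_) ht ht'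
  · obtain ⟨C₁, h2⟩ := hf t ht
    obtain ⟨C₂, h3⟩ := hf t' ht'
    refine (DomAt.sub h3 h2).of_enorm_vec_le (by simp) ?_
    rw [vec_sub h3 (by simp) h2 (by simp), ← ofReal_norm]
    exact ENNReal.ofReal_le_ofReal h1
  · have := (hg t ht).enorm_vec_le
    rwa [enorm_le_coe] at this

/-- If the synthesis is differentiable in time at every `x`, with a derivative that is Lipschitz in
time as a vector, then the coefficients are differentiable in norm. -/
lemma hasDerivWithinAt_vec (hρ : 0 ≤ ρ) (hs : 1 ≤ s)
    (hf : ∀ t ∈ Icc a b, ∃ C : ℝ≥0, DomAt ρ s (f t) C)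
    (hg : ∀ t ∈ Icc a b, ∃ C : ℝ≥0, DomAt ρ s (g t) C)
    (hd : ∀ t ∈ Icc a b, ∀ x, HasDerivWithinAt (fun τ => synth (f τ) x) (synth (g t) x)
      (Icc a b) t)
    (hgc : ∀ t ∈ Icc a b, ∀ t' ∈ Icc a b,
      DomAt ρ s (fun ξ => g t' ξ - g t ξ) (ENNReal.ofReal (C * |t' - t|)))
    {t : ℝ} (ht : t ∈ Icc a b) :
    HasDerivWithinAt (fun τ => vec ρ s (f τ)) (vec ρ s (g t)) (Icc a b) t := by
  refine hasDerivWithinAt_of_weak_deriv (v := fun τ => vec ρ s (g τ))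
    (fun z hz => eq_zero_of_inner_testFun hρ hs fun c x => hz _ (mem_range_self (c, x)))
    (weak_deriv_vec hρ hs hf hg hd) ht ?_
  refine LipschitzOnWith.continuousOn (K := C) ?_ t ht
  refine LipschitzOnWith.of_dist_le_mul fun t' ht' t ht => ?_
  obtain ⟨C₁, h2⟩ := hg t ht
  obtain ⟨C₂, h3⟩ := hg t' ht'
  have h4 := (hgc t ht t' ht').enorm_vec_le
  rw [vec_sub h3 (by simp) h2 (by simp), ← ofReal_norm,
    ENNReal.ofReal_le_ofReal_iff (by positivity)] at h4
  rwa [dist_eq_norm, Real.dist_eq]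

/-- The energy inequality `‖f(t)‖ ≤ ∫ ‖h‖` for `∂ₜf = -iκf - h`, `f(a) = 0`. -/
lemma DomAt.energy {κ : ℝ → ℝ} {h : ℝ → ℝ → ℂ} {B β : ℝ → ℝ}
    (hd : ∀ t ∈ Icc a b, HasDerivWithinAt (fun τ => vec ρ s (f τ))
      (vec ρ s (fun ξ => -(Complex.I * κ ξ * f t ξ) - h t ξ)) (Icc a b) t)
    (hf : ∀ t ∈ Icc a b, ∃ C : ℝ≥0, DomAt ρ s (f t) C)
    (hκ : ∀ t ∈ Icc a b, ∃ C : ℝ≥0, DomAt ρ s (fun ξ => -(Complex.I * κ ξ * f t ξ) - h t ξ) C)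
    (hh : ∀ t ∈ Icc a b, DomAt ρ s (h t) (ENNReal.ofReal (β t)))
    (hβ : ∀ t ∈ Icc a b, 0 ≤ β t) (hB : ∀ t, HasDerivAt B (β t) t) (hBa : 0 ≤ B a)
    (h0 : f a =ᵐ[volume] 0) {t : ℝ} (ht : t ∈ Icc a b) :
    DomAt ρ s (f t) (ENNReal.ofReal (B t)) := by
  have hinner : ∀ t ∈ Icc a b, inner ℝ (vec ρ s (f t))
      (vec ρ s (fun ξ => -(Complex.I * κ ξ * f t ξ) - h t ξ)) ≤ ‖vec ρ s (f t)‖ * β t := by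
    intro t ht
    obtain ⟨C₁, h1⟩ := hf t ht
    obtain ⟨C₂, h2⟩ := hκ t ht
    have h3 := hh t ht
    -- the term `-iκf` is orthogonal to `f` for the real inner product
    have e : inner ℝ (vec ρ s (f t)) (vec ρ s (fun ξ => -(Complex.I * κ ξ * f t ξ) - h t ξ)) =
        inner ℝ (vec ρ s (f t)) (-vec ρ s (h t)) := by
      rw [L2.inner_def, L2.inner_def]
      refine integral_congr_ae ?_
      filter_upwards [h1.coe_vec (by simp), h2.coe_vec (by simp), h3.coe_vec (by simp),
        Lp.coeFn_neg (vec ρ s (h t))] with ξ e1 e2 e3 e4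
      rw [e4, Pi.neg_apply, e1, e2, e3, Complex.inner, Complex.inner]
      simp only [map_mul, Complex.conj_ofReal, Complex.mul_re, Complex.mul_im, Complex.sub_re,
        Complex.sub_im, Complex.neg_re, Complex.neg_im, Complex.conj_re, Complex.conj_im,
        Complex.ofReal_re, Complex.ofReal_im, Complex.I_re, Complex.I_im]
      ring
    rw [e]
    refine (real_inner_le_norm _ _).trans ?_
    rw [norm_neg]
    gcongr
    have := h3.enorm_vec_le
    rwa [← ofReal_norm, ENNReal.ofReal_le_ofReal_iff (hβ t ht)] at this
  have hva : vec ρ s (f a) = 0 := by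
    have : (fun ξ => (wt ρ s ξ : ℂ) * f a ξ) =ᵐ[volume] 0 := by
      filter_upwards [h0] with ξ e
      rw [e]; simp
    rw [vec]
    split_ifs with hm
    · exact Lp.ext ((hm.coeFn_toLp.trans this).trans (Lp.coeFn_zero _ _ _).symm)
    · rfl
  -- the norm is regularized because it is not differentiable at `0`
  have key : ∀ η > 0, ‖vec ρ s (f t)‖ ≤ B t + η := by
    intro η hη
    have hpos : ∀ t, 0 < ‖vec ρ s (f t)‖ ^ 2 + η ^ 2 := fun t => by positivity
    have hle : ∀ t, ‖vec ρ s (f t)‖ ≤ √(‖vec ρ s (f t)‖ ^ 2 + η ^ 2) := fun t =>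
      Real.le_sqrt_of_sq_le (by nlinarith)
    have hdy : ∀ t ∈ Icc a b, HasDerivWithinAt (fun τ => √(‖vec ρ s (f τ)‖ ^ 2 + η ^ 2))
        (2 * inner ℝ (vec ρ s (f t)) (vec ρ s (fun ξ => -(Complex.I * κ ξ * f t ξ) - h t ξ)) /
          (2 * √(‖vec ρ s (f t)‖ ^ 2 + η ^ 2))) (Icc a b) t := fun t ht =>
      ((hd t ht).norm_sq.add_const (η ^ 2)).sqrt (hpos t).ne'
    refine (hle t).trans ?_
    refine image_le_of_deriv_right_le_deriv_boundary (a := a) (b := b)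
      (B := fun τ => B τ + η) (B' := β)
      (fun τ hτ => (hdy τ hτ).continuousWithinAt)
      (fun τ hτ => (hdy τ (Ico_subset_Icc_self hτ)).mono_of_mem_nhdsWithin
        (Icc_mem_nhdsGE_of_mem hτ)) ?_
      (fun τ hτ => ((hB τ).add_const η).continuousAt.continuousWithinAt)
      (fun τ hτ => ((hB τ).add_const η).hasDerivWithinAt) (fun τ hτ => ?_) ht
    · rw [hva]; simp [Real.sqrt_sq hη.le, hBa]
    · have hτ' := Ico_subset_Icc_self hτ
      have h5 : 0 < √(‖vec ρ s (f τ)‖ ^ 2 + η ^ 2) := Real.sqrt_pos.2 (hpos τ)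
      rw [mul_div_mul_left _ _ (by norm_num : (2 : ℝ) ≠ 0), div_le_iff₀ h5, mul_comm (β τ)]
      exact (hinner τ hτ').trans (mul_le_mul_of_nonneg_right (hle τ) (hβ τ hτ'))
  have h6 : ‖vec ρ s (f t)‖ ≤ B t := le_of_forall_pos_le_add key
  obtain ⟨C₁, h1⟩ := hf t ht
  refine h1.of_enorm_vec_le (by simp) ?_
  rw [← ofReal_norm]
  exact ENNReal.ofReal_le_ofReal h6

end Time

/-! ### Uniqueness -/

lemma DomAt.exists_gain {ρ ρ' : ℝ} (h : ρ' < ρ) (s s' : ℝ) (C : ℝ≥0) :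
    ∃ C' : ℝ≥0, ∀ f, DomAt ρ s f C → DomAt ρ' s' f C' := by
  obtain ⟨D, hD⟩ := Dom.exp_gain (sub_pos.2 h) (s' - s)
  refine ⟨D * C, fun f hf => ?_⟩
  have := hD _ (fun _ => ρ') _ _ _ _ (fun _ _ => by simp) hf
  rw [add_sub_cancel] at this
  exact this.mono (by simp)

/-- The loss of one derivative costs the inverse of the loss of analyticity. -/
lemma DomAt.gain_one {ρ δ s : ℝ} {f : ℝ → ℂ} {C : ℝ≥0∞} (hδ : 0 < δ) (h : DomAt (ρ + δ) s f C) :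
    DomAt ρ (s + 1) f (ENNReal.ofReal δ⁻¹ * C) := by
  obtain ⟨hm, K, hK, hKC, hb⟩ := h
  refine ⟨hm, fun ξ => ENNReal.ofReal δ⁻¹ * (br (-1) ξ * K ξ), by fun_prop, ?_, ?_⟩
  · rw [wNorm_const_mul _ (by fun_prop), wNorm_br_mul]
    gcongr
    simpa using hKC
  · filter_upwards [hb] with ξ h t ht
    refine (h t ht).trans ?_
    have hbr := bracket_pos ξ
    have : ex (fun _ => ρ + δ) t ξ ≤ ex (fun _ => ρ) t ξ * (ENNReal.ofReal δ⁻¹ * br (-1) ξ) := by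
      rw [ex, ex, br, ← ENNReal.ofReal_mul (by positivity), ← ENNReal.ofReal_mul (by positivity)]
      refine ENNReal.ofReal_le_ofReal ?_
      rw [add_mul, neg_add, Real.exp_add, Real.rpow_neg_one, ← mul_inv, Real.exp_neg (δ * _)]
      gcongr
      linarith [Real.add_one_le_exp (δ * bracket ξ)]
    calc _ ≤ ex (fun _ => ρ) t ξ * (ENNReal.ofReal δ⁻¹ * br (-1) ξ) * K ξ := by gcongr
      _ = _ := by ring

/-- The right-hand side `-iνξ²f/2 - h`. -/
def rhs (ν : ℝ) (f h : ℝ → ℂ) (ξ : ℝ) : ℂ := -(Complex.I * (ν / 2 * ξ ^ 2 : ℝ) * f ξ) - h ξ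

lemma DomAt.rhs {ρ s ν : ℝ} {f h : ℝ → ℂ} {C C' : ℝ≥0∞} (hf : DomAt ρ (s + 2) f C)
    (hh : DomAt ρ s h C') : DomAt ρ s (rhs ν f h) (‖Complex.I * ν / 2‖ₑ * C + C') := by
  rw [show s + 2 = s + 1 + 1 by ring] at hf
  refine ((hf.mulI.mulI.const_mul (Complex.I * ν / 2)).sub hh).congr (ae_of_all _ fun ξ t _ => ?_)
  rw [mulI_mulI, WKB.rhs]; push_cast; ring

lemma rhs_sub (ν : ℝ) (f h f' h' : ℝ → ℂ) (ξ : ℝ) :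
    rhs ν f h ξ - rhs ν f' h' ξ = rhs ν (fun ξ => f ξ - f' ξ) (fun ξ => h ξ - h' ξ) ξ := by
  simp only [rhs]; ring

/-- Uniform boundedness in all the spaces of weight smaller than `ρ`. -/
def UnifBdd (ρ : ℝ) (S : Set ℝ) (f : ℝ → ℝ → ℂ) : Prop :=
  ∀ ρ', 0 ≤ ρ' → ρ' < ρ → ∀ s, ∃ C : ℝ≥0, ∀ t ∈ S, DomAt ρ' s (f t) C

/-- Lipschitz continuity in time in all the spaces of weight smaller than `ρ`. -/
def UnifLip (ρ : ℝ) (S : Set ℝ) (f : ℝ → ℝ → ℂ) : Prop :=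
  ∀ ρ', 0 ≤ ρ' → ρ' < ρ → ∀ s, ∃ C : ℝ≥0, ∀ t ∈ S, ∀ t' ∈ S,
    DomAt ρ' s (fun ξ => f t' ξ - f t ξ) (ENNReal.ofReal (C * |t' - t|))

/-- `∂ₜu = (iν/2) ∂ₓ²u - v` on `[0, T]`, for the functions `u`, `v` with coefficients `f`, `h`. -/
def Evolves (ν T : ℝ) (f h : ℝ → ℝ → ℂ) : Prop :=
  ∀ t ∈ Icc 0 T, ∀ x, HasDerivWithinAt (fun τ => synth (f τ) x) (synth (rhs ν (f t) (h t)) x)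
    (Icc 0 T) t

section Evolves

variable {ρ ν T : ℝ} {S : Set ℝ} {f h f' h' : ℝ → ℝ → ℂ}

lemma UnifBdd.of_domAt {s : ℝ} {C : ℝ≥0} (hf : ∀ t ∈ S, DomAt ρ s (f t) C) : UnifBdd ρ S f :=
  fun ρ' _ h s' => by
    obtain ⟨C', hC'⟩ := DomAt.exists_gain h s s' C
    exact ⟨C', fun t ht => hC' _ (hf t ht)⟩

lemma UnifBdd.sub (hf : UnifBdd ρ S f) (hf' : UnifBdd ρ S f') :
    UnifBdd ρ S fun t ξ => f t ξ - f' t ξ := fun ρ' h0 h s => by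
  obtain ⟨C, hC⟩ := hf ρ' h0 h s
  obtain ⟨C', hC'⟩ := hf' ρ' h0 h s
  exact ⟨C + C', fun t ht => ((hC t ht).sub (hC' t ht)).mono (by simp)⟩

lemma UnifLip.sub (hf : UnifLip ρ S f) (hf' : UnifLip ρ S f') :
    UnifLip ρ S fun t ξ => f t ξ - f' t ξ := fun ρ' h0 h s => by
  obtain ⟨C, hC⟩ := hf ρ' h0 h s
  obtain ⟨C', hC'⟩ := hf' ρ' h0 h s
  refine ⟨C + C', fun t ht t' ht' => (((hC t ht t' ht').sub (hC' t ht t' ht')).mono ?_).congr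
    (ae_of_all _ fun ξ t _ => by ring)⟩
  rw [← ENNReal.ofReal_add (by positivity) (by positivity)]
  refine le_of_eq ?_
  congr 1
  push_cast; ring

lemma UnifBdd.integrable (hρ : 0 < ρ) (hf : UnifBdd ρ S f) {t : ℝ} (ht : t ∈ S) :
    Integrable (f t) := by
  obtain ⟨C, hC⟩ := hf 0 le_rfl hρ 1
  exact Dom.integrable (hC t ht) (by simp) (by simp) (mem_singleton 0)

lemma UnifBdd.rhs (hf : UnifBdd ρ S f) (hh : UnifBdd ρ S h) :
    UnifBdd ρ S fun t => rhs ν (f t) (h t) := fun ρ' h0 hρ' s => by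
  obtain ⟨C, hC⟩ := hf ρ' h0 hρ' (s + 2)
  obtain ⟨C', hC'⟩ := hh ρ' h0 hρ' s
  exact ⟨‖Complex.I * ν / 2‖₊ * C + C', fun t ht =>
    (DomAt.rhs (hC t ht) (hC' t ht)).mono (by simp [enorm])⟩

lemma UnifLip.rhs (hf : UnifLip ρ S f) (hh : UnifLip ρ S h) :
    UnifLip ρ S fun t => rhs ν (f t) (h t) := fun ρ' h0 hρ' s => by
  obtain ⟨C, hC⟩ := hf ρ' h0 hρ' (s + 2)
  obtain ⟨C', hC'⟩ := hh ρ' h0 hρ' s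
  refine ⟨‖Complex.I * ν / 2‖₊ * C + C', fun t ht t' ht' =>
    ((DomAt.rhs (ν := ν) (hC t ht t' ht') (hC' t ht t' ht')).mono ?_).congr
      (ae_of_all _ fun ξ t _ => (rhs_sub _ _ _ _ _ _).symm)⟩
  rw [← ofReal_norm, ← ENNReal.ofReal_mul (norm_nonneg _),
    ← ENNReal.ofReal_add (by positivity) (by positivity)]
  refine ENNReal.ofReal_le_ofReal (le_of_eq ?_)
  push_cast
  ring

lemma Evolves.sub (hρ : 0 < ρ) (hf : UnifBdd ρ (Icc 0 T) f) (hf' : UnifBdd ρ (Icc 0 T) f')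
    (hh : UnifBdd ρ (Icc 0 T) h) (hh' : UnifBdd ρ (Icc 0 T) h')
    (he : Evolves ν T f h) (he' : Evolves ν T f' h') :
    Evolves ν T (fun t ξ => f t ξ - f' t ξ) (fun t ξ => h t ξ - h' t ξ) := by
  intro t ht x
  have h1 : ∀ τ ∈ Icc 0 T, synth (fun ξ => f τ ξ - f' τ ξ) x = synth (f τ) x - synth (f' τ) x :=
    fun τ hτ => synth_sub (hf.integrable hρ hτ) (hf'.integrable hρ hτ) x
  refine (((he t ht x).sub (he' t ht x)).congr h1 (h1 t ht)).congr_deriv ?_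
  rw [← synth_sub ((hf.rhs hh).integrable hρ ht) ((hf'.rhs hh').integrable hρ ht)]
  simp only [rhs_sub]

/-- A bounded solution is Lipschitz in time in all the spaces, by the mean value inequality. -/
lemma Evolves.unifLip (hf : UnifBdd ρ (Icc 0 T) f) (hh : UnifBdd ρ (Icc 0 T) h)
    (he : Evolves ν T f h) : UnifLip ρ (Icc 0 T) f := fun ρ' h0 hρ' s => by
  obtain ⟨C, hC⟩ := hf.rhs (ν := ν) hh ρ' h0 hρ' (max s 1)
  obtain ⟨C', hC'⟩ := hf ρ' h0 hρ' (max s 1)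
  exact ⟨C, fun t ht t' ht' => (DomAt.sub_of_synth_deriv h0 (le_max_right s 1)
    (fun t ht => ⟨C', hC' t ht⟩) hC he ht ht').mono_exp (le_max_left s 1)⟩

/-- The energy inequality on `[t₀, T]` for a solution that vanishes at `t₀`. -/
lemma Evolves.domAt_le (hf : UnifBdd ρ (Icc 0 T) f) (hh : UnifBdd ρ (Icc 0 T) h)
    (hhl : UnifLip ρ (Icc 0 T) h) (he : Evolves ν T f h) {ρ' s t₀ : ℝ} (h0 : 0 ≤ ρ') (hρ' : ρ' < ρ)
    (hs : 1 ≤ s) (ht₀ : 0 ≤ t₀) {B β : ℝ → ℝ}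
    (hd : ∀ t ∈ Icc t₀ T, DomAt ρ' s (h t) (ENNReal.ofReal (β t)))
    (hβ : ∀ t ∈ Icc t₀ T, 0 ≤ β t) (hB : ∀ t, HasDerivAt B (β t) t) (hBa : 0 ≤ B t₀)
    (hz : f t₀ =ᵐ[volume] 0) {t : ℝ} (ht : t ∈ Icc t₀ T) :
    DomAt ρ' s (f t) (ENNReal.ofReal (B t)) := by
  have hsub : Icc t₀ T ⊆ Icc 0 T := Icc_subset_Icc_left ht₀
  obtain ⟨C, hC⟩ := hf.rhs (ν := ν) hh ρ' h0 hρ' s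
  obtain ⟨C', hC'⟩ := hf ρ' h0 hρ' s
  obtain ⟨L, hL⟩ := (he.unifLip hf hh).rhs (ν := ν) hhl ρ' h0 hρ' s
  refine DomAt.energy (κ := fun ξ => ν / 2 * ξ ^ 2) (h := h) (fun t ht => ?_)
    (fun t ht => ⟨C', hC' t (hsub ht)⟩) (fun t ht => ⟨C, hC t (hsub ht)⟩) hd hβ hB hBa hz ht
  exact (hasDerivWithinAt_vec h0 hs (fun t ht => ⟨C', hC' t ht⟩) (fun t ht => ⟨C, hC t ht⟩) he hL
    (hsub ht)).mono hsub

end Evolves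

section Unique

variable {N : Nonlinearity} {ρ ε T s₀ s : ℝ} {S : Set ℝ} {p q p' q' : ℝ → ℝ → ℂ}
  {Ψ : (ℝ → ℂ) → (ℝ → ℂ) → ℝ → ℂ}

lemma UnifBdd.lipOp (hΨ : ∀ s, 0 ≤ s → LipOp s s Ψ) (hp : UnifBdd ρ S p) (hq : UnifBdd ρ S q) :
    UnifBdd ρ S fun t => Ψ (p t) (q t) := fun ρ' h0 hρ' s => by
  obtain ⟨C, hC⟩ := hp ρ' h0 hρ' (max s 0 + 2)
  obtain ⟨C', hC'⟩ := hq ρ' h0 hρ' (max s 0 + 1)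
  obtain ⟨A, hA⟩ := hΨ (max s 0) (le_max_right _ _) (max C C')
  refine ⟨A, fun t ht => ?_⟩
  have := (hA (fun _ => ρ') {0} (fun _ => p t) (fun _ => q t) _ _ _ (fun _ _ => h0)
    (Close.self ((hC t ht).mono ?_) ((hC' t ht).mono ?_))).1
  · exact this.mono_exp (le_max_left _ _)
  · exact_mod_cast le_max_left C C'
  · exact_mod_cast le_max_right C C'

/-- The nonlinear terms inherit the Lipschitz continuity in time from `p` and `q`. -/
lemma UnifLip.lipOp (hΨ : ∀ s, 0 ≤ s → LipOp s s Ψ) (hp : UnifBdd ρ S p) (hq : UnifBdd ρ S q)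
    (hpl : UnifLip ρ S p) (hql : UnifLip ρ S q) :
    UnifLip ρ S fun t => Ψ (p t) (q t) := fun ρ' h0 hρ' s => by
  obtain ⟨C, hC⟩ := hp ρ' h0 hρ' (max s 0 + 2)
  obtain ⟨C', hC'⟩ := hq ρ' h0 hρ' (max s 0 + 1)
  obtain ⟨L, hL⟩ := hpl ρ' h0 hρ' (max s 0 + 2)
  obtain ⟨L', hL'⟩ := hql ρ' h0 hρ' (max s 0 + 1)
  obtain ⟨A, hA⟩ := hΨ (max s 0) (le_max_right _ _) (max C C')
  refine ⟨A * max L L', fun t ht t' ht' => ?_⟩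
  have m1 : (C : ℝ≥0∞) ≤ (max C C' : ℝ≥0) := by exact_mod_cast le_max_left C C'
  have m2 : (C' : ℝ≥0∞) ≤ (max C C' : ℝ≥0) := by exact_mod_cast le_max_right C C'
  have := (hA (fun _ => ρ') {0} (fun _ => p t') (fun _ => q t') (fun _ => p t) (fun _ => q t)
    (ENNReal.ofReal ((max L L' : ℝ≥0) * |t' - t|)) (fun _ _ => h0)
    ⟨(hC t' ht').mono m1, (hC' t' ht').mono m2, (hC t ht).mono m1, (hC' t ht).mono m2,
      (hL t ht t' ht').mono ?_, (hL' t ht t' ht').mono ?_⟩).2.2.1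
  · refine (this.mono_exp (le_max_left s 0)).mono (le_of_eq ?_)
    rw [← ENNReal.ofReal_coe_nnreal, ← ENNReal.ofReal_mul A.coe_nonneg]
    congr 1
    push_cast; ring
  · refine ENNReal.ofReal_le_ofReal (mul_le_mul_of_nonneg_right ?_ (abs_nonneg _))
    exact_mod_cast le_max_left L L'
  · refine ENNReal.ofReal_le_ofReal (mul_le_mul_of_nonneg_right ?_ (abs_nonneg _))
    exact_mod_cast le_max_right L L'

/-- The Fourier coefficients of a solution, bounded in a fixed space of analytic functions. -/
structure CoefSol (N : Nonlinearity) (ε ρ T : ℝ) (p q : ℝ → ℝ → ℂ) : Prop where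
  bdd_p : UnifBdd ρ (Icc 0 T) p
  bdd_q : UnifBdd ρ (Icc 0 T) q
  evolves_p : Evolves 0 T p fun t => phaseOp N (p t) (q t)
  evolves_q : Evolves ε T q fun t => ampOp N (p t) (q t)

lemma LipOp.phaseOp_self (N : Nonlinearity) : ∀ s, 0 ≤ s → LipOp s s (WKB.phaseOp N) :=
  fun _ hs => (LipOp.phaseOp hs N).mono_exp (by linarith)

lemma LipOp.ampOp_self (N : Nonlinearity) : ∀ s, 0 ≤ s → LipOp s s (WKB.ampOp N) :=
  fun _ hs => LipOp.ampOp hs N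

namespace CoefSol

variable (h : CoefSol N ε ρ T p q)
include h

lemma bdd_phase : UnifBdd ρ (Icc 0 T) fun t => phaseOp N (p t) (q t) :=
  .lipOp (LipOp.phaseOp_self N) h.bdd_p h.bdd_q

lemma bdd_amp : UnifBdd ρ (Icc 0 T) fun t => ampOp N (p t) (q t) :=
  .lipOp (LipOp.ampOp_self N) h.bdd_p h.bdd_q

lemma lip_p : UnifLip ρ (Icc 0 T) p := h.evolves_p.unifLip h.bdd_p h.bdd_phase

lemma lip_q : UnifLip ρ (Icc 0 T) q := h.evolves_q.unifLip h.bdd_q h.bdd_amp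

lemma lip_phase : UnifLip ρ (Icc 0 T) fun t => phaseOp N (p t) (q t) :=
  .lipOp (LipOp.phaseOp_self N) h.bdd_p h.bdd_q h.lip_p h.lip_q

lemma lip_amp : UnifLip ρ (Icc 0 T) fun t => ampOp N (p t) (q t) :=
  .lipOp (LipOp.ampOp_self N) h.bdd_p h.bdd_q h.lip_p h.lip_q

end CoefSol

/-- The bound of order `k + 1` is a primitive of `c` times the bound of order `k`. -/
lemma hasDerivAt_pow_div_factorial (b c t₀ t : ℝ) (k : ℕ) :
    HasDerivAt (fun t => b * (c * (t - t₀)) ^ (k + 1) / (k + 1).factorial)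
      (c * (b * (c * (t - t₀)) ^ k / k.factorial)) t := by
  have h1 : HasDerivAt (fun t => c * (t - t₀)) c t := by
    simpa using ((hasDerivAt_id t).sub_const t₀).const_mul c
  have h2 := ((h1.pow (k + 1)).const_mul b).div_const ((k + 1).factorial : ℝ)
  refine h2.congr_deriv ?_
  have h3 : (k.factorial : ℝ) ≠ 0 := by positivity
  rw [Nat.factorial_succ]
  push_cast
  have h4 : (k : ℝ) + 1 ≠ 0 := by positivity
  field_simp

/-- Two solutions that coincide at time `t₀` coincide on an interval whose length is independent of
`t₀`. The difference is estimated in `n` spaces whose weights decrease from `ρ/2` to `0`, as in the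
abstract Cauchy-Kovalevskaya theorem: the bound `b (c n (t - t₀))ⁿ / n!` so obtained tends
to `0`. -/
lemma CoefSol.exists_unique_step (hρ : 0 < ρ) (h : CoefSol N ε ρ T p q)
    (h' : CoefSol N ε ρ T p' q') : ∃ τ > 0, ∀ t₀, 0 ≤ t₀ → p t₀ =ᵐ[volume] p' t₀ →
      q t₀ =ᵐ[volume] q' t₀ → ∀ t ∈ Icc t₀ T, t ≤ t₀ + τ →
        p t =ᵐ[volume] p' t ∧ q t =ᵐ[volume] q' t := by
  have hρ2 : ρ / 2 < ρ := by linarith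
  obtain ⟨C₁, h1⟩ := h.bdd_p (ρ / 2) (by linarith) hρ2 (0 + 2)
  obtain ⟨C₂, h2⟩ := h.bdd_q (ρ / 2) (by linarith) hρ2 (0 + 1)
  obtain ⟨C₃, h3⟩ := h'.bdd_p (ρ / 2) (by linarith) hρ2 (0 + 2)
  obtain ⟨C₄, h4⟩ := h'.bdd_q (ρ / 2) (by linarith) hρ2 (0 + 1)
  set R : ℝ≥0 := C₁ + C₂ + C₃ + C₄ with hR
  have r1 : (C₁ : ℝ≥0∞) ≤ R := by
    exact_mod_cast (le_self_add.trans le_self_add).trans (le_self_add (a := C₁ + C₂ + C₃))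
  have r2 : (C₂ : ℝ≥0∞) ≤ R := by
    exact_mod_cast ((le_add_self (a := C₂)).trans le_self_add).trans
      (le_self_add (a := C₁ + C₂ + C₃))
  have r3 : (C₃ : ℝ≥0∞) ≤ R := by
    exact_mod_cast (le_add_self (a := C₃)).trans (le_self_add (a := C₁ + C₂ + C₃))
  have r4 : (C₄ : ℝ≥0∞) ≤ R := by exact_mod_cast le_add_self (a := C₄)
  obtain ⟨A₁, hA₁⟩ := LipOp.phaseOp (le_refl (0 : ℝ)) N R
  obtain ⟨A₂, hA₂⟩ := LipOp.ampOp (le_refl (0 : ℝ)) N R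
  set A : ℝ≥0 := max A₁ A₂ + 1 with hA
  have a1 : (A₁ : ℝ≥0∞) ≤ A := by exact_mod_cast (le_max_left A₁ A₂).trans le_self_add
  have a2 : (A₂ : ℝ≥0∞) ≤ A := by exact_mod_cast (le_max_right A₁ A₂).trans le_self_add
  have hA0 : (0 : ℝ) < A := by rw [hA]; push_cast; positivity
  have hep := h.evolves_p.sub hρ h.bdd_p h'.bdd_p h.bdd_phase h'.bdd_phase h'.evolves_p
  have heq := h.evolves_q.sub hρ h.bdd_q h'.bdd_q h.bdd_amp h'.bdd_amp h'.evolves_q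
  -- this length makes the geometric ratio in `hbound` at most `1/2`, by `nⁿ / n! ≤ eⁿ`
  refine ⟨ρ / 2 / (2 * Real.exp 1 * A), by positivity, fun t₀ ht₀ hp0 hq0 t ht htτ => ?_⟩
  have key : ∀ n : ℕ, 0 < n → ∀ k ≤ n, ∀ t ∈ Icc t₀ T,
      DomAt (ρ / 2 - k * (ρ / 2 / n)) (0 + 2) (fun ξ => p t ξ - p' t ξ)
        (ENNReal.ofReal (2 * R * (A / (ρ / 2 / n) * (t - t₀)) ^ k / k.factorial)) ∧
      DomAt (ρ / 2 - k * (ρ / 2 / n)) (0 + 1) (fun ξ => q t ξ - q' t ξ)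
        (ENNReal.ofReal (2 * R * (A / (ρ / 2 / n) * (t - t₀)) ^ k / k.factorial)) := by
    intro n hn k
    have hn' : (0 : ℝ) < n := by exact_mod_cast hn
    set δ : ℝ := ρ / 2 / n with hδ
    have hδ0 : 0 < δ := by positivity
    induction k with
    | zero =>
      intro _ t ht
      have ht' : t ∈ Icc 0 T := ⟨ht₀.trans ht.1, ht.2⟩
      have e : ENNReal.ofReal (2 * R * (A / δ * (t - t₀)) ^ 0 / (Nat.factorial 0 : ℝ)) =
          (R : ℝ≥0∞) + R := by
        simp [two_mul, ENNReal.ofReal_add]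
      rw [e, Nat.cast_zero, zero_mul, sub_zero]
      exact ⟨((h1 t ht').sub (h3 t ht')).mono (add_le_add r1 r3),
        ((h2 t ht').sub (h4 t ht')).mono (add_le_add r2 r4)⟩
    | succ k ih =>
      intro hk t ht
      have ih := ih (by omega)
      set ρk : ℝ := ρ / 2 - k * δ with hρk
      have hk' : ((k : ℝ) + 1) * δ ≤ ρ / 2 := by
        have : ((k : ℝ) + 1) ≤ n := by exact_mod_cast hk
        calc _ ≤ n * δ := by gcongr
          _ = ρ / 2 := by rw [hδ]; field_simp
      have hρk1 : ρ / 2 - (k + 1 : ℕ) * δ = ρk - δ := by rw [hρk]; push_cast; ring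
      have hρk0 : 0 ≤ ρk - δ := by rw [hρk]; linarith
      have hle : ρk ≤ ρ / 2 := by
        rw [hρk]; have : 0 ≤ k * δ := by positivity
        linarith
      rw [hρk1]
      set b : ℝ → ℝ := fun t => 2 * R * (A / δ * (t - t₀)) ^ k / k.factorial with hb
      have hb0 : ∀ t ∈ Icc t₀ T, 0 ≤ b t := fun t ht => by
        have := sub_nonneg.2 ht.1
        positivity
      have hclose : ∀ t ∈ Icc t₀ T, Close (fun _ => ρk) {0} 0 (fun _ => p t) (fun _ => q t)
          (fun _ => p' t) (fun _ => q' t) R (ENNReal.ofReal (b t)) := fun t ht => by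
        have ht' : t ∈ Icc 0 T := ⟨ht₀.trans ht.1, ht.2⟩
        exact ⟨((h1 t ht').mono r1).mono_weight fun _ _ => hle,
          ((h2 t ht').mono r2).mono_weight fun _ _ => hle,
          ((h3 t ht').mono r3).mono_weight fun _ _ => hle,
          ((h4 t ht').mono r4).mono_weight fun _ _ => hle, (ih t ht).1, (ih t ht).2⟩
      have hC : ∀ t, ENNReal.ofReal δ⁻¹ * (A * ENNReal.ofReal (b t)) =
          ENNReal.ofReal (A / δ * b t) := fun t => by
        rw [← ENNReal.ofReal_coe_nnreal, ← ENNReal.ofReal_mul A.coe_nonneg,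
          ← ENNReal.ofReal_mul (by positivity)]
        congr 1; ring
      have hω : ∀ t ∈ ({0} : Set ℝ), 0 ≤ (fun _ => ρk) t := fun _ _ => by
        show 0 ≤ ρk
        linarith
      -- the derivative lost in the nonlinear terms is recovered by giving up the weight `δ`
      have dphase : ∀ t ∈ Icc t₀ T, DomAt (ρk - δ) (0 + 2)
          (fun ξ => phaseOp N (p t) (q t) ξ - phaseOp N (p' t) (q' t) ξ)
          (ENNReal.ofReal (A / δ * b t)) := fun t ht => by
        have := (hA₁ _ _ _ _ _ _ _ hω (hclose t ht)).2.2.1.mono (mul_le_mul_left a1 _)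
        have := DomAt.gain_one (ρ := ρk - δ) hδ0 (by rwa [sub_add_cancel])
        rw [hC] at this
        convert this using 1
        norm_num
      have damp : ∀ t ∈ Icc t₀ T, DomAt (ρk - δ) (0 + 1)
          (fun ξ => ampOp N (p t) (q t) ξ - ampOp N (p' t) (q' t) ξ)
          (ENNReal.ofReal (A / δ * b t)) := fun t ht => by
        have := (hA₂ _ _ _ _ _ _ _ hω (hclose t ht)).2.2.1.mono (mul_le_mul_left a2 _)
        have := DomAt.gain_one (ρ := ρk - δ) hδ0 (by rwa [sub_add_cancel])
        rwa [hC] at this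
      have hβ0 : ∀ t ∈ Icc t₀ T, 0 ≤ A / δ * b t := fun t ht =>
        mul_nonneg (by positivity) (hb0 t ht)
      have hB := fun t => hasDerivAt_pow_div_factorial (2 * R) (A / δ) t₀ t k
      constructor
      · exact hep.domAt_le (h.bdd_p.sub h'.bdd_p) (h.bdd_phase.sub h'.bdd_phase)
          (h.lip_phase.sub h'.lip_phase) hρk0 (by linarith) (by norm_num) ht₀ dphase hβ0 hB
          (by simp) (by filter_upwards [hp0] with ξ e; simp [e]) ht
      · exact heq.domAt_le (h.bdd_q.sub h'.bdd_q) (h.bdd_amp.sub h'.bdd_amp)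
          (h.lip_amp.sub h'.lip_amp) hρk0 (by linarith) (by norm_num) ht₀ damp hβ0 hB
          (by simp) (by filter_upwards [hq0] with ξ e; simp [e]) ht
  have hbound : ∀ n : ℕ, 0 < n → 2 * R * (A / (ρ / 2 / n) * (t - t₀)) ^ n / n.factorial ≤
      2 * R * (1 / 2) ^ n := by
    intro n hn
    have hn' : (0 : ℝ) < n := by exact_mod_cast hn
    have e1 : Real.exp 1 ^ n = Real.exp n := by rw [← Real.exp_nat_mul]; simp
    have h5 := Real.pow_div_factorial_le_exp (n : ℝ) hn'.le n
    have h6 : A / (ρ / 2) * (t - t₀) ≤ (2 * Real.exp 1)⁻¹ := by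
      have : t - t₀ ≤ ρ / 2 / (2 * Real.exp 1 * A) := by linarith
      calc _ ≤ A / (ρ / 2) * (ρ / 2 / (2 * Real.exp 1 * A)) := by gcongr
        _ = _ := by field_simp
    have h7 : 0 ≤ A / (ρ / 2) * (t - t₀) := mul_nonneg (by positivity) (sub_nonneg.2 ht.1)
    calc _ = 2 * R * ((A / (ρ / 2) * (t - t₀)) ^ n * ((n : ℝ) ^ n / n.factorial)) := by
          rw [show A / (ρ / 2 / n) * (t - t₀) = A / (ρ / 2) * (t - t₀) * n by field_simp]
          rw [mul_pow]; ring
      _ ≤ 2 * R * ((2 * Real.exp 1)⁻¹ ^ n * Real.exp n) := by gcongr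
      _ = _ := by
        rw [← e1, ← mul_pow]
        congr 2
        have := Real.exp_pos 1
        field_simp
  have hlim : Tendsto (fun n : ℕ => ENNReal.ofReal (2 * R * (1 / 2) ^ (n + 1))) atTop (𝓝 0) := by
    have h8 : Tendsto (fun n : ℕ => 2 * (R : ℝ) * (1 / 2 : ℝ) ^ (n + 1)) atTop (𝓝 0) := by
      have := ((tendsto_pow_atTop_nhds_zero_of_lt_one (r := (1 / 2 : ℝ)) (by norm_num)
        (by norm_num)).comp (tendsto_add_atTop_nat 1)).const_mul (2 * (R : ℝ))
      simpa using this
    simpa using ENNReal.tendsto_ofReal h8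
  have hzero : ∀ n : ℕ, ρ / 2 - (n + 1 : ℕ) * (ρ / 2 / (n + 1 : ℕ)) = 0 := fun n => by
    have : ((n + 1 : ℕ) : ℝ) ≠ 0 := by positivity
    field_simp
    simp
  constructor
  · have := Dom.ae_eq_zero (ω := fun _ => 0) (S := {0}) (s := 0 + 2)
      (f := fun _ ξ => p t ξ - p' t ξ) hlim fun n => by
        have := (key (n + 1) n.succ_pos (n + 1) le_rfl t ht).1
        rw [hzero] at this
        exact this.mono (ENNReal.ofReal_le_ofReal (hbound (n + 1) n.succ_pos))
    filter_upwards [this] with ξ e using sub_eq_zero.1 (e 0 rfl)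
  · have := Dom.ae_eq_zero (ω := fun _ => 0) (S := {0}) (s := 0 + 1)
      (f := fun _ ξ => q t ξ - q' t ξ) hlim fun n => by
        have := (key (n + 1) n.succ_pos (n + 1) le_rfl t ht).2
        rw [hzero] at this
        exact this.mono (ENNReal.ofReal_le_ofReal (hbound (n + 1) n.succ_pos))
    filter_upwards [this] with ξ e using sub_eq_zero.1 (e 0 rfl)

/-- Uniqueness on the whole interval, by steps of constant length. -/
theorem CoefSol.unique (hρ : 0 < ρ) (h : CoefSol N ε ρ T p q) (h' : CoefSol N ε ρ T p' q')
    (hp : p 0 =ᵐ[volume] p' 0) (hq : q 0 =ᵐ[volume] q' 0) :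
    ∀ t ∈ Icc 0 T, p t =ᵐ[volume] p' t ∧ q t =ᵐ[volume] q' t := by
  obtain ⟨τ, hτ, H⟩ := h.exists_unique_step hρ h'
  have key : ∀ n : ℕ, ∀ t ∈ Icc 0 T, t ≤ n * τ → p t =ᵐ[volume] p' t ∧ q t =ᵐ[volume] q' t := by
    intro n
    induction n with
    | zero =>
      intro t ht htn
      have : t = 0 := le_antisymm (by simpa using htn) ht.1
      rw [this]
      exact ⟨hp, hq⟩
    | succ n ih =>
      intro t ht htn
      rcases le_total t (n * τ) with h1 | h1
      · exact ih t ht h1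
      · have h2 : (n : ℝ) * τ ∈ Icc 0 T := ⟨by positivity, h1.trans ht.2⟩
        obtain ⟨e1, e2⟩ := ih _ h2 le_rfl
        refine H _ h2.1 e1 e2 t ⟨h1, ht.2⟩ ?_
        push_cast at htn
        linarith
  intro t ht
  obtain ⟨n, hn⟩ := exists_nat_ge (t / τ)
  exact key n t ht ((div_le_iff₀ hτ).1 hn)

end Unique

/-! ### The Fourier coefficients of a solution -/

section

variable {w₀ M T ℓ : ℝ}

/-- The norm is locally bounded along a curve that is continuous in the sense of `MemCH`. -/
lemma hNorm_sq_le_of_sub {w v ℓ : ℝ} {ψ χ : ℝ → ℂ} (hψ : MemLp ψ 2 volume)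
    (hχ : MemLp χ 2 volume) : hNorm w ℓ ψ ^ 2 ≤ 2 * (∫⁻ ξ : ℝ, ENNReal.ofReal (bracket ξ ^ (2 * ℓ) *
      ‖(Real.exp (w * bracket ξ) : ℂ) * fourierL2 ψ ξ
        - (Real.exp (v * bracket ξ) : ℂ) * fourierL2 χ ξ‖ ^ 2)) + 2 * hNorm v ℓ χ ^ 2 := by
  have e : ∀ {w : ℝ} {ψ : ℝ → ℂ}, MemLp ψ 2 volume → hNorm w ℓ ψ ^ 2 = ∫⁻ ξ : ℝ,
      ENNReal.ofReal (bracket ξ ^ (2 * ℓ) * ‖(Real.exp (w * bracket ξ) : ℂ) * fourierL2 ψ ξ‖ ^ 2) :=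
    fun {w ψ} hψ => by
      rw [hNorm, if_pos hψ, ← ENNReal.rpow_natCast, ← ENNReal.rpow_mul]
      norm_num
      refine lintegral_congr fun ξ => ?_
      congr 1
      rw [Complex.norm_exp, mul_pow, ← Real.exp_nat_mul, ← mul_assoc]
      congr 3
      simp; ring
  have hm : ∀ (w : ℝ) (ψ : ℝ → ℂ), Measurable fun ξ : ℝ => ENNReal.ofReal (bracket ξ ^ (2 * ℓ) *
      ‖(Real.exp (w * bracket ξ) : ℂ) * fourierL2 ψ ξ‖ ^ 2) := fun w ψ =>
    ((measurable_bracket.pow_const _).mul (((Complex.measurable_ofReal.comp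
      (measurable_bracket.const_mul w).exp).mul (measurable_fourierL2 ψ)).norm.pow_const 2)
      ).ennreal_ofReal
  rw [e hψ, e hχ, ← lintegral_const_mul _ (hm v χ), ← lintegral_const_mul' _ _ (by norm_num),
    ← lintegral_add_right _ ((hm v χ).const_mul 2)]
  refine lintegral_mono fun ξ => ?_
  set A := (Real.exp (w * bracket ξ) : ℂ) * fourierL2 ψ ξ
  set B := (Real.exp (v * bracket ξ) : ℂ) * fourierL2 χ ξ
  have hb := Real.rpow_nonneg (bracket_pos ξ).le (2 * ℓ)
  rw [← ENNReal.ofReal_ofNat, ← ENNReal.ofReal_mul (by norm_num),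
    ← ENNReal.ofReal_mul (by norm_num),
    ← ENNReal.ofReal_add (by positivity) (by positivity)]
  refine ENNReal.ofReal_le_ofReal ?_
  have h1 : ‖A‖ ≤ ‖A - B‖ + ‖B‖ := by simpa using norm_add_le (A - B) B
  have h2 : ‖A‖ ^ 2 ≤ 2 * ‖A - B‖ ^ 2 + 2 * ‖B‖ ^ 2 := by
    nlinarith [norm_nonneg A, norm_nonneg B, norm_nonneg (A - B), sq_nonneg (‖A - B‖ - ‖B‖)]
  nlinarith

/-- Continuity on the compact interval `[0, T]` gives a uniform bound. -/
lemma MemCH.exists_bound {w : ℝ → ℝ} {ψ : ℝ → ℝ → ℂ} (h : MemCH w T ℓ ψ) :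
    ∃ C : ℝ≥0, ∀ t ∈ Icc 0 T, hNorm (w t) ℓ (ψ t) ^ 2 ≤ C := by
  have hcompact := isCompact_Icc (a := (0 : ℝ)) (b := T)
  refine hcompact.induction_on (p := fun K => ∃ C : ℝ≥0, ∀ t ∈ K, hNorm (w t) ℓ (ψ t) ^ 2 ≤ C)
    ⟨0, by simp⟩ (fun K L hKL ⟨C, hC⟩ => ⟨C, fun t ht => hC t (hKL ht)⟩)
    (fun K L ⟨C, hC⟩ ⟨D, hD⟩ => ⟨max C D, fun t ht => ?_⟩) fun t ht => ?_
  · rcases ht with ht | ht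
    · exact (hC t ht).trans (by exact_mod_cast le_max_left C D)
    · exact (hD t ht).trans (by exact_mod_cast le_max_right C D)
  · have h1 := h.1 t ht
    have h2 := (h.2 t ht).eventually_le_const (zero_lt_one (α := ℝ≥0∞))
    have h3 : 2 * 1 + 2 * hNorm (w t) ℓ (ψ t) ^ 2 ≠ ∞ :=
      ENNReal.add_ne_top.2 ⟨by norm_num, ENNReal.mul_ne_top (by norm_num)
        (ENNReal.pow_ne_top h1.ne)⟩
    refine ⟨_, (eventually_mem_set.1 (h2.and self_mem_nhdsWithin)),
      (2 * 1 + 2 * hNorm (w t) ℓ (ψ t) ^ 2).toNNReal, fun s hs => ?_⟩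
    rw [ENNReal.coe_toNNReal h3]
    refine (hNorm_sq_le_of_sub (v := w t) (χ := ψ t) (h.1 s hs.2).memLp h1.memLp).trans ?_
    gcongr
    exact hs.1

lemma weight_pos (hM : 0 < M) (hT : T < w₀ / M) : 0 < weight w₀ M T := by
  rw [lt_div_iff₀ hM] at hT
  rw [weight]; linarith

/-- On `[0, T]` the weight is at least its final value, which is positive. -/
lemma MemCH.unifBdd {ψ : ℝ → ℝ → ℂ} (hM : 0 < M) (h : MemCH (weight w₀ M) T ℓ ψ) :
    UnifBdd (weight w₀ M T) (Icc 0 T) fun t => coef (ψ t) := by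
  obtain ⟨C, hC⟩ := h.exists_bound
  refine UnifBdd.of_domAt (s := ℓ) (C := C + 1) fun t ht => ?_
  have h1 : DomAt (weight w₀ M t) ℓ (coef (ψ t)) _ :=
    dom_coef (h.1 t ht).memLp (ω := fun _ => weight w₀ M t) (t := 0) rfl
  refine (h1.mono ?_).mono_weight fun _ _ => ?_
  · have h2 : hNorm (weight w₀ M t) ℓ (ψ t) ^ 2 ≤ ((C + 1 : ℝ≥0) : ℝ≥0∞) ^ 2 := by
      refine (hC t ht).trans ?_
      have : C ≤ (C + 1) ^ 2 := by nlinarith [zero_le (a := C)]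
      exact_mod_cast this
    exact (ENNReal.pow_le_pow_left_iff (by norm_num)).1 h2
  · simp only [weight]
    nlinarith [ht.2]

lemma MemCH.synth_coef_eq {ψ : ℝ → ℝ → ℂ} (hM : 0 < M) (hT : T < w₀ / M)
    (h : MemCH (weight w₀ M) T ℓ ψ) {t : ℝ} (ht : t ∈ Icc 0 T) (hc : Continuous (ψ t)) :
    RapidDecay (coef (ψ t)) ∧ synth (coef (ψ t)) = ψ t := by
  have hpos : 0 < weight w₀ M t := (weight_pos hM hT).trans_le (by
    simp only [weight]; nlinarith [ht.2])
  have hn := MemH.rapidDecay_coef hpos (h.1 t ht)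
  refine ⟨hn, ?_⟩
  exact ((Continuous.ae_eq_iff_eq volume hc (continuous_synth hn.integrable)).1
    (synth_coef (h.1 t ht).memLp hn)).symm

lemma deriv_ofReal {f : ℝ → ℝ} (hf : Differentiable ℝ f) :
    deriv (fun x => (f x : ℂ)) = fun x => ((deriv f x : ℝ) : ℂ) := by
  ext x
  exact (hf x).hasDerivAt.ofReal_comp.deriv

/-- The Fourier coefficients of a solution in `X_{w,T}^ℓ`. -/
lemma IsSolution.coefSol {N : Nonlinearity} {ε : ℝ} {φ₀ : ℝ → ℝ} {a₀ : ℝ → ℂ} {ψ : ℝ → ℝ → ℝ}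
    {b : ℝ → ℝ → ℂ} (hM : 0 < M) (hT : T < w₀ / M) (hX : MemX (weight w₀ M) T ℓ ψ b)
    (h : IsSolution N ε T φ₀ a₀ ψ b) :
    CoefSol N ε (weight w₀ M T) T (fun t => coef fun x => (ψ t x : ℂ)) fun t => coef (b t) := by
  have hP : ∀ t ∈ Icc 0 T, RapidDecay (coef fun x => (ψ t x : ℂ)) ∧
      synth (coef fun x => (ψ t x : ℂ)) = fun x => (ψ t x : ℂ) := fun t ht =>
    hX.1.1.synth_coef_eq hM hT ht
      (Complex.continuous_ofReal.comp (h.contDiff_phase t ht).continuous)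
  have hQ : ∀ t ∈ Icc 0 T, RapidDecay (coef (b t)) ∧ synth (coef (b t)) = b t := fun t ht =>
    hX.2.1.synth_coef_eq hM hT ht (h.contDiff_amplitude t ht).continuous
  have hd1 : ∀ t ∈ Icc 0 T, synth (mulI (coef fun x => (ψ t x : ℂ))) =
      fun x => ((deriv (ψ t) x : ℝ) : ℂ) := fun t ht => by
    rw [← (hP t ht).1.deriv_synth, (hP t ht).2]
    exact deriv_ofReal ((h.contDiff_phase t ht).differentiable (by norm_num))
  have hd2 : ∀ t ∈ Icc 0 T, synth (mulI (mulI (coef fun x => (ψ t x : ℂ)))) =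
      fun x => ((deriv (deriv (ψ t)) x : ℝ) : ℂ) := fun t ht => by
    rw [← (hP t ht).1.mulI.deriv_synth, hd1 t ht]
    refine deriv_ofReal ?_
    exact ((contDiff_succ_iff_deriv (n := 1)).1 (h.contDiff_phase t ht)).2.2.differentiable
      (by norm_num)
  refine ⟨hX.1.1.unifBdd hM, hX.2.1.unifBdd hM, fun t ht x => ?_, fun t ht x => ?_⟩
  · obtain ⟨φ', h1, h2⟩ := h.phase_eq t ht x
    have h3 := h1.ofReal_comp
    refine (h3.congr (fun τ hτ => congrFun (hP τ hτ).2 x) (congrFun (hP t ht).2 x)).congr_deriv ?_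
    have e : rhs 0 (coef fun x => (ψ t x : ℂ)) (phaseOp N (coef fun x => (ψ t x : ℂ)) (coef (b t)))
        = fun ξ => -1 * phaseOp N (coef fun x => (ψ t x : ℂ)) (coef (b t)) ξ := by
      ext ξ; simp [rhs]
    rw [e, synth_const_mul, synth_phaseOp (hP t ht).1 (hQ t ht).1, hd1 t ht, (hQ t ht).2]
    have h4 : φ' = -(1 / 2 * deriv (ψ t) x ^ 2 + 1 / 2 * N.g (‖b t x‖ ^ 2) * deriv (ψ t) x
      + N.f (‖b t x‖ ^ 2)) := by linear_combination h2
    rw [h4]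
    push_cast
    ring
  · obtain ⟨a', h1, h2⟩ := h.amplitude_eq t ht x
    refine (h1.congr (fun τ hτ => congrFun (hQ τ hτ).2 x) (congrFun (hQ t ht).2 x)).congr_deriv ?_
    have e : rhs ε (coef (b t)) (ampOp N (coef fun x => (ψ t x : ℂ)) (coef (b t))) =
        fun ξ => -(Complex.I * (ε / 2 * ξ ^ 2 : ℝ) * coef (b t) ξ) +
          (0 - ampOp N (coef fun x => (ψ t x : ℂ)) (coef (b t)) ξ) := by
      ext ξ; simp only [rhs]; ring
    rw [e, synth_amp_rhs (p := fun t => coef fun x => (ψ t x : ℂ)) (q := fun t => coef (b t))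
      (hP t ht).1 (hQ t ht).1, synth_ampOp (hP t ht).1 (hQ t ht).1, hd1 t ht, hd2 t ht,
      (hQ t ht).2]
    linear_combination h2

/-- Uniqueness of the solution in `X_{w,T}^ℓ`. -/
lemma IsSolution.unique {N : Nonlinearity} {ε : ℝ} {φ₀ : ℝ → ℝ} {a₀ : ℝ → ℂ} {φ ψ : ℝ → ℝ → ℝ}
    {a b : ℝ → ℝ → ℂ} (hM : 0 < M) (hT : T < w₀ / M)
    (hX : MemX (weight w₀ M) T ℓ φ a) (h : IsSolution N ε T φ₀ a₀ φ a)
    (hX' : MemX (weight w₀ M) T ℓ ψ b) (h' : IsSolution N ε T φ₀ a₀ ψ b) :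
    ∀ t ∈ Icc 0 T, ψ t = φ t ∧ b t = a t := by
  intro t ht
  have hT0 : (0 : ℝ) ∈ Icc 0 T := ⟨le_rfl, ht.1.trans ht.2⟩
  -- the data are attained almost everywhere, which determines the coefficients at time `0`
  have hini : ∀ {f g : ℝ → ℂ}, MemLp f 2 volume → f =ᵐ[volume] g → coef f =ᵐ[volume] coef g := by
    intro f g hf hfg
    have hg := (memLp_congr_ae hfg).1 hf
    have e : hf.toLp f = hg.toLp g := MemLp.toLp_eq_toLp_iff hf hg |>.2 hfg
    refine Eventually.of_forall fun ξ => ?_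
    simp only [coef, fourierL2]
    rw [dif_pos hf, dif_pos hg, e]
  obtain ⟨e1, e2⟩ := (h'.coefSol hM hT hX').unique (weight_pos hM hT) (h.coefSol hM hT hX)
    (hini (hX'.1.1.1 0 hT0).memLp (by
      filter_upwards [h.phase_init, h'.phase_init] with x k1 k2
      rw [k1, k2]))
    (hini (hX'.2.1.1 0 hT0).memLp (h'.amplitude_init.trans h.amplitude_init.symm)) t ht
  constructor
  · have k1 := (hX.1.1.synth_coef_eq hM hT ht
      (Complex.continuous_ofReal.comp (h.contDiff_phase t ht).continuous)).2
    have k2 := (hX'.1.1.synth_coef_eq hM hT ht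
      (Complex.continuous_ofReal.comp (h'.contDiff_phase t ht).continuous)).2
    rw [synth_congr_ae e1, k1] at k2
    ext x
    exact_mod_cast (congrFun k2 x).symm
  · have k1 := (hX.2.1.synth_coef_eq hM hT ht (h.contDiff_amplitude t ht).continuous).2
    have k2 := (hX'.2.1.synth_coef_eq hM hT ht (h'.contDiff_amplitude t ht).continuous).2
    rw [synth_congr_ae e2, k1] at k2
    exact k2.symm

end

/-! ### Existence of solutions and the error estimate -/

/-- Well-posedness in `X_{w,T}^ℓ` for `M` large, with a bound that depends only on the size of the
data. On the Fourier side the weight `w₀ - (M/2) t` is used, which decreases more slowly. -/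
lemma exists_solution (N : Nonlinearity) {ℓ : ℝ} (hℓ : 1 ≤ ℓ) (R₀ : ℝ≥0) :
    ∃ M₁ : ℝ, 0 < M₁ ∧ ∃ R : ℝ≥0, ∀ (w₀ M T ε : ℝ) (φ₀ : ℝ → ℝ) (a₀ : ℝ → ℂ), 0 < w₀ → M₁ ≤ M →
      0 < T → T < w₀ / M → hNorm w₀ (ℓ + 1) (fun x => (φ₀ x : ℂ)) ≤ R₀ → hNorm w₀ ℓ a₀ ≤ R₀ →
      ∃ p q : ℝ → ℝ → ℂ, IsStep N ε 0 T 0 p q p q ∧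
        Dom (weight w₀ (M / 2)) (Icc 0 T) (ℓ + 1) p R ∧
        Dom (weight w₀ (M / 2)) (Icc 0 T) ℓ q R ∧
        p 0 = coef (fun x => (φ₀ x : ℂ)) ∧ q 0 = coef a₀ ∧
        (∀ t ∈ Icc 0 T, ∀ x, ((synth (p t) x).re : ℂ) = synth (p t) x) ∧
        IsTheSolution N ε (weight w₀ M) T ℓ φ₀ a₀ (fun t x => (synth (p t) x).re)
          fun t => synth (q t) := by
  have hs : 0 ≤ ℓ - 1 := by linarith
  obtain ⟨μ₀, hμ₀, R, H⟩ := exists_fourier_solution N hs R₀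
  rw [show ℓ - 1 + 2 = ℓ + 1 by ring, sub_add_cancel] at H
  -- the weight used on the Fourier side decreases at the rate `M/2 ≥ μ₀`
  refine ⟨2 * μ₀, by positivity, R, fun w₀ M T ε φ₀ a₀ hw₀ hM hT0 hT hφ₀ ha₀ => ?_⟩
  have hM0 : 0 < M := by linarith
  have hw : ∀ t ∈ Icc 0 T, weight w₀ (M / 2) T ≤ weight w₀ (M / 2) t := fun t ht => by
    simp only [weight]; nlinarith [ht.2]
  have hη : 0 < weight w₀ (M / 2) T := weight_half_pos hM0 hT ⟨hT0.le, le_rfl⟩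
  have hφm : MemH w₀ (ℓ + 1) fun x => (φ₀ x : ℂ) := hφ₀.trans_lt (by simp)
  have ham : MemH w₀ ℓ a₀ := ha₀.trans_lt (by simp)
  have hw0 : weight w₀ (M / 2) 0 = w₀ := by simp [weight]
  obtain ⟨p, q, hst, hp, hq, hp0, hq0, hsym⟩ := H (M / 2) w₀ T ε _ _ (by linarith) hT0.le
    (fun t ht => (weight_half_pos hM0 hT ht).le) (measurable_coef _) (measurable_coef a₀)
    (refl_coef_of_real hφm.memLp (MemH.rapidDecay_coef hw₀ hφm))
    ((dom_coef hφm.memLp hw0).mono hφ₀) ((dom_coef ham.memLp hw0).mono ha₀)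
  have hre : ∀ t ∈ Icc 0 T, ∀ x, ((synth (p t) x).re : ℂ) = synth (p t) x := fun t ht x =>
    synth_re_of_refl (hsym t ht) x
  have hX : MemX (weight w₀ M) T ℓ (fun t x => (synth (p t) x).re) fun t => synth (q t) :=
    ⟨memY_of_dom hM0 hT (by simp) hp (fun t ht => funext (hre t ht))
      (hst.2.mono fun ξ h t ht => (h t ht).1.continuousWithinAt),
    memY_of_dom hM0 hT (by simp) hq (fun t ht => rfl)
      (hst.2.mono fun ξ h t ht => (h t ht).2.continuousWithinAt)⟩
  have hS : IsSolution N ε T φ₀ a₀ (fun t x => (synth (p t) x).re) fun t => synth (q t) := by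
    refine isSolution_of_isStep hs hη hw hst (R := R) ?_ ?_ hsym ?_ ?_
    · rwa [show ℓ - 1 + 2 = ℓ + 1 by ring]
    · rwa [sub_add_cancel]
    · rw [hp0]; exact synth_coef hφm.memLp (MemH.rapidDecay_coef hw₀ hφm)
    · rw [hq0]; exact synth_coef ham.memLp (MemH.rapidDecay_coef hw₀ ham)
  exact ⟨p, q, hst, hp, hq, hp0, hq0, hre, hX, hS,
    fun ψ b hX' hS' => IsSolution.unique hM0 hT hX hS hX' hS'⟩

/-- A solution of the limiting system is a solution of `(S_ε)` up to the source `-(iε/2) ∂ₓ²a`. -/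
lemma IsStep.with_source {N : Nonlinearity} {T ε : ℝ} {p q : ℝ → ℝ → ℂ}
    (h : IsStep N 0 0 T 0 p q p q) :
    IsStep N ε 0 T (fun t ξ => Complex.I * (ε / 2 * ξ ^ 2 : ℝ) * q t ξ) p q p q := by
  refine ⟨h.1, h.2.mono fun ξ hξ t ht => ⟨(hξ t ht).1, (hξ t ht).2.congr_deriv ?_⟩⟩
  simp only [Pi.zero_apply, zero_div, zero_mul, Complex.ofReal_zero, mul_zero, neg_zero]
  ring

/-- Stability: the contraction estimate with constant `A/μ ≤ 1/2`, applied to a solution of `(S_ε)`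
and a solution of the limiting system, improves any bound `r` on the difference to `δ + r/2`. -/
lemma exists_error_bound (N : Nonlinearity) {ℓ : ℝ} (hℓ : 1 ≤ ℓ) (R : ℝ≥0) :
    ∃ A : ℝ≥0, ∀ (w₀ μ T ε : ℝ) (p q p' q' : ℝ → ℝ → ℂ) (ρ₀ : ℝ≥0∞), 0 < μ → A ≤ μ →
      (∀ t ∈ Icc 0 T, 0 ≤ weight w₀ μ t) →
      IsStep N ε 0 T 0 p q p q → IsStep N 0 0 T 0 p' q' p' q' →
      Dom (weight w₀ μ) (Icc 0 T) (ℓ + 1) p R → Dom (weight w₀ μ) (Icc 0 T) ℓ q R →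
      Dom (weight w₀ μ) (Icc 0 T) (ℓ + 1 + 1) p' R → Dom (weight w₀ μ) (Icc 0 T) (ℓ + 1) q' R →
      Dom (weight w₀ μ) {0} (ℓ + 1) (fun t ξ => p t ξ - p' t ξ) ρ₀ →
      Dom (weight w₀ μ) {0} ℓ (fun t ξ => q t ξ - q' t ξ) ρ₀ → ∀ n : ℕ,
      Dom (weight w₀ μ) (Icc 0 T) (ℓ + 1) (fun t ξ => p t ξ - p' t ξ)
        (2⁻¹ ^ n * (2 * R) + 2 * (ρ₀ + ENNReal.ofReal μ⁻¹ * (ENNReal.ofReal |ε| * R))) ∧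
      Dom (weight w₀ μ) (Icc 0 T) ℓ (fun t ξ => q t ξ - q' t ξ)
        (2⁻¹ ^ n * (2 * R) + 2 * (ρ₀ + ENNReal.ofReal μ⁻¹ * (ENNReal.ofReal |ε| * R))) := by
  have hs : 0 ≤ ℓ - 1 := by linarith
  obtain ⟨A, H⟩ := exists_step_bound N hs R
  rw [show ℓ - 1 + 2 = ℓ + 1 by ring, sub_add_cancel] at H
  refine ⟨2 * A, fun w₀ μ T ε p q p' q' ρ₀ hμ hA hw h h' hp hq hp' hq' hp0 hq0 n => ?_⟩
  have hhalf : ENNReal.ofReal μ⁻¹ * A ≤ 2⁻¹ := by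
    rw [← ENNReal.ofReal_coe_nnreal, ← ENNReal.ofReal_mul (by positivity),
      show (2⁻¹ : ℝ≥0∞) = ENNReal.ofReal 2⁻¹ by rw [ENNReal.ofReal_inv_of_pos two_pos]; simp]
    refine ENNReal.ofReal_le_ofReal ?_
    rw [inv_mul_le_iff₀ hμ]
    push_cast at hA
    linarith
  have hsrc : Dom (weight w₀ μ) (Icc 0 T) (ℓ - 1)
      (fun t ξ => Complex.I * (ε / 2 * ξ ^ 2 : ℝ) * q' t ξ) (ENNReal.ofReal |ε| * R) := by
    rw [show ℓ + 1 = ℓ - 1 + 1 + 1 by ring] at hq'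
    refine ((hq'.mulI.mulI.const_mul (-(Complex.I * ε / 2))).mono ?_).congr
      (ae_of_all _ fun ξ t _ => ?_)
    · gcongr
      rw [← ofReal_norm]
      refine ENNReal.ofReal_le_ofReal ?_
      simp only [norm_neg, norm_div, norm_mul, Complex.norm_I, one_mul, Complex.norm_real,
        Real.norm_eq_abs]
      norm_num
    · rw [mulI_mulI]; push_cast; ring
  induction n with
  | zero =>
    have : (2⁻¹ ^ 0 * (2 * R) : ℝ≥0∞) = R + R := by rw [pow_zero, one_mul, two_mul]
    rw [this]
    exact ⟨(hp.sub (hp'.mono_exp (by linarith))).mono le_self_add,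
      (hq.sub (hq'.mono_exp (by linarith))).mono le_self_add⟩
  | succ n ih =>
    set D := ρ₀ + ENNReal.ofReal μ⁻¹ * (ENNReal.ofReal |ε| * R) with hD
    have hle : ρ₀ + ENNReal.ofReal μ⁻¹ * (A * (2⁻¹ ^ n * (2 * R) + 2 * D) +
        ENNReal.ofReal |ε| * R) ≤
        2⁻¹ ^ (n + 1) * (2 * R) + 2 * D := by
      calc _ = (ENNReal.ofReal μ⁻¹ * A) * (2⁻¹ ^ n * (2 * R) + 2 * D) + D := by rw [hD]; ring
        _ ≤ 2⁻¹ * (2⁻¹ ^ n * (2 * R) + 2 * D) + D := by gcongr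
        _ = 2⁻¹ ^ (n + 1) * (2 * R) + ((2⁻¹ * 2) * D + D) := by ring
        _ = _ := by rw [ENNReal.inv_mul_cancel (by norm_num) (by norm_num)]; ring
    have hclose : Close (weight w₀ μ) (Icc 0 T) (ℓ - 1) p q p' q' R
        (2⁻¹ ^ n * (2 * R) + 2 * D) := by
      have e1 : ℓ - 1 + 2 = ℓ + 1 := by ring
      have e2 : ℓ - 1 + 1 = ℓ := by ring
      refine ⟨?_, ?_, ?_, ?_, ?_, ?_⟩ <;> simp only [e1, e2]
      exacts [hp, hq, hp'.mono_exp (by linarith), hq'.mono_exp (by linarith), ih.1, ih.2]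
    obtain ⟨k1, k2⟩ := (H w₀ μ 0 T ε _ p q p q p' q' p' q' _ ρ₀ _ hμ hw hclose h
      h'.with_source hsrc).2 hp0 hq0
    exact ⟨k1.mono hle, k2.mono hle⟩

/-- Iterating `r ↦ δ + r/2` leaves only the fixed point `D = 2δ`. -/
lemma le_of_forall_half_pow {x R D : ℝ≥0∞} (hR : R ≠ ∞)
    (h : ∀ n : ℕ, x ≤ 4 * (2⁻¹ ^ n * R + D)) : x ≤ 4 * D := by
  refine ge_of_tendsto' (x := atTop) (f := fun n : ℕ => 4 * ((2⁻¹ : ℝ≥0∞) ^ n * R + D)) ?_ h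
  have h1 : Tendsto (fun n : ℕ => (2⁻¹ : ℝ≥0∞) ^ n) atTop (𝓝 0) :=
    ENNReal.tendsto_pow_atTop_nhds_zero_of_lt_one (by norm_num)
  have h2 := ENNReal.Tendsto.const_mul ((ENNReal.Tendsto.mul_const h1 (Or.inr hR)).add_const D)
    (Or.inr (by norm_num : (4 : ℝ≥0∞) ≠ ∞))
  simpa using h2

/-- The initial difference on the Fourier side is bounded by the norm of the difference of the
data. -/
lemma dom_coef_sub {w ℓ : ℝ} {ψ χ : ℝ → ℂ} (hψ : MemLp ψ 2 volume) (hχ : MemLp χ 2 volume)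
    {ω : ℝ → ℝ} {t : ℝ} (hω : ω t = w) {p q : ℝ → ℝ → ℂ} (hp : p t = coef ψ) (hq : q t = coef χ) :
    Dom ω {t} ℓ (fun τ ξ => p τ ξ - q τ ξ) (hNorm w ℓ fun x => ψ x - χ x) := by
  refine (dom_coef (hψ.sub hχ) hω).congr ?_
  filter_upwards [coef_sub hψ hχ] with ξ h τ hτ
  rw [mem_singleton_iff.1 hτ, hp, hq]
  exact h

end WKB

theorem theorem2 (N : WKB.Nonlinearity) (w₀ ℓ : ℝ) (hw₀ : 0 < w₀) (hℓ : 1 < ℓ)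
    (φ₀ : ℝ → ℝ) (a₀ : ℝ → ℂ)
    (hφ₀ : WKB.MemH w₀ (ℓ + 2) (fun x => (φ₀ x : ℂ))) (ha₀ : WKB.MemH w₀ (ℓ + 1) a₀)
    (φ₀ε : ℝ → ℝ → ℝ) (a₀ε : ℝ → ℝ → ℂ)
    (hbdd : ∃ R : ℝ, ∀ ε ∈ Ioc (0 : ℝ) 1,
      WKB.hNorm w₀ (ℓ + 1) (fun x => (φ₀ε ε x : ℂ)) ≤ ENNReal.ofReal R ∧
      WKB.hNorm w₀ ℓ (a₀ε ε) ≤ ENNReal.ofReal R)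
    (hconv : Tendsto (fun ε => WKB.dataError w₀ ℓ φ₀ a₀ (φ₀ε ε) (a₀ε ε)) (𝓝[>] 0) (𝓝 0)) :
    ∃ M₀ : ℝ, 0 < M₀ ∧ ∀ M : ℝ, M₀ ≤ M → ∀ T : ℝ, 0 < T → T < w₀ / M →
      ∃ (φ : ℝ → ℝ → ℝ) (a : ℝ → ℝ → ℂ) (φε : ℝ → ℝ → ℝ → ℝ) (aε : ℝ → ℝ → ℝ → ℂ),
        WKB.IsTheSolution N 0 (WKB.weight w₀ M) T (ℓ + 1) φ₀ a₀ φ a ∧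
        (∀ ε ∈ Ioc (0 : ℝ) 1,
          WKB.IsTheSolution N ε (WKB.weight w₀ M) T ℓ (φ₀ε ε) (a₀ε ε) (φε ε) (aε ε)) ∧
        ∃ C : ℝ, 0 < C ∧ ∀ ε ∈ Ioc (0 : ℝ) 1,
          WKB.tripleNorm w₀ M (ℓ + 1) T (fun t x => ((φε ε t x - φ t x : ℝ) : ℂ)) +
            WKB.tripleNorm w₀ M ℓ T (fun t x => aε ε t x - a t x) ≤
          ENNReal.ofReal C *
            (WKB.dataError w₀ ℓ φ₀ a₀ (φ₀ε ε) (a₀ε ε) + ENNReal.ofReal ε) := by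
  open WKB in
  obtain ⟨R₁, hR₁⟩ := hbdd
  set R₀ : ℝ≥0 := max (hNorm w₀ (ℓ + 2) (fun x => (φ₀ x : ℂ))).toNNReal
    (hNorm w₀ (ℓ + 1) a₀).toNNReal with hR₀
  have hR₀φ : hNorm w₀ (ℓ + 1 + 1) (fun x => (φ₀ x : ℂ)) ≤ R₀ := by
    rw [show ℓ + 1 + 1 = ℓ + 2 by ring, ← ENNReal.coe_toNNReal hφ₀.ne]
    exact_mod_cast le_max_left _ _
  have hR₀a : hNorm w₀ (ℓ + 1) a₀ ≤ R₀ := by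
    rw [← ENNReal.coe_toNNReal ha₀.ne]
    exact_mod_cast le_max_right _ _
  -- the limiting system is solved one level higher, so that `ε ∂ₓ²a` is an admissible source
  -- of size `ε`
  obtain ⟨M₁, hM₁, C₁, H₁⟩ := exists_solution N (ℓ := ℓ + 1) (by linarith) R₀
  obtain ⟨M₂, hM₂, C₂, H₂⟩ := exists_solution N (ℓ := ℓ) hℓ.le R₁.toNNReal
  obtain ⟨A, HA⟩ := exists_error_bound N hℓ.le (max C₁ C₂)
  have hC₁ : (C₁ : ℝ≥0∞) ≤ (max C₁ C₂ : ℝ≥0) := by exact_mod_cast le_max_left C₁ C₂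
  have hC₂ : (C₂ : ℝ≥0∞) ≤ (max C₁ C₂ : ℝ≥0) := by exact_mod_cast le_max_right C₁ C₂
  set R : ℝ≥0 := max C₁ C₂ with hR
  refine ⟨max (max M₁ M₂) (2 * A), lt_max_of_lt_left (lt_max_of_lt_left hM₁),
    fun M hM T hT0 hT => ?_⟩
  have hMM₁ : M₁ ≤ M := ((le_max_left _ _).trans (le_max_left _ _)).trans hM
  have hMM₂ : M₂ ≤ M := ((le_max_right _ _).trans (le_max_left _ _)).trans hM
  have hMA : 2 * A ≤ M := (le_max_right _ _).trans hM
  have hM0 : 0 < M := hM₁.trans_le hMM₁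
  have hw : ∀ t ∈ Icc 0 T, 0 ≤ weight w₀ (M / 2) t := fun t ht => (weight_half_pos hM0 hT ht).le
  have hw0 : weight w₀ (M / 2) 0 = w₀ := by simp [weight]
  obtain ⟨p, q, hst, hp, hq, hp0, hq0, hre, hsol⟩ :=
    H₁ w₀ M T 0 φ₀ a₀ hw₀ hMM₁ hT0 hT hR₀φ hR₀a
  have H₂' : ∀ ε, ∃ pq : (ℝ → ℝ → ℂ) × (ℝ → ℝ → ℂ), ε ∈ Ioc (0 : ℝ) 1 →
      IsStep N ε 0 T 0 pq.1 pq.2 pq.1 pq.2 ∧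
        Dom (weight w₀ (M / 2)) (Icc 0 T) (ℓ + 1) pq.1 C₂ ∧
        Dom (weight w₀ (M / 2)) (Icc 0 T) ℓ pq.2 C₂ ∧
        pq.1 0 = coef (fun x => (φ₀ε ε x : ℂ)) ∧ pq.2 0 = coef (a₀ε ε) ∧
        (∀ t ∈ Icc 0 T, ∀ x, ((synth (pq.1 t) x).re : ℂ) = synth (pq.1 t) x) ∧
        IsTheSolution N ε (weight w₀ M) T ℓ (φ₀ε ε) (a₀ε ε) (fun t x => (synth (pq.1 t) x).re)
          fun t => synth (pq.2 t) := fun ε => by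
    by_cases hε : ε ∈ Ioc (0 : ℝ) 1
    · obtain ⟨p, q, h⟩ := H₂ w₀ M T ε (φ₀ε ε) (a₀ε ε) hw₀ hMM₂ hT0 hT (hR₁ ε hε).1 (hR₁ ε hε).2
      exact ⟨(p, q), fun _ => h⟩
    · exact ⟨(0, 0), fun h => absurd h hε⟩
  choose pq hpq using H₂'
  refine ⟨fun t x => (synth (p t) x).re, fun t => synth (q t),
    fun ε t x => (synth ((pq ε).1 t) x).re, fun ε t => synth ((pq ε).2 t), hsol,
    fun ε hε => (hpq ε hε).2.2.2.2.2.2, 16 * (1 + (M / 2)⁻¹ * R), by positivity, fun ε hε => ?_⟩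
  obtain ⟨hst', hp', hq', hp0', hq0', hre', -⟩ := hpq ε hε
  set E := dataError w₀ ℓ φ₀ a₀ (φ₀ε ε) (a₀ε ε) with hE
  -- the estimate is void when the right-hand side is infinite
  by_cases hEtop : E = ∞
  · rw [hEtop, top_add, ENNReal.mul_top]
    · exact le_top
    · rw [Ne, ENNReal.ofReal_eq_zero, not_le]; positivity
  have hφm := hφ₀.memLp
  have ham := ha₀.memLp
  have hφεm : MemLp (fun x => (φ₀ε ε x : ℂ)) 2 volume :=
    MemH.memLp ((hR₁ ε hε).1.trans_lt ENNReal.ofReal_lt_top)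
  have haεm : MemLp (a₀ε ε) 2 volume :=
    MemH.memLp ((hR₁ ε hε).2.trans_lt ENNReal.ofReal_lt_top)
  have hdiff := HA w₀ (M / 2) T ε (pq ε).1 (pq ε).2 p q E (by positivity) (by linarith) hw hst' hst
    (hp'.mono hC₂) (hq'.mono hC₂) (hp.mono hC₁) (hq.mono hC₁)
    ((dom_coef_sub hφεm hφm hw0 hp0' hp0).mono (by
      rw [hE, dataError]
      simp only [Complex.ofReal_sub]
      exact le_self_add))
    ((dom_coef_sub haεm ham hw0 hq0' hq0).mono (by rw [hE, dataError]; exact le_add_self))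
  set D := 2 * (E + ENNReal.ofReal (M / 2)⁻¹ * (ENNReal.ofReal |ε| * R)) with hD
  have hDtop : D ≠ ∞ := by
    refine ENNReal.mul_ne_top (by norm_num) (ENNReal.add_ne_top.2 ⟨hEtop, ?_⟩)
    exact ENNReal.mul_ne_top ENNReal.ofReal_ne_top
      (ENNReal.mul_ne_top ENNReal.ofReal_ne_top (by simp))
  have hrtop : ∀ n : ℕ, (2⁻¹ ^ n * (2 * R) + D : ℝ≥0∞) ≠ ∞ := fun n =>
    ENNReal.add_ne_top.2 ⟨ENNReal.mul_ne_top (ENNReal.pow_ne_top (by norm_num))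
      (ENNReal.mul_ne_top (by norm_num) (by simp)), hDtop⟩
  have hint : ∀ {s : ℝ} {f : ℝ → ℝ → ℂ} {K : ℝ≥0},
      Dom (weight w₀ (M / 2)) (Icc 0 T) s f K → ∀ t ∈ Icc 0 T, Integrable (f t) :=
    fun h t ht => (h.rapidDecay (by simp) ht (weight_half_pos hM0 hT ht)).integrable
  have b1 : tripleNorm w₀ M (ℓ + 1) T
      (fun t x => (((synth ((pq ε).1 t) x).re - (synth (p t) x).re : ℝ) : ℂ)) ≤ 4 * D := by
    refine le_of_forall_half_pow (R := 2 * R) (ENNReal.mul_ne_top (by norm_num) (by simp))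
      fun n => tripleNorm_le hM0 hT (hrtop n) (hdiff n).1 fun t ht => ?_
    ext x
    rw [Complex.ofReal_sub, hre' t ht, hre t ht, synth_sub (hint hp' t ht) (hint hp t ht)]
  have b2 : tripleNorm w₀ M ℓ T (fun t x => synth ((pq ε).2 t) x - synth (q t) x) ≤ 4 * D := by
    refine le_of_forall_half_pow (R := 2 * R) (ENNReal.mul_ne_top (by norm_num) (by simp))
      fun n => tripleNorm_le hM0 hT (hrtop n) (hdiff n).2 fun t ht => ?_
    ext x
    rw [synth_sub (hint hq' t ht) (hint hq t ht)]
  calc _ ≤ 4 * D + 4 * D := add_le_add b1 b2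
    _ = 16 * (1 * E + (ENNReal.ofReal (M / 2)⁻¹ * R) * ENNReal.ofReal ε) := by
      rw [hD, abs_of_pos hε.1]; ring
    _ ≤ 16 * ((1 + ENNReal.ofReal (M / 2)⁻¹ * R) * E +
          (1 + ENNReal.ofReal (M / 2)⁻¹ * R) * ENNReal.ofReal ε) := by
      gcongr
      · exact le_self_add
      · exact le_add_self
    _ = _ := by
      rw [ENNReal.ofReal_mul (by norm_num), ENNReal.ofReal_add (by norm_num) (by positivity),
        ENNReal.ofReal_mul (by positivity), ENNReal.ofReal_coe_nnreal]
      simp only [ENNReal.ofReal_one, ENNReal.ofReal_ofNat]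
      ring

end
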